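/- Theorem. Let $\Sigma$ be a finite set with at least two elements. For $S\subseteq\Sigma\times\Sigma\times\Sigma$ let $S_{xy}=\{(x,y):\exists z,\ (x,y,z)\in S\}$, and define $S_{xz}$ and $S_{yz}$ likewise. Call $S$ pairwise-connected if each of the three bipartite graphs on the disjoint union of two copies of $\Sigma$ with edge sets $S_{xy}$, $S_{xz}$, $S_{yz}$ is connected. (1) There are constants $c_\Sigma,C_\Sigma>0$, depending only on $\Sigma$, such that the following holds. Let $S\subseteq\Sigma^3$ be pairwise-connected with $(x,x,x)\in S$ for all $x\in\Sigma$, let $n\ge 16$ (so that $\log\log\log n>0$, where $\log$ is the natural logarithm), and let $A\subseteq\Sigma^n$ satisfy $$\frac{|A|}{|\Sigma|^n}\ \ge\ \frac{C_\Sigma}{(\log\log\log n)^{c_\Sigma}}.$$ Then there are $x,y,z\in A$, not all equal, such that $(x_i,y_i,z_i)\in S$ for all $i\in\{1,\dots,n\}$. (2) In particular, for every prime $p\ge 3$ there are constants $c_p,C_p>0$ such that for every $n\ge 16$, every $A\subseteq\mathbb{F}_p^n$ with $|A|/p^n\ge C_p(\log\log\log n)^{-c_p}$ contains a restricted $3$-term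 arithmetic progression, that is, $x,\,x+a,\,x+2a\in A$ for some $x\in\mathbb{F}_p^n$ and some $a\in\{0,1\}^n\setminus\{\vec 0\}$. -/

import Mathlib

/-- The bipartite graph on the disjoint union of `α` and `β` whose edges are the pairs in `R`. -/
def bipartiteGraph {α β : Type*} (R : Set (α × β)) : SimpleGraph (α ⊕ β) where
  Adj u v := (∃ a b, (a, b) ∈ R ∧ u = Sum.inl a ∧ v = Sum.inr b) ∨
    (∃ a b, (a, b) ∈ R ∧ u = Sum.inr b ∧ v = Sum.inl a)
  symm := by
    constructor
    rintro u v (⟨a, b, h, hu, hv⟩ | ⟨a, b, h, hu, hv⟩)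
    · exact Or.inr ⟨a, b, h, hv, hu⟩
    · exact Or.inl ⟨a, b, h, hv, hu⟩
  loopless := by
    constructor
    rintro u (⟨a, b, _, hu, hv⟩ | ⟨a, b, _, hu, hv⟩) <;> simp [hu] at hv

/-- The projection of a set of triples to the first and second coordinates. -/
def projXY {α β γ : Type*} (S : Set (α × β × γ)) : Set (α × β) :=
  {q | ∃ z, (q.1, q.2, z) ∈ S}

/-- The projection of a set of triples to the first and third coordinates. -/
def projXZ {α β γ : Type*} (S : Set (α × β × γ)) : Set (α × γ) :=
  {q | ∃ y, (q.1, y, q.2) ∈ S}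

/-- The projection of a set of triples to the second and third coordinates. -/
def projYZ {α β γ : Type*} (S : Set (α × β × γ)) : Set (β × γ) :=
  {q | ∃ x, (x, q.1, q.2) ∈ S}

/-- The bipartite graphs spanned by the three pairwise projections of `S` are all connected. -/
def PairwiseConnected {α β γ : Type*} (S : Set (α × β × γ)) : Prop :=
  (bipartiteGraph (projXY S)).Connected ∧
  (bipartiteGraph (projXZ S)).Connected ∧
  (bipartiteGraph (projYZ S)).Connected

open Finset Function
open scoped BigOperators
set_option linter.unusedSectionVars false

namespace TripleDensity

/-! ### Averages over finite product spaces. -/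

section Average
variable {X Y ι α : Type*}

/-! The proof is a density increment. Let A have density δ and contain only trivial triples, and let
f be the indicator of A minus δ. Fix a non-diagonal triple of S. After a random permutation of the
coordinates, one coordinate carries this triple, 2N coordinates carry independent uniform elements
of S, and every other coordinate carries the same random letter in all three points. The three
points then form a nontrivial triple, so the product of their three indicators is always 0.
Replacing first the middle and then the first indicator by f + δ writes this product as T₁ + δ T₂ +
δ² 1_A(z), where T₁ and T₂ contain a factor f. Planting few letters at random places hardly changes
a mean (`abs_expect_labelPoint_sub_le`), so the last term contributes at least δ³ / 2, and T₁ or T₂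
has an average of size at least δ³ / 4 (`exists_parameters`).

Split the 2N coordinates into halves I and J. One application of Cauchy–Schwarz removes the first
function by resampling on I, another the third function by resampling on J; a box average of f for
certain product kernels is left. Further applications lengthen the walks described by these kernels
until connectivity makes them positive everywhere (`pow_trilinear_le_kbox_linkKernel`,
`exists_linkKernel_pos`). A positive kernel is a mixture with a uniform part, so f has a large
average box norm on random restrictions (`pow_le_of_ubox_le`).

A large box norm yields a large mean on a combinatorial subspace (`exists_subpoint_of_boxNorm`). The
covariance of f on one side of the partition has an eigenvector e with a large eigenvalue Λ. The
correlation of f with e, as a function of the other coordinates, keeps being an approximate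
eigenvector of the complementary covariance when a few coordinates are fixed. The large eigenvalues
are boundedly many, so among many ways to fix a group of coordinates two give nearly the same
function: flipping some segment of the group has small influence. Pigeonholing over many groups and
applying an Efron–Stein inequality, the correlation keeps its norm when it is averaged over letters
constant on s such segments. Hence the averages of f over these s-dimensional subspaces have a large
second moment; as their mean is hardly negative, one of them is large and positive.

So density at least 1 / D grows by D ^ (-K) on a subspace of dimension s as soon as the dimension is
at least (s D) ^ (D ^ K) (`exists_density_increment`). At most D ^ K increments are possible, which
bounds the dimension (`exists_dense_triple`). -/

lemma expect_expect_eq_prod [Fintype X] [Fintype Y] (h : X → Y → ℝ) :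
    𝔼 x, 𝔼 y, h x y = 𝔼 p : X × Y, h p.1 p.2 := by
  rw [← Finset.univ_product_univ, Finset.expect_product]

lemma expect_fst [Fintype X] [Fintype Y] [Nonempty Y] (h : X → ℝ) :
    𝔼 p : X × Y, h p.1 = 𝔼 x, h x := by
  rw [← expect_expect_eq_prod (fun x _ => h x)]
  simp only [Fintype.expect_const]

/-- Averaging over the values of a random point on a set of coordinates does nothing to the mean. -/
lemma expect_piecewise [Fintype ι] [DecidableEq ι] [Fintype α] [Nonempty α] (K : Finset ι)
    (h : (ι → α) → ℝ) : 𝔼 x, 𝔼 y, h (K.piecewise x y) = 𝔼 x, h x := by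
  rw [expect_expect_eq_prod (fun x y => h (K.piecewise x y)), ← expect_fst (Y := ι → α) h]
  -- Exchanging the two points outside `K` is an involution on pairs.
  let e : ((ι → α) × (ι → α)) → ((ι → α) × (ι → α)) :=
    fun p => (K.piecewise p.1 p.2, K.piecewise p.2 p.1)
  have he : Involutive e := by
    rintro ⟨x, y⟩
    ext i <;> by_cases hi : i ∈ K <;> simp [e, hi]
  exact Fintype.expect_bijective e he.bijective _ _ (fun _ => rfl)

lemma expect_piecewise' [Fintype ι] [DecidableEq ι] [Fintype α] [Nonempty α] (K : Finset ι)
    (h : (ι → α) → ℝ) : 𝔼 y, 𝔼 x, h (K.piecewise x y) = 𝔼 x, h x := by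
  rw [Finset.expect_comm, expect_piecewise]

/-- Exchanging `y` with the letters of `x` on the range of `e` is an involution on pairs. -/
lemma expect_extend [Fintype X] [Fintype ι] [DecidableEq X] [DecidableEq ι] [Fintype α] [Nonempty α]
    {e : X → ι} (he : Injective e) (h : (ι → α) → ℝ) :
    𝔼 x, 𝔼 y : X → α, h (extend e y x) = 𝔼 x, h x := by
  rw [expect_expect_eq_prod (fun x y => h (extend e y x)), ← expect_fst (Y := X → α) h]
  let t : ((ι → α) × (X → α)) → ((ι → α) × (X → α)) := fun p => (extend e p.2 p.1, p.1 ∘ e)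
  have ht : Involutive t := by
    rintro ⟨x, y⟩
    refine Prod.ext (funext fun i => ?_) (funext fun k => ?_)
    · by_cases hi : ∃ k, e k = i
      · obtain ⟨k, rfl⟩ := hi
        simp [t, he.extend_apply]
      · simp [t, extend_apply' _ _ _ hi]
    · simp [t, he.extend_apply]
  exact Fintype.expect_bijective t ht.bijective _ _ (fun _ => rfl)

lemma expect_comp_injective [Fintype X] [Fintype ι] [DecidableEq X] [DecidableEq ι] [Fintype α]
    [Nonempty α] {e : X → ι} (he : Injective e) (h : (X → α) → ℝ) :
    𝔼 x : ι → α, h (x ∘ e) = 𝔼 y, h y := by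
  rw [← expect_extend he]
  have : ∀ x : ι → α, ∀ y : X → α, h (extend e y x ∘ e) = h y := fun x y => by
    congr 1; funext k; simp [he.extend_apply]
  simp only [this, Fintype.expect_const]

lemma sq_expect_le [Fintype X] (f : X → ℝ) : (𝔼 x, f x) ^ 2 ≤ 𝔼 x, f x ^ 2 := by
  rcases isEmpty_or_nonempty X with hX | hX
  · simp
  · have := expect_mul_sq_le_sq_mul_sq (univ : Finset X) f (fun _ => (1 : ℝ))
    simpa using this

lemma expect_mul_sq_le [Fintype X] (f g : X → ℝ) :
    (𝔼 x, f x * g x) ^ 2 ≤ (𝔼 x, f x ^ 2) * 𝔼 x, g x ^ 2 :=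
  expect_mul_sq_le_sq_mul_sq _ f g

lemma abs_expect_le_of_le [Fintype X] {f : X → ℝ} {B : ℝ} (hB : 0 ≤ B) (h : ∀ x, |f x| ≤ B) :
    |𝔼 x, f x| ≤ B := by
  rcases isEmpty_or_nonempty X with hX | hX
  · simpa
  · exact (abs_expect_le _ _).trans (expect_le univ_nonempty fun x _ => h x)

lemma expect_le_of_le [Fintype X] {f : X → ℝ} {B : ℝ} (hB : 0 ≤ B) (h : ∀ x, f x ≤ B) :
    𝔼 x, f x ≤ B := by
  rcases isEmpty_or_nonempty X with hX | hX
  · simpa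
  · exact expect_le univ_nonempty fun x _ => h x

lemma expect_mono [Fintype X] {f g : X → ℝ} (h : ∀ x, f x ≤ g x) : 𝔼 x, f x ≤ 𝔼 x, g x :=
  expect_le_expect fun x _ => h x

lemma expect_nonneg' [Fintype X] {f : X → ℝ} (h : ∀ x, 0 ≤ f x) : 0 ≤ 𝔼 x, f x :=
  expect_nonneg fun x _ => h x

lemma expect_equiv_perm [Fintype X] (e : X ≃ X) (f : X → ℝ) : 𝔼 x, f (e x) = 𝔼 x, f x :=
  Fintype.expect_equiv e _ _ fun _ => rfl

end Average

/-! ### Bessel's inequality for single coordinates. -/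

section Bessel
variable {ι α : Type*} [Fintype ι] [DecidableEq ι] [Fintype α] [DecidableEq α] [Nonempty α]

/-- Fixing a coordinate to `a` is the same as reweighting by a normalized indicator. -/
lemma expect_update (g : (ι → α) → ℝ) (e : ι) (a : α) :
    𝔼 x, g (update x e a) = 𝔼 x, g x * (if x e = a then (Fintype.card α : ℝ) else 0) := by
  have hq : (Fintype.card α : ℝ) ≠ 0 := by simp
  rw [← expect_piecewise' {e} (fun x => g x * (if x e = a then (Fintype.card α : ℝ) else 0))]
  congr 1; funext y
  have h1 : ∀ x : ι → α, ({e} : Finset ι).piecewise x y = update y e (x e) := fun x =>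
    piecewise_singleton _ _ _
  simp only [h1, update_self]
  refine Eq.trans ?_ (expect_comp_injective (e := fun _ : Unit => e) (fun _ _ _ => rfl)
    (fun z : Unit → α => g (update y e (z ())) * if z () = a then (Fintype.card α : ℝ) else 0)).symm
  rw [Fintype.expect_equiv (Equiv.funUnique Unit α) _
    (fun b => g (update y e b) * if b = a then (Fintype.card α : ℝ) else 0) (fun z => by
      simp [Equiv.funUnique])]
  rw [Fintype.expect_eq_sum_div_card]
  simp only [mul_ite, mul_zero, Finset.sum_ite_eq', Finset.mem_univ, if_true]
  field_simp

lemma expect_normalized_mul {e e' : ι} (h : e ≠ e') (a b : α) :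
    𝔼 x : ι → α, ((if x e = a then (Fintype.card α : ℝ) else 0) - 1) *
      ((if x e' = b then (Fintype.card α : ℝ) else 0) - 1) = 0 := by
  have h1 := expect_update (fun x : ι → α => (if x e = a then (Fintype.card α : ℝ) else 0) - 1) e' b
  have h2 := expect_update (fun _ : ι → α => (1 : ℝ)) e a
  simp only [update_of_ne h] at h1
  simp only [Fintype.expect_const, one_mul] at h2
  simp only [mul_sub, mul_one, expect_sub_distrib]
  rw [← h1, expect_sub_distrib, ← h2]
  simp

lemma expect_normalized_sq (e : ι) (a : α) :
    𝔼 x : ι → α, (((if x e = a then (Fintype.card α : ℝ) else 0) - 1) ^ 2 : ℝ) =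
      (Fintype.card α : ℝ) - 1 := by
  have h1 := expect_update (fun x : ι → α => (if x e = a then (Fintype.card α : ℝ) else 0) - 1) e a
  have h2 := expect_update (fun _ : ι → α => (1 : ℝ)) e a
  simp only [Fintype.expect_const, one_mul, update_self, if_true] at h1 h2
  simp only [sq, mul_sub, mul_one, expect_sub_distrib] at h1 ⊢
  rw [← h1, ← h2]
  simp

/-- Bessel's inequality: a bounded function is nearly uncorrelated with most single coordinates. -/
lemma sum_sq_expect_update_sub_le (Q : Finset ι) (g : (ι → α) → ℝ) (a : α) :
    ∑ e ∈ Q, (𝔼 x, g (update x e a) - 𝔼 x, g x) ^ 2 ≤ (Fintype.card α : ℝ) * 𝔼 x, g x ^ 2 := by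
  set q : ℝ := (Fintype.card α : ℝ) with hq
  have hq1 : 1 ≤ q := by
    rw [hq]; exact_mod_cast Fintype.card_pos
  -- For different `e` these functions are orthogonal, each with mean square q − 1.
  let ψ : ι → (ι → α) → ℝ := fun e x => (if x e = a then q else 0) - 1
  let β : ι → ℝ := fun e => 𝔼 x, g x * ψ e x
  have hβ : ∀ e, 𝔼 x, g (update x e a) - 𝔼 x, g x = β e := fun e => by
    rw [expect_update g e a, ← expect_sub_distrib]
    simp only [β, ψ, mul_sub, mul_one, hq]
  simp only [hβ]
  set B := ∑ e ∈ Q, β e ^ 2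
  have hcross : 𝔼 x, g x * ∑ e ∈ Q, β e * ψ e x = B := by
    simp only [Finset.mul_sum, expect_sum_comm]
    refine Finset.sum_congr rfl fun e _ => ?_
    have : ∀ x, g x * (β e * ψ e x) = β e * (g x * ψ e x) := fun x => by ring
    simp only [this, ← mul_expect, sq]
    rfl
  have hsq : 𝔼 x, (∑ e ∈ Q, β e * ψ e x) ^ 2 = (q - 1) * B := by
    have : ∀ x, (∑ e ∈ Q, β e * ψ e x) ^ 2 =
        ∑ e ∈ Q, ∑ e' ∈ Q, (β e * β e') * (ψ e x * ψ e' x) := fun x => by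
      rw [sq, Finset.sum_mul_sum]
      refine Finset.sum_congr rfl fun e _ => Finset.sum_congr rfl fun e' _ => by ring
    simp only [this, expect_sum_comm, ← mul_expect]
    rw [Finset.mul_sum]
    refine Finset.sum_congr rfl fun e he => ?_
    rw [Finset.sum_eq_single e]
    · have := expect_normalized_sq (ι := ι) e a
      simp only [sq] at this
      simp only [ψ, hq]
      rw [this]; ring
    · intro e' _ hne
      have := expect_normalized_mul (α := α) (Ne.symm hne) a a
      simp only [ψ, hq]
      rw [this]; ring
    · exact fun h => absurd he h
  -- The factor q⁻¹ instead of the optimal (q − 1)⁻¹ also covers q = 1.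
  have hpos : 0 ≤ 𝔼 x, (g x - q⁻¹ * ∑ e ∈ Q, β e * ψ e x) ^ 2 := expect_nonneg' fun x => sq_nonneg _
  have hexp : 𝔼 x, (g x - q⁻¹ * ∑ e ∈ Q, β e * ψ e x) ^ 2 =
      𝔼 x, g x ^ 2 - 2 * q⁻¹ * B + q⁻¹ ^ 2 * ((q - 1) * B) := by
    have : ∀ x, (g x - q⁻¹ * ∑ e ∈ Q, β e * ψ e x) ^ 2 =
        g x ^ 2 - 2 * q⁻¹ * (g x * ∑ e ∈ Q, β e * ψ e x) +
          q⁻¹ ^ 2 * (∑ e ∈ Q, β e * ψ e x) ^ 2 := fun x => by ring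
    simp only [this, expect_add_distrib, expect_sub_distrib, ← mul_expect, hcross, hsq]
  rw [hexp] at hpos
  have hB : 0 ≤ B := Finset.sum_nonneg fun _ _ => sq_nonneg _
  have h3 : q⁻¹ * B ≤ 2 * q⁻¹ * B - q⁻¹ ^ 2 * ((q - 1) * B) := by
    have : 2 * q⁻¹ * B - q⁻¹ ^ 2 * ((q - 1) * B) - q⁻¹ * B = q⁻¹ ^ 2 * B := by
      field_simp; ring
    have h4 : 0 ≤ q⁻¹ ^ 2 * B := by positivity
    linarith
  have h5 : q⁻¹ * B ≤ 𝔼 x, g x ^ 2 := by linarith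
  rwa [inv_mul_le_iff₀ (by linarith)] at h5

end Bessel

/-! ### Planting letters at random coordinates. -/

section Planting
variable {ι α : Type*} [Fintype ι] [DecidableEq ι] [Fintype α] [DecidableEq α] [Nonempty α]

/-- The function `F` read in coordinates permuted by `τ`. -/
def relabel (τ : Equiv.Perm ι) (F : (ι → α) → ℝ) : (ι → α) → ℝ := fun x => F (x ∘ τ)

omit [Fintype ι] [Fintype α] [DecidableEq α] [Nonempty α] [DecidableEq ι] in
lemma relabel_mul (σ τ : Equiv.Perm ι) (F : (ι → α) → ℝ) :
    relabel (σ * τ) F = fun x => relabel τ F (x ∘ σ) := rfl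

/-- The functional `g` commutes with transpositions of a coordinate in `K` and one in `Q`. -/
def SwapEquivariant (g : ((ι → α) → ℝ) → (ι → α) → ℝ) (K Q : Finset ι) : Prop :=
  ∀ F, ∀ e ∈ K, ∀ e' ∈ Q, ∀ x,
    g (fun y => F (y ∘ Equiv.swap e e')) x = g F (x ∘ Equiv.swap e e')

omit [Fintype ι] [Fintype α] [DecidableEq α] [Nonempty α] in
lemma SwapEquivariant.mono {g : ((ι → α) → ℝ) → (ι → α) → ℝ} {K K' Q : Finset ι}
    (h : SwapEquivariant g K Q) (hK : K' ⊆ K) : SwapEquivariant g K' Q :=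
  fun F e he e' he' x => h F e (hK he) e' he' x

omit [Fintype ι] [Fintype α] [DecidableEq α] [Nonempty α] in
lemma update_comp_swap (x : ι → α) (e e' : ι) (a : α) :
    update x e a ∘ Equiv.swap e e' = update (x ∘ Equiv.swap e e') e' a := by
  funext i
  by_cases h : i = e'
  · subst h; simp
  · rw [update_of_ne h]
    have : Equiv.swap e e' i ≠ e := by
      intro h2
      apply h
      rw [Equiv.swap_apply_eq_iff] at h2
      simpa using h2
    simp [comp, update_of_ne this]

omit [DecidableEq ι] [DecidableEq α] [Nonempty α] in
lemma expect_comp_perm [DecidableEq ι] (σ : Equiv.Perm ι) (h : (ι → α) → ℝ) :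
    𝔼 x : ι → α, h (x ∘ σ) = 𝔼 x, h x :=
  expect_equiv_perm (Equiv.arrowCongr σ.symm (Equiv.refl α)) h

/-- Composing the random permutation with a transposition shows that every coordinate of `Q` has the
same expected effect as `e`. The effect of `e` is therefore an average over `Q`, which Bessel's
inequality and Cauchy–Schwarz make small. -/
lemma expect_perm_update_sub_le {g : ((ι → α) → ℝ) → (ι → α) → ℝ} {B : ℝ} (hB : 0 ≤ B)
    {e : ι} {Q : Finset ι} (hQ : Q.Nonempty) (hg : SwapEquivariant g {e} Q) (F : (ι → α) → ℝ)
    (hgB : ∀ τ x, |g (relabel τ F) x| ≤ B) (a : α) :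
    𝔼 τ : Equiv.Perm ι, |𝔼 x, g (relabel τ F) (update x e a) - 𝔼 x, g (relabel τ F) x| ≤
      B * √(Fintype.card α / #Q) := by
  have hQ0 : (0 : ℝ) < #Q := by exact_mod_cast hQ.card_pos
  have hswap : ∀ e' ∈ Q,
      𝔼 τ : Equiv.Perm ι, |𝔼 x, g (relabel τ F) (update x e a) - 𝔼 x, g (relabel τ F) x| =
      𝔼 τ : Equiv.Perm ι, |𝔼 x, g (relabel τ F) (update x e' a) - 𝔼 x, g (relabel τ F) x| := by
    intro e' he'
    rw [← expect_equiv_perm (Equiv.mulLeft (Equiv.swap e e'))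
      (fun τ : Equiv.Perm ι => |𝔼 x, g (relabel τ F) (update x e a) - 𝔼 x, g (relabel τ F) x|)]
    congr 1; funext τ
    have h1 : ∀ x, g (relabel (Equiv.swap e e' * τ) F) x =
        g (relabel τ F) (x ∘ Equiv.swap e e') := fun x => by
      rw [relabel_mul]
      exact hg (relabel τ F) e (by simp) e' he' x
    simp only [Equiv.coe_mulLeft, h1, update_comp_swap]
    rw [expect_comp_perm (Equiv.swap e e') (fun x => g (relabel τ F) (update x e' a)),
      expect_comp_perm (Equiv.swap e e') (fun x => g (relabel τ F) x)]
  have havg : 𝔼 τ : Equiv.Perm ι,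
      |𝔼 x, g (relabel τ F) (update x e a) - 𝔼 x, g (relabel τ F) x| =
      𝔼 τ : Equiv.Perm ι, (∑ e' ∈ Q,
        |𝔼 x, g (relabel τ F) (update x e' a) - 𝔼 x, g (relabel τ F) x|) / #Q := by
    rw [← expect_div, expect_sum_comm, ← Finset.sum_congr rfl hswap, Finset.sum_const,
      nsmul_eq_mul, mul_div_cancel_left₀ _ hQ0.ne']
  rw [havg]
  refine expect_le_of_le (by positivity) fun τ => ?_
  have hb := sum_sq_expect_update_sub_le Q (g (relabel τ F)) a
  have hg2 : 𝔼 x, g (relabel τ F) x ^ 2 ≤ B ^ 2 :=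
    expect_le_of_le (by positivity) fun x => sq_le_sq' (by linarith [abs_le.1 (hgB τ x)])
      (abs_le.1 (hgB τ x)).2
  have hcs := sq_sum_le_card_mul_sum_sq (s := Q)
    (f := fun e' => |𝔼 x, g (relabel τ F) (update x e' a) - 𝔼 x, g (relabel τ F) x|)
  simp only [sq_abs] at hcs
  rw [div_le_iff₀ hQ0]
  refine (Real.le_sqrt_of_sq_le (y := #Q * (Fintype.card α * B ^ 2)) ?_).trans ?_
  · refine hcs.trans ?_
    gcongr
    refine hb.trans ?_
    gcongr
  · refine Real.sqrt_le_iff.2 ⟨by positivity, ?_⟩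
    rw [mul_pow, mul_pow, Real.sq_sqrt (by positivity)]
    refine le_of_eq ?_
    field_simp

/-- Fixing the coordinates of a small set at given values hardly changes a mean, on average over
all arrangements of the coordinates. -/
lemma expect_perm_piecewise_sub_le {g : ((ι → α) → ℝ) → (ι → α) → ℝ} {B : ℝ} (hB : 0 ≤ B)
    {K Q : Finset ι} (hQ : Q.Nonempty) (hKQ : Disjoint K Q) (hg : SwapEquivariant g K Q)
    (F : (ι → α) → ℝ) (hgB : ∀ τ x, |g (relabel τ F) x| ≤ B) (w : ι → α) :
    𝔼 τ : Equiv.Perm ι, |𝔼 x, g (relabel τ F) (K.piecewise w x) - 𝔼 x, g (relabel τ F) x| ≤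
      #K * (B * √(Fintype.card α / #Q)) := by
  induction K using Finset.induction_on with
  | empty => simp
  | insert e K he ih =>
    have hKQ' : Disjoint K Q := hKQ.mono_left (subset_insert _ _)
    have heQ : e ∉ Q := fun h => (disjoint_left.1 hKQ) (mem_insert_self _ _) h
    have ih := ih hKQ' (hg.mono (subset_insert _ _))
    -- The coordinates are fixed one at a time. With `K` already fixed the functional remains
    -- equivariant for swaps of `e` with `Q`, as these do not touch `K`.
    let g' : ((ι → α) → ℝ) → (ι → α) → ℝ := fun F x => g F (K.piecewise w x)
    have hg' : SwapEquivariant g' {e} Q := by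
      intro F e₁ he₁ e' he' x
      rw [mem_singleton] at he₁
      subst he₁
      change g _ _ = g _ _
      rw [hg F e₁ (mem_insert_self _ _) e' he']
      congr 1
      funext i
      have he'K : e' ∉ K := fun h => (disjoint_left.1 hKQ') h he'
      by_cases hi : i ∈ K
      · have h1 : i ≠ e₁ := fun h => he (h ▸ hi)
        have h2 : i ≠ e' := fun h => he'K (h ▸ hi)
        simp [Equiv.swap_apply_of_ne_of_ne h1 h2, hi]
      · have : Equiv.swap e₁ e' i ∉ K := by
          rcases Equiv.swap_apply_eq_iff.1 (rfl : Equiv.swap e₁ e' i = _) with h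
          by_cases h1 : i = e₁
          · subst h1; simpa using he'K
          · by_cases h2 : i = e'
            · subst h2; simpa using he
            · rwa [Equiv.swap_apply_of_ne_of_ne h1 h2]
        simp [hi, this]
    have h1 := expect_perm_update_sub_le hB hQ hg' F (fun τ x => hgB τ _) (w e)
    have hpw : ∀ x : ι → α, (insert e K).piecewise w x = K.piecewise w (update x e (w e)) := by
      intro x
      rw [piecewise_insert]
      funext i
      by_cases h : i = e
      · subst h; simp [he]
      · by_cases hi : i ∈ K <;> simp [h, hi]
    have h2 : ∀ τ : Equiv.Perm ι,
        |𝔼 x, g (relabel τ F) ((insert e K).piecewise w x) - 𝔼 x, g (relabel τ F) x| ≤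
        |𝔼 x, g' (relabel τ F) (update x e (w e)) - 𝔼 x, g' (relabel τ F) x| +
        |𝔼 x, g (relabel τ F) (K.piecewise w x) - 𝔼 x, g (relabel τ F) x| := by
      intro τ
      simp only [hpw, g']
      exact abs_sub_le _ _ _
    refine (expect_mono h2).trans ?_
    rw [expect_add_distrib, card_insert_of_notMem he]
    push_cast
    linarith

end Planting

/-! ### Spectral theory of covariance kernels. -/

section Spectral
variable {X Y A : Type*} [Fintype X] [DecidableEq X] [Nonempty X] [Fintype Y]

/-- The spectral theorem for real symmetric kernels, with respect to normalized averages. -/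
lemma exists_spectral_decomposition (k : X → X → ℝ) (hk : ∀ x y, k x y = k y x) :
    ∃ (b : X → X → ℝ) (l : X → ℝ), (∀ j, 𝔼 x, b j x ^ 2 = 1) ∧
      (∀ j x, 𝔼 y, k x y * b j y = l j * b j x) ∧
      (∀ φ : X → ℝ, 𝔼 x, φ x ^ 2 = ∑ j, (𝔼 x, φ x * b j x) ^ 2) := by
  set N : ℝ := (Fintype.card X : ℝ) with hN
  have hN0 : 0 < N := by rw [hN]; exact_mod_cast Fintype.card_pos
  have hs : √N ^ 2 = N := Real.sq_sqrt hN0.le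
  have hs0 : √N ≠ 0 := (Real.sqrt_pos.2 hN0).ne'
  let M : Matrix X X ℝ := Matrix.of fun x y => k x y / N
  have hM : M.IsHermitian := by
    ext x y
    simp [M, hk x y]
  let v := hM.eigenvectorBasis
  have hpars : ∀ φ : X → ℝ, ∑ x, φ x ^ 2 = ∑ j, (∑ x, φ x * v j x) ^ 2 := by
    intro φ
    have h1 := v.sum_sq_norm_inner_right (WithLp.toLp 2 φ)
    simp only [EuclideanSpace.norm_sq_eq, Real.norm_eq_abs, sq_abs, PiLp.inner_apply,
      RCLike.inner_apply, conj_trivial] at h1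
    exact h1.symm
  have hv : ∀ j, ∑ x, v j x ^ 2 = 1 := by
    intro j
    have h1 : ‖v j‖ ^ 2 = 1 := by rw [v.orthonormal.1 j]; norm_num
    rw [EuclideanSpace.norm_sq_eq] at h1
    simpa only [Real.norm_eq_abs, sq_abs] using h1
  refine ⟨fun j x => √N * v j x, hM.eigenvalues, fun j => ?_, fun j x => ?_, fun φ => ?_⟩
  · simp only [mul_pow, hs]
    rw [Fintype.expect_eq_sum_div_card, ← Finset.mul_sum, hv, ← hN]
    field_simp
  · have h1 := congrFun (hM.mulVec_eigenvectorBasis j) x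
    simp only [Matrix.mulVec, dotProduct, Pi.smul_apply, smul_eq_mul] at h1
    rw [Fintype.expect_eq_sum_div_card, ← hN]
    have h2 : (∑ y, k x y * (√N * v j y)) / N = √N * ∑ y, M x y * v j y := by
      rw [Finset.sum_div, Finset.mul_sum]
      refine Finset.sum_congr rfl fun y _ => ?_
      simp only [M, Matrix.of_apply]; ring
    rw [h2]
    have h3 : ∑ y, M x y * v j y = hM.eigenvalues j * v j x := h1
    rw [h3]; ring
  · rw [Fintype.expect_eq_sum_div_card, ← hN, hpars, Finset.sum_div]
    refine Finset.sum_congr rfl fun j _ => ?_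
    rw [Fintype.expect_eq_sum_div_card, ← hN]
    have h2 : ∑ x, φ x * (√N * v j x) = √N * ∑ x, φ x * v j x := by
      rw [Finset.mul_sum]
      exact Finset.sum_congr rfl fun y _ => by ring
    rw [h2, div_pow, mul_pow, hs]
    field_simp

lemma expect_mul_expect_comm (k : X → X → ℝ) (φ ψ : X → ℝ) :
    𝔼 x, φ x * 𝔼 y, k x y * ψ y = 𝔼 y, ψ y * 𝔼 x, k x y * φ x := by
  simp only [mul_expect]
  rw [Finset.expect_comm]
  refine Finset.expect_congr rfl fun y _ => Finset.expect_congr rfl fun x _ => by ring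

/-- The spectral decomposition of a covariance kernel of functions bounded by one. -/
lemma exists_spectral_decomposition_covariance (H : Y → X → ℝ) (hH : ∀ y x, |H y x| ≤ 1) :
    ∃ (b : X → X → ℝ) (l : X → ℝ), (∀ j, 𝔼 x, b j x ^ 2 = 1) ∧
      (∀ j x, 𝔼 x', (𝔼 y, H y x * H y x') * b j x' = l j * b j x) ∧
      (∀ φ : X → ℝ, 𝔼 x, φ x ^ 2 = ∑ j, (𝔼 x, φ x * b j x) ^ 2) ∧
      (∀ j, 0 ≤ l j) ∧ ∑ j, l j ≤ 1 ∧
      ∑ j, l j ^ 2 = 𝔼 x, 𝔼 x', (𝔼 y, H y x * H y x') ^ 2 := by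
  obtain ⟨b, l, hb, hl, hp⟩ := exists_spectral_decomposition (fun x x' => 𝔼 y, H y x * H y x')
    (fun x y => by simp only [mul_comm])
  -- The Rayleigh quotient of `b j`. It shows that eigenvalues are non-negative and, through
  -- Parseval, that their sum is at most one.
  have hlj : ∀ j, l j = 𝔼 y, (𝔼 x, H y x * b j x) ^ 2 := by
    intro j
    have h1 : l j = 𝔼 x, b j x * (l j * b j x) := by
      have : ∀ x, b j x * (l j * b j x) = l j * b j x ^ 2 := fun x => by ring
      simp only [this, ← mul_expect, hb, mul_one]
    rw [h1]
    simp only [← hl]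
    have h2 : ∀ x, b j x * 𝔼 x', (𝔼 y, H y x * H y x') * b j x' =
        𝔼 y, (b j x * H y x) * 𝔼 x', H y x' * b j x' := by
      intro x
      simp only [expect_mul, mul_expect]
      rw [Finset.expect_comm]
      refine Finset.expect_congr rfl fun y _ => Finset.expect_congr rfl fun x _ => by ring
    simp only [h2]
    rw [Finset.expect_comm]
    refine Finset.expect_congr rfl fun y _ => ?_
    rw [← expect_mul, sq]
    simp only [mul_comm (b j _)]
  refine ⟨b, l, hb, hl, hp, fun j => ?_, ?_, ?_⟩
  · rw [hlj]; exact expect_nonneg' fun y => sq_nonneg _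
  · simp only [hlj]
    rw [← expect_sum_comm]
    simp only [← hp]
    refine expect_le_of_le zero_le_one fun y => expect_le_of_le zero_le_one fun x => ?_
    rw [← sq_abs]
    exact pow_le_one₀ (abs_nonneg _) (hH y x)
  · have h1 : ∀ x, 𝔼 x', (𝔼 y, H y x * H y x') ^ 2 = ∑ j, l j ^ 2 * b j x ^ 2 := by
      intro x
      rw [hp]
      refine Finset.sum_congr rfl fun j _ => ?_
      rw [hl]; ring
    simp only [h1, expect_sum_comm, ← mul_expect, hb, mul_one]

/-- The largest eigenvalue dominates the sum of the squares, because the eigenvalues are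
non-negative with sum at most one. -/
lemma exists_eigenvector_covariance (H : Y → X → ℝ) (hH : ∀ y x, |H y x| ≤ 1) :
    ∃ (e : X → ℝ) (L : ℝ), 𝔼 x, 𝔼 x', (𝔼 y, H y x * H y x') ^ 2 ≤ L ∧ 𝔼 x, e x ^ 2 = 1 ∧
      ∀ x, 𝔼 x', (𝔼 y, H y x * H y x') * e x' = L * e x := by
  obtain ⟨b, l, hb, hl, -, hl0, hl1, hl2⟩ := exists_spectral_decomposition_covariance H hH
  obtain ⟨j, -, hj⟩ := exists_max_image (univ : Finset X) l univ_nonempty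
  refine ⟨b j, l j, ?_, hb j, hl j⟩
  rw [← hl2]
  calc ∑ i, l i ^ 2 ≤ ∑ i, l j * l i := Finset.sum_le_sum fun i _ => by
        rw [sq]; exact mul_le_mul_of_nonneg_right (hj i (mem_univ _)) (hl0 i)
    _ = l j * ∑ i, l i := by rw [Finset.mul_sum]
    _ ≤ l j := mul_le_of_le_one_right (hl0 j) hl1

/-- Among many approximate eigenvectors of a covariance kernel two are close to each other,
simultaneously for a bounded number of families. -/
lemma exists_lt_expect_sub_sq_le [Fintype A] (H : Y → X → ℝ) (hH : ∀ y x, |H y x| ≤ 1)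
    {Λ η : ℝ} (hΛ : 0 < Λ) {R c L : ℕ} (hR : 2 / Λ ≤ R) (hc : 0 < c)
    (hL : (2 * c + 1) ^ (Fintype.card A * R) ≤ L) (φ : ℕ → A → X → ℝ)
    (hφ : ∀ i a, 𝔼 x, φ i a x ^ 2 ≤ 1)
    (hφe : ∀ i ≤ L, ∀ a, 𝔼 x, ((𝔼 x', (𝔼 y, H y x * H y x') * φ i a x') - Λ * φ i a x) ^ 2 ≤ η) :
    ∃ i j, i < j ∧ j ≤ L ∧
      ∀ a, 𝔼 x, (φ j a x - φ i a x) ^ 2 ≤ R / (c : ℝ) ^ 2 + 16 * η / Λ ^ 2 := by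
  classical
  obtain ⟨b, l, hb, hl, hp, hl0, hl1, hl2⟩ := exists_spectral_decomposition_covariance H hH
  have hc0 : (0 : ℝ) < c := by exact_mod_cast hc
  -- At most 2 / Λ eigenvalues reach Λ / 2. Up to a small error an approximate eigenvector for Λ is
  -- determined by its coefficients on `T`; the pigeonhole principle is applied to these
  -- coefficients rounded to multiples of 1 / c.
  let T : Finset X := univ.filter fun j => Λ / 2 ≤ l j
  have hT : #T ≤ R := by
    have h1 : (#T : ℝ) * (Λ / 2) ≤ 1 := by
      calc (#T : ℝ) * (Λ / 2) = ∑ j ∈ T, Λ / 2 := by rw [Finset.sum_const, nsmul_eq_mul]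
        _ ≤ ∑ j ∈ T, l j := Finset.sum_le_sum fun j hj => (mem_filter.1 hj).2
        _ ≤ ∑ j, l j := Finset.sum_le_sum_of_subset_of_nonneg (subset_univ _) fun j _ _ => hl0 j
        _ ≤ 1 := hl1
    have h2 : (#T : ℝ) ≤ 2 / Λ := by
      rw [le_div_iff₀ hΛ]; linarith
    exact_mod_cast h2.trans hR
  let t : ℕ → A → X → ℝ := fun i a j => 𝔼 x, φ i a x * b j x
  have ht : ∀ i a j, |t i a j| ≤ 1 := by
    intro i a j
    rw [← sq_le_one_iff_abs_le_one]
    calc t i a j ^ 2 ≤ ∑ j, t i a j ^ 2 :=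
          Finset.single_le_sum (f := fun j => t i a j ^ 2) (fun j _ => sq_nonneg _) (mem_univ j)
      _ = 𝔼 x, φ i a x ^ 2 := (hp _).symm
      _ ≤ 1 := hφ i a
  have hcell : ∀ i a j, ⌊c * t i a j⌋ ∈ Finset.Icc (-c : ℤ) c := by
    intro i a j
    have h1 := abs_le.1 (ht i a j)
    rw [Finset.mem_Icc]
    refine ⟨Int.le_floor.2 ?_, Int.floor_le_iff.2 ?_⟩
    · push_cast; nlinarith
    · push_cast; nlinarith
  -- Outside `T` the kernel operator minus Λ multiplies a coefficient by at least Λ / 2 in absolute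
  -- value.
  have htail : ∀ i ≤ L, ∀ a, ∑ j ∈ Tᶜ, t i a j ^ 2 ≤ 4 * η / Λ ^ 2 := by
    intro i hi a
    have h1 := hφe i hi a
    rw [hp] at h1
    have h2 : ∀ j, 𝔼 x, ((𝔼 x', (𝔼 y, H y x * H y x') * φ i a x') - Λ * φ i a x) * b j x =
        (l j - Λ) * t i a j := by
      intro j
      simp only [sub_mul, expect_sub_distrib]
      congr 1
      · simp only [mul_comm (𝔼 x', (𝔼 y, H y _ * H y x') * φ i a x')]
        rw [expect_mul_expect_comm (fun x x' => 𝔼 y, H y x * H y x') (b j) (φ i a)]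
        have h3 : ∀ x', 𝔼 x, (𝔼 y, H y x * H y x') * b j x = l j * b j x' := by
          intro x'
          rw [← hl j x']
          simp only [mul_comm (H _ x')]
        simp only [h3, t, mul_expect]
        exact Finset.expect_congr rfl fun x _ => by ring
      · simp only [t, mul_expect]
        exact Finset.expect_congr rfl fun x _ => by ring
    simp only [h2] at h1
    have h4 : (Λ ^ 2 / 4) * ∑ j ∈ Tᶜ, t i a j ^ 2 ≤ η := by
      rw [Finset.mul_sum]
      calc ∑ j ∈ Tᶜ, Λ ^ 2 / 4 * t i a j ^ 2 ≤ ∑ j ∈ Tᶜ, ((l j - Λ) * t i a j) ^ 2 := by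
            refine Finset.sum_le_sum fun j hj => ?_
            rw [mul_pow]
            refine mul_le_mul_of_nonneg_right ?_ (sq_nonneg _)
            have h5 : l j < Λ / 2 := by
              simpa [T] using hj
            nlinarith [hl0 j]
        _ ≤ ∑ j, ((l j - Λ) * t i a j) ^ 2 :=
            Finset.sum_le_sum_of_subset_of_nonneg (subset_univ _) fun j _ _ => sq_nonneg _
        _ ≤ η := h1
    rw [le_div_iff₀ (by positivity)]
    linarith
  let cell : ℕ → (A → T → Finset.Icc (-c : ℤ) c) := fun i a j => ⟨⌊c * t i a j⌋, hcell i a j⟩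
  have hcard : Fintype.card (A → T → Finset.Icc (-c : ℤ) c) ≤ L := by
    simp only [Fintype.card_fun, Fintype.card_coe, Int.card_Icc]
    rw [← pow_mul, mul_comm]
    have h1 : (c + 1 - -(c : ℤ)).toNat = 2 * c + 1 := by omega
    rw [h1]
    refine le_trans (Nat.pow_le_pow_right (by omega) (Nat.mul_le_mul_left _ hT)) hL
  obtain ⟨i, hi, j, hj, hne, hij⟩ := Finset.exists_ne_map_eq_of_card_lt_of_maps_to
    (s := Finset.range (L + 1)) (t := (univ : Finset (A → T → Finset.Icc (-c : ℤ) c)))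
    (f := cell) (by rw [card_range, card_univ]; omega) (fun _ _ => mem_coe.2 (mem_univ _))
  have key : ∀ i j, i ≤ L → j ≤ L → cell i = cell j → ∀ a,
      𝔼 x, (φ j a x - φ i a x) ^ 2 ≤ R / (c : ℝ) ^ 2 + 16 * η / Λ ^ 2 := by
    intro i j hi hj hij a
    rw [hp]
    have h1 : ∀ m, 𝔼 x, (φ j a x - φ i a x) * b m x = t j a m - t i a m := fun m => by
      simp only [sub_mul, expect_sub_distrib, t]
    simp only [h1]
    rw [← Finset.sum_add_sum_compl T]
    have hA : ∑ m ∈ T, (t j a m - t i a m) ^ 2 ≤ R / (c : ℝ) ^ 2 := by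
      calc ∑ m ∈ T, (t j a m - t i a m) ^ 2 ≤ ∑ m ∈ T, 1 / (c : ℝ) ^ 2 := by
            refine Finset.sum_le_sum fun m hm => ?_
            have h2 : ⌊c * t i a m⌋ = ⌊c * t j a m⌋ := by
              have := congrFun (congrFun hij a) ⟨m, hm⟩
              simpa [cell] using this
            have h3 := Int.abs_sub_lt_one_of_floor_eq_floor h2
            rw [← mul_sub, abs_mul, abs_of_pos hc0] at h3
            have h4 : (c : ℝ) ^ 2 * (t j a m - t i a m) ^ 2 ≤ 1 := by
              rw [← mul_pow, ← sq_abs, abs_mul, abs_of_pos hc0, abs_sub_comm]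
              exact pow_le_one₀ (by positivity) h3.le
            rw [le_div_iff₀ (by positivity)]
            linarith
        _ = #T * (1 / (c : ℝ) ^ 2) := by rw [Finset.sum_const, nsmul_eq_mul]
        _ ≤ R * (1 / (c : ℝ) ^ 2) := by gcongr
        _ = R / (c : ℝ) ^ 2 := by ring
    have hB : ∑ m ∈ Tᶜ, (t j a m - t i a m) ^ 2 ≤ 16 * η / Λ ^ 2 := by
      calc ∑ m ∈ Tᶜ, (t j a m - t i a m) ^ 2
          ≤ ∑ m ∈ Tᶜ, (2 * t j a m ^ 2 + 2 * t i a m ^ 2) :=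
            Finset.sum_le_sum fun m _ => by nlinarith [sq_nonneg (t j a m + t i a m)]
        _ = 2 * ∑ m ∈ Tᶜ, t j a m ^ 2 + 2 * ∑ m ∈ Tᶜ, t i a m ^ 2 := by
            rw [Finset.sum_add_distrib, Finset.mul_sum, Finset.mul_sum]
        _ ≤ 2 * (4 * η / Λ ^ 2) + 2 * (4 * η / Λ ^ 2) := by
            gcongr
            · exact htail j hj a
            · exact htail i hi a
        _ = 16 * η / Λ ^ 2 := by ring
    linarith
  rw [mem_range] at hi hj
  rcases lt_or_gt_of_ne hne with h | h
  · exact ⟨i, j, h, by omega, key i j (by omega) (by omega) hij⟩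
  · exact ⟨j, i, h, by omega, key j i (by omega) (by omega) hij.symm⟩

end Spectral

/-! ### An Efron–Stein inequality. -/

section EfronStein
variable {κ α : Type*} [Fintype κ] [DecidableEq κ] [Fintype α] [DecidableEq α] [Nonempty α]

/-- By orthogonality the left side is the mean square of `h` minus its average over coordinate `l`;
Jensen's inequality bounds it by the influence. -/
lemma expect_sq_sub_expect_update_sq_le (h : (κ → α) → ℝ) (l : κ) :
    𝔼 b, h b ^ 2 - 𝔼 b, (𝔼 c, h (update b l c)) ^ 2 ≤
      𝔼 b, 𝔼 c, (h b - h (update b l c)) ^ 2 := by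
  have h1 : ∀ b, h b ^ 2 = (𝔼 c, h (update b l c)) ^ 2 + (h b ^ 2 - (𝔼 c, h (update b l c)) ^ 2) :=
    fun b => by ring
  have h2 : 𝔼 b, h b * 𝔼 c, h (update b l c) = 𝔼 b, (𝔼 c, h (update b l c)) ^ 2 := by
    rw [← expect_piecewise' {l} (fun b => h b * 𝔼 c, h (update b l c))]
    refine Finset.expect_congr rfl fun b _ => ?_
    have h3 : ∀ x : κ → α, ({l} : Finset κ).piecewise x b = update b l (x l) := fun x =>
      piecewise_singleton _ _ _
    simp only [h3, update_idem]
    rw [← expect_mul, sq]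
    congr 1
    refine Eq.trans (expect_comp_injective (e := fun _ : Unit => l) (fun _ _ _ => rfl)
      (fun z : Unit → α => h (update b l (z ())))) ?_
    exact Fintype.expect_equiv (Equiv.funUnique Unit α) _ _ fun z => rfl
  have h4 : 𝔼 b, h b ^ 2 - 𝔼 b, (𝔼 c, h (update b l c)) ^ 2 =
      𝔼 b, (h b - 𝔼 c, h (update b l c)) ^ 2 := by
    have : ∀ b, (h b - 𝔼 c, h (update b l c)) ^ 2 = h b ^ 2 - 2 * (h b * 𝔼 c, h (update b l c)) +
      (𝔼 c, h (update b l c)) ^ 2 := fun b => by ring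
    simp only [this, expect_add_distrib, expect_sub_distrib, ← mul_expect, h2]
    ring
  rw [h4]
  refine expect_mono fun b => ?_
  refine le_trans (le_of_eq ?_) (sq_expect_le _)
  rw [expect_sub_distrib, Fintype.expect_const]

/-- An Efron–Stein inequality: averaging over coordinates of small influence keeps the norm. -/
lemma expect_sq_sub_expect_piecewise_sq_le (h : (κ → α) → ℝ) (Q : Finset κ) :
    𝔼 b, h b ^ 2 - 𝔼 b, (𝔼 b', h (Q.piecewise b' b)) ^ 2 ≤
      ∑ l ∈ Q, 𝔼 b, 𝔼 c, (h b - h (update b l c)) ^ 2 := by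
  induction Q using Finset.induction_on with
  | empty => simp
  | insert l Q hl ih =>
    rw [Finset.sum_insert hl]
    -- Averaging over `Q` can only decrease the influence of `l`, so each new coordinate is charged
    -- with the influence for `h` itself.
    set k : (κ → α) → ℝ := fun b => 𝔼 b', h (Q.piecewise b' b) with hk
    have h1 : ∀ b, 𝔼 b', h ((insert l Q).piecewise b' b) = 𝔼 c, k (update b l c) := by
      intro b
      rw [← expect_piecewise' {l} (fun b' => h ((insert l Q).piecewise b' b)), Finset.expect_comm]
      have h2 : ∀ x y : κ → α, h ((insert l Q).piecewise (({l} : Finset κ).piecewise x y) b) =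
          h (Q.piecewise y (update b l (x l))) := by
        intro x y
        congr 1
        funext i
        by_cases hi : i = l
        · subst hi; simp [hl]
        · by_cases hQ : i ∈ Q <;> simp [hi, hQ]
      simp only [h2]
      refine Eq.trans (expect_comp_injective (e := fun _ : Unit => l) (fun _ _ _ => rfl)
        (fun z : Unit → α => k (update b l (z ())))) ?_
      exact Fintype.expect_equiv (Equiv.funUnique Unit α) _ _ fun z => rfl
    simp only [h1]
    have h3 := expect_sq_sub_expect_update_sq_le k l
    have h4 : 𝔼 b, 𝔼 c, (k b - k (update b l c)) ^ 2 ≤ 𝔼 b, 𝔼 c, (h b - h (update b l c)) ^ 2 := by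
      have h5 : ∀ b c, (k b - k (update b l c)) ^ 2 ≤
          𝔼 b', (h (Q.piecewise b' b) - h (update (Q.piecewise b' b) l c)) ^ 2 := by
        intro b c
        refine le_trans (le_of_eq ?_) (sq_expect_le _)
        rw [expect_sub_distrib]
        congr 3
        refine Finset.expect_congr rfl fun b' _ => ?_
        congr 1
        funext i
        by_cases hi : i = l
        · subst hi; simp [hl]
        · by_cases hQ : i ∈ Q <;> simp [hi, hQ]
      refine (expect_mono fun b => expect_mono fun c => h5 b c).trans ?_
      refine le_of_eq ?_
      rw [← expect_piecewise' Q (fun b => 𝔼 c, (h b - h (update b l c)) ^ 2)]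
      refine Finset.expect_congr rfl fun b _ => Finset.expect_comm _ _ _
    linarith

end EfronStein

/-! ### Covariance kernels, box norms and top eigenvectors. -/

section Covariance
variable {ι α : Type*} [Fintype ι] [DecidableEq ι] [Fintype α] [DecidableEq α] [Nonempty α]

/-- The covariance kernel of `F` with respect to averaging outside `I`. -/
noncomputable def cov (I : Finset ι) (F : (ι → α) → ℝ) (u u' : ι → α) : ℝ :=
  𝔼 x, F (I.piecewise u x) * F (I.piecewise u' x)

/-- The fourth power of the box norm of `F` for the partition of the coordinates into `I` and its
complement. -/
noncomputable def boxNorm (I : Finset ι) (F : (ι → α) → ℝ) : ℝ :=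
  𝔼 u, 𝔼 u', cov I F u u' ^ 2

open Classical in
/-- A normalized eigenvector of the kernel `k` for a large eigenvalue, if there is one. -/
noncomputable def topVec {X : Type*} [Fintype X] (k : X → X → ℝ) : X → ℝ :=
  if h : ∃ e : X → ℝ, 𝔼 x, e x ^ 2 = 1 ∧
    ∃ L : ℝ, 𝔼 x, 𝔼 x', k x x' ^ 2 ≤ L ∧ ∀ x, 𝔼 x', k x x' * e x' = L * e x
  then h.choose else 0

lemma expect_topVec_sq_le {X : Type*} [Fintype X] (k : X → X → ℝ) :
    𝔼 x, topVec k x ^ 2 ≤ 1 := by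
  unfold topVec
  split_ifs with h
  · exact h.choose_spec.1.le
  · simp

/-- The correlation of `F` on the coordinates in `I` with the top eigenvector of its covariance. -/
noncomputable def eigProj (I : Finset ι) (F : (ι → α) → ℝ) (x : ι → α) : ℝ :=
  𝔼 u, topVec (cov I F) u * F (I.piecewise u x)

lemma abs_eigProj_le {I : Finset ι} {F : (ι → α) → ℝ} (hF : ∀ x, |F x| ≤ 1) (x : ι → α) :
    |eigProj I F x| ≤ 1 := by
  rw [← sq_le_one_iff_abs_le_one]
  refine (expect_mul_sq_le _ _).trans ?_
  refine mul_le_one₀ (expect_topVec_sq_le _) (expect_nonneg' fun _ => sq_nonneg _) ?_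
  exact expect_le_of_le zero_le_one fun u => (sq_le_one_iff_abs_le_one _).2 (hF _)

/-- For bounded `F` the default value 0 of `topVec` is never taken. -/
lemma topVec_cov_spec {I : Finset ι} {F : (ι → α) → ℝ} (hF : ∀ x, |F x| ≤ 1) :
    𝔼 x, topVec (cov I F) x ^ 2 = 1 ∧ ∃ L : ℝ, boxNorm I F ≤ L ∧
      ∀ x, 𝔼 x', cov I F x x' * topVec (cov I F) x' = L * topVec (cov I F) x := by
  obtain ⟨e, L, h1, h2, h3⟩ := exists_eigenvector_covariance
    (fun (y : ι → α) (u : ι → α) => F (I.piecewise u y)) (fun y u => hF _)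
  have h : ∃ e : (ι → α) → ℝ, 𝔼 x, e x ^ 2 = 1 ∧
    ∃ L : ℝ, 𝔼 x, 𝔼 x', cov I F x x' ^ 2 ≤ L ∧ ∀ x, 𝔼 x', cov I F x x' * e x' = L * e x :=
    ⟨e, h2, L, h1, h3⟩
  unfold topVec
  rw [dif_pos h]
  exact h.choose_spec

/-- If T sends a function of the coordinates in `I` to its correlation with `F`, then `eigProj` is T
e and the covariance is T* T, so ‖T e‖² = ⟨e, T* T e⟩. -/
lemma expect_eigProj_sq {I : Finset ι} {F : (ι → α) → ℝ} {L : ℝ}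
    (h1 : 𝔼 x, topVec (cov I F) x ^ 2 = 1)
    (hL : ∀ x, 𝔼 x', cov I F x x' * topVec (cov I F) x' = L * topVec (cov I F) x) :
    𝔼 x, eigProj I F x ^ 2 = L := by
  have h2 : ∀ x, eigProj I F x ^ 2 = 𝔼 u, topVec (cov I F) u * 𝔼 u',
      (F (I.piecewise u x) * F (I.piecewise u' x)) * topVec (cov I F) u' := by
    intro x
    rw [eigProj, sq, expect_mul]
    refine Finset.expect_congr rfl fun u _ => ?_
    rw [mul_assoc, mul_expect]
    congr 1
    exact Finset.expect_congr rfl fun u' _ => by ring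
  simp only [h2]
  rw [Finset.expect_comm]
  have h3 : ∀ u, 𝔼 x, topVec (cov I F) u * 𝔼 u',
      (F (I.piecewise u x) * F (I.piecewise u' x)) * topVec (cov I F) u' =
      L * topVec (cov I F) u ^ 2 := by
    intro u
    rw [← mul_expect, Finset.expect_comm]
    simp only [← expect_mul]
    have := hL u
    simp only [cov] at this ⊢
    rw [this]; ring
  simp only [h3, ← mul_expect, h1, mul_one]

lemma piecewise_comp_swap {T : Finset ι} {e e' : ι} (he : e ∉ T) (he' : e' ∉ T) (u x : ι → α) :
    T.piecewise u x ∘ Equiv.swap e e' = T.piecewise u (x ∘ Equiv.swap e e') := by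
  funext i
  by_cases hi : i ∈ T
  · have h1 : i ≠ e := fun h => he (h ▸ hi)
    have h2 : i ≠ e' := fun h => he' (h ▸ hi)
    simp [Equiv.swap_apply_of_ne_of_ne h1 h2, hi]
  · have : Equiv.swap e e' i ∉ T := by
      by_cases h1 : i = e
      · subst h1; simpa using he'
      · by_cases h2 : i = e'
        · subst h2; simpa using he
        · rwa [Equiv.swap_apply_of_ne_of_ne h1 h2]
    simp [hi, this]

lemma cov_comp_swap {T : Finset ι} {e e' : ι} (he : e ∉ T) (he' : e' ∉ T) (F : (ι → α) → ℝ) :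
    cov T (fun y => F (y ∘ Equiv.swap e e')) = cov T F := by
  funext u u'
  simp only [cov, piecewise_comp_swap he he']
  exact expect_comp_perm (Equiv.swap e e')
    (fun x => F (T.piecewise u x) * F (T.piecewise u' x))

/-- A swap outside `T` does not change the covariance kernel, hence not the chosen eigenvector
either: `topVec` depends on the kernel alone. This makes `eigProj` accessible to the planting
estimates. -/
lemma eigProj_comp_swap {T : Finset ι} {e e' : ι} (he : e ∉ T) (he' : e' ∉ T) (F : (ι → α) → ℝ)
    (x : ι → α) : eigProj T (fun y => F (y ∘ Equiv.swap e e')) x =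
      eigProj T F (x ∘ Equiv.swap e e') := by
  simp only [eigProj, cov_comp_swap he he', piecewise_comp_swap he he']

/-- The effect on the covariance kernel of fixing the coordinates in `K` at `w`. -/
noncomputable def covDefect (T K : Finset ι) (w : ι → α) (F : (ι → α) → ℝ) : ℝ :=
  𝔼 u, 𝔼 u', ((𝔼 x, F (T.piecewise u (K.piecewise w x)) * F (T.piecewise u' (K.piecewise w x))) -
    cov T F u u') ^ 2

lemma covDefect_nonneg (T K : Finset ι) (w : ι → α) (F : (ι → α) → ℝ) :
    0 ≤ covDefect T K w F :=
  expect_nonneg' fun _ => expect_nonneg' fun _ => sq_nonneg _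

/-- For fixed `u` and `u'` the product of the two restrictions is an equivariant functional, so the
planting bound applies. The differences are at most 2, so squaring costs a factor 2. -/
lemma expect_covDefect_le {T K Q : Finset ι} (hQ : Q.Nonempty) (hKQ : Disjoint K Q)
    (hTK : Disjoint T K) (hTQ : Disjoint T Q) {F : (ι → α) → ℝ} (hF : ∀ x, |F x| ≤ 1)
    (w : ι → α) :
    𝔼 τ : Equiv.Perm ι, covDefect T K w (relabel τ F) ≤ 2 * (#K * √(Fintype.card α / #Q)) := by
  have hFτ : ∀ (τ : Equiv.Perm ι) x, |relabel τ F x| ≤ 1 := fun τ x => hF _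
  simp only [covDefect]
  rw [Finset.expect_comm]
  refine expect_le_of_le (by positivity) fun u => ?_
  rw [Finset.expect_comm]
  refine expect_le_of_le (by positivity) fun u' => ?_
  have hg : SwapEquivariant
      (fun (F : (ι → α) → ℝ) x => F (T.piecewise u x) * F (T.piecewise u' x)) K Q := by
    intro F e he e' he' x
    simp only [piecewise_comp_swap (fun h => disjoint_left.1 hTK h he)
      (fun h => disjoint_left.1 hTQ h he')]
  have hB : ∀ (τ : Equiv.Perm ι) x,
      |relabel τ F (T.piecewise u x) * relabel τ F (T.piecewise u' x)| ≤ 1 := fun τ x => by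
    rw [abs_mul]
    exact mul_le_one₀ (hFτ _ _) (abs_nonneg _) (hFτ _ _)
  have h1 := expect_perm_piecewise_sub_le zero_le_one hQ hKQ hg F hB w
  rw [one_mul] at h1
  refine le_trans ?_ (mul_le_mul_of_nonneg_left h1 zero_le_two)
  rw [mul_expect]
  refine expect_mono fun τ => ?_
  have h2 : |(𝔼 x, relabel τ F (T.piecewise u (K.piecewise w x)) *
      relabel τ F (T.piecewise u' (K.piecewise w x))) - cov T (relabel τ F) u u'| ≤ 2 := by
    have h3 := abs_expect_le_of_le zero_le_one (fun x => hB τ (K.piecewise w x))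
    have h4 := abs_expect_le_of_le zero_le_one (fun x => hB τ x)
    have h5 : |cov T (relabel τ F) u u'| ≤ 1 := h4
    exact (abs_sub _ _).trans (by linarith)
  rw [← sq_abs, sq]
  exact mul_le_mul_of_nonneg_right h2 (abs_nonneg _)

end Covariance

/-! ### Blocks of coordinates and the errors of planting in them. -/

section Blocks
variable {ι α : Type*} [Fintype ι] [DecidableEq ι] [Fintype α] [DecidableEq α] [Nonempty α]
variable {S L : ℕ} (grp : Fin S × Fin L → ι)

/-- The `l`-th group of coordinates. -/
def group (l : Fin S) : Finset ι := univ.image fun k => grp (l, k)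

/-- The segment `[i, j)` of the `l`-th group. -/
def segment (l : Fin S) (i j : ℕ) : Finset ι :=
  (univ.filter fun k : Fin L => i ≤ k ∧ k < j).image fun k => grp (l, k)

/-- The union of the segments `[i, j)` of all groups. -/
def segments (i j : ℕ) : Finset ι := univ.biUnion fun l => segment grp l i j

/-- The assignment that is `a` on the initial segment of length `i` of the `l`-th group. -/
def chain (a₀ : α) (l : Fin S) (i : ℕ) (a : α) : ι → α :=
  fun p => if p ∈ segment grp l 0 i then a else a₀

/-- The assignment that is constant equal to `b l` on the `l`-th group. -/
noncomputable def groupwise (a₀ : α) (b : Fin S → α) : ι → α :=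
  extend grp (fun p => b p.1) fun _ => a₀

variable {grp}

lemma mem_group {l : Fin S} {p : ι} : p ∈ group grp l ↔ ∃ k, grp (l, k) = p := by
  simp [group]

lemma mem_segment {l : Fin S} {i j : ℕ} {p : ι} :
    p ∈ segment grp l i j ↔ ∃ k : Fin L, (i ≤ k ∧ k < j) ∧ grp (l, k) = p := by
  simp [segment]

lemma mem_segments {i j : ℕ} {p : ι} :
    p ∈ segments grp i j ↔ ∃ l, p ∈ segment grp l i j := by
  simp [segments]

lemma apply_mem_segment (hg : Injective grp) {l l' : Fin S} {k : Fin L} {i j : ℕ} :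
    grp (l, k) ∈ segment grp l' i j ↔ l = l' ∧ i ≤ k ∧ k < j := by
  rw [mem_segment]
  constructor
  · rintro ⟨k', h, h'⟩
    have := hg h'
    simp only [Prod.mk.injEq] at this
    obtain ⟨rfl, rfl⟩ := this
    exact ⟨rfl, h⟩
  · rintro ⟨rfl, h⟩
    exact ⟨k, h, rfl⟩

lemma segment_subset_group (l : Fin S) (i j : ℕ) : segment grp l i j ⊆ group grp l := by
  intro p hp
  obtain ⟨k, -, h⟩ := mem_segment.1 hp
  exact mem_group.2 ⟨k, h⟩

lemma segment_subset_segments (l : Fin S) (i j : ℕ) : segment grp l i j ⊆ segments grp i j :=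
  fun _ hp => mem_segments.2 ⟨l, hp⟩

lemma segments_subset_range (i j : ℕ) : segments grp i j ⊆ univ.image grp := by
  intro p hp
  obtain ⟨l, hp⟩ := mem_segments.1 hp
  obtain ⟨k, -, h⟩ := mem_segment.1 hp
  exact mem_image.2 ⟨_, mem_univ _, h⟩

lemma group_subset_range (l : Fin S) : group grp l ⊆ univ.image grp := by
  intro p hp
  obtain ⟨k, h⟩ := mem_group.1 hp
  exact mem_image.2 ⟨_, mem_univ _, h⟩

lemma card_range_le : #(univ.image grp) ≤ S * L := by
  refine card_image_le.trans ?_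
  simp

lemma groupwise_apply (hg : Injective grp) (a₀ : α) (b : Fin S → α) (l : Fin S) (k : Fin L) :
    groupwise grp a₀ b (grp (l, k)) = b l := by
  simp [groupwise, hg.extend_apply]

/-- Together with `chain_same` this writes the chain points at `j` and `i` as two fillings of one
segment, by `a` and by `a₀`, with a common outside. Closeness of two chain restrictions thus becomes
small influence of the segment. -/
lemma chain_step (hg : Injective grp) (a₀ a : α) (l : Fin S) {i j : ℕ} (hij : i ≤ j) (x : ι → α) :
    (group grp l).piecewise (chain grp a₀ l j a) x =
      (segment grp l i j).piecewise (fun _ => a)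
        ((group grp l \ segment grp l i j).piecewise (chain grp a₀ l i a) x) := by
  funext p
  by_cases hp : p ∈ group grp l
  · obtain ⟨k, rfl⟩ := mem_group.1 hp
    by_cases h1 : (k : ℕ) < i
    · simp [hp, chain, apply_mem_segment hg, h1, show (k : ℕ) < j by omega]
    · by_cases h2 : (k : ℕ) < j
      · simp [hp, chain, apply_mem_segment hg, h2, show i ≤ (k : ℕ) by omega]
      · simp [hp, chain, apply_mem_segment hg, h1, h2]
  · have : p ∉ segment grp l i j := fun h => hp (segment_subset_group _ _ _ h)
    simp [hp, this]

lemma chain_same (hg : Injective grp) (a₀ a : α) (l : Fin S) {i j : ℕ} (x : ι → α) :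
    (group grp l).piecewise (chain grp a₀ l i a) x =
      (segment grp l i j).piecewise (fun _ => a₀)
        ((group grp l \ segment grp l i j).piecewise (chain grp a₀ l i a) x) := by
  funext p
  by_cases hp : p ∈ group grp l
  · obtain ⟨k, rfl⟩ := mem_group.1 hp
    by_cases h1 : i ≤ (k : ℕ) ∧ (k : ℕ) < j
    · have : ¬ (k : ℕ) < i := by omega
      simp [hp, chain, apply_mem_segment hg, h1, this]
    · simp [hp, chain, apply_mem_segment hg, h1]
  · have : p ∉ segment grp l i j := fun h => hp (segment_subset_group _ _ _ h)
    simp [hp, this]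

lemma groupwise_split (hg : Injective grp) (a₀ : α) (b : Fin S → α) (l : Fin S) (i j : ℕ)
    (x : ι → α) : (segments grp i j).piecewise (groupwise grp a₀ b) x =
      (segment grp l i j).piecewise (fun _ => b l)
        ((segments grp i j \ segment grp l i j).piecewise (groupwise grp a₀ b) x) := by
  funext p
  by_cases hp : p ∈ segment grp l i j
  · have := segment_subset_segments l i j hp
    obtain ⟨k, -, rfl⟩ := mem_segment.1 hp
    simp [hp, this, groupwise_apply hg]
  · by_cases h : p ∈ segments grp i j <;> simp [hp, h]

lemma groupwise_update_split (hg : Injective grp) (a₀ : α) (b : Fin S → α) (l : Fin S) (c : α)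
    (i j : ℕ) (x : ι → α) : (segments grp i j).piecewise (groupwise grp a₀ (update b l c)) x =
      (segment grp l i j).piecewise (fun _ => c)
        ((segments grp i j \ segment grp l i j).piecewise (groupwise grp a₀ b) x) := by
  rw [groupwise_split hg a₀ _ l, update_self]
  congr 1
  funext p
  by_cases hp : p ∈ segments grp i j \ segment grp l i j
  · obtain ⟨h1, h2⟩ := mem_sdiff.1 hp
    obtain ⟨l', h3⟩ := mem_segments.1 h1
    obtain ⟨k, h4, rfl⟩ := mem_segment.1 h3
    have : l' ≠ l := by
      rintro rfl
      exact h2 h3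
    simp [hp, groupwise_apply hg, this]
  · simp [hp]

variable (grp)

/-- The squared effect of changing the value on `D` from `a₀` to `a`. -/
noncomputable def changeSq (I D : Finset ι) (a₀ a : α) (F : (ι → α) → ℝ) (x : ι → α) : ℝ :=
  (eigProj I F (D.piecewise (fun _ => a) x) - eigProj I F (D.piecewise (fun _ => a₀) x)) ^ 2

/-- The change in the mean of `g F` when the coordinates in `K` are fixed at `w`. -/
noncomputable def meanDefect (g : ((ι → α) → ℝ) → (ι → α) → ℝ) (K : Finset ι) (w : ι → α)
    (F : (ι → α) → ℝ) : ℝ :=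
  |𝔼 x, g F (K.piecewise w x) - 𝔼 x, g F x|

/-- The sum of all the errors made by fixing coordinates in the groups. -/
noncomputable def totalDefect (I : Finset ι) (a₀ : α) (F : (ι → α) → ℝ) : ℝ :=
  (∑ l, ∑ i ∈ range (L + 1), ∑ a, (covDefect I (group grp l) (chain grp a₀ l i a) F +
      covDefect (I ∪ group grp l)ᶜ (group grp l) (chain grp a₀ l i a) F)) +
  (∑ l, ∑ i ∈ range (L + 1), ∑ j ∈ range (L + 1), ∑ a,
    (meanDefect (changeSq I (segment grp l i j) a₀ a) (group grp l \ segment grp l i j)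
      (chain grp a₀ l i a) F +
    𝔼 b, meanDefect (changeSq I (segment grp l i j) a₀ a) (segments grp i j \ segment grp l i j)
      (groupwise grp a₀ b) F)) +
  (∑ i ∈ range (L + 1), ∑ j ∈ range (L + 1),
    (𝔼 b, meanDefect (fun F x => eigProj I F x ^ 2) (segments grp i j) (groupwise grp a₀ b) F +
    𝔼 b, meanDefect (fun F => F) (segments grp i j) (groupwise grp a₀ b) F))

variable {grp}

lemma meanDefect_nonneg (g : ((ι → α) → ℝ) → (ι → α) → ℝ) (K : Finset ι) (w : ι → α)
    (F : (ι → α) → ℝ) : 0 ≤ meanDefect g K w F := abs_nonneg _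

lemma abs_changeSq_le {I D : Finset ι} {a₀ a : α} {F : (ι → α) → ℝ} (hF : ∀ x, |F x| ≤ 1)
    (x : ι → α) : |changeSq I D a₀ a F x| ≤ 4 := by
  have h1 := abs_le.1 (abs_eigProj_le (I := I) hF (D.piecewise (fun _ => a) x))
  have h2 := abs_le.1 (abs_eigProj_le (I := I) hF (D.piecewise (fun _ => a₀) x))
  rw [changeSq, abs_of_nonneg (sq_nonneg _)]
  nlinarith

lemma swapEquivariant_changeSq {I D K Q : Finset ι} (hIK : Disjoint I K) (hIQ : Disjoint I Q)
    (hDK : Disjoint D K) (hDQ : Disjoint D Q) (a₀ a : α) :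
    SwapEquivariant (changeSq I D a₀ a) K Q := by
  intro F e he e' he' x
  have h1 : e ∉ I := fun h => disjoint_left.1 hIK h he
  have h2 : e' ∉ I := fun h => disjoint_left.1 hIQ h he'
  have h3 : e ∉ D := fun h => disjoint_left.1 hDK h he
  have h4 : e' ∉ D := fun h => disjoint_left.1 hDQ h he'
  simp only [changeSq, eigProj_comp_swap h1 h2, piecewise_comp_swap h3 h4]

lemma sqrt_card_le {Q : Finset ι} {N : ℕ} (hN : 0 < N) (hQ : N ≤ #Q) :
    √((Fintype.card α : ℝ) / #Q) ≤ √((Fintype.card α : ℝ) / N) := by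
  have : (0 : ℝ) < N := by exact_mod_cast hN
  have : (N : ℝ) ≤ #Q := by exact_mod_cast hQ
  gcongr

/-- Each summand is a planting error. The spare coordinates are those in `Q`, except for the
covariance on the complement of `I` and a group: its averaged coordinates outside the group are
those of `I`, which therefore serve as the spare ones. -/
lemma expect_totalDefect_le (I Q : Finset ι) (a₀ : α) {N : ℕ} (hN : 0 < N) (hNI : N ≤ #I)
    (hNQ : N ≤ #Q) (hS : 0 < S) (hgI : Disjoint (univ.image grp) I)
    (hgQ : Disjoint (univ.image grp) Q) (hIQ : Disjoint I Q) {F : (ι → α) → ℝ}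
    (hF : ∀ x, |F x| ≤ 1) :
    𝔼 τ : Equiv.Perm ι, totalDefect grp I a₀ (relabel τ F) ≤
      14 * S ^ 2 * (L + 1) ^ 3 * Fintype.card α * √((Fintype.card α : ℝ) / N) := by
  set q : ℝ := (Fintype.card α : ℝ) with hq
  set ρ := √(q / N) with hρ
  have hρ0 : 0 ≤ ρ := Real.sqrt_nonneg _
  have hq1 : 1 ≤ q := by rw [hq]; exact_mod_cast Fintype.card_pos
  have hS1 : (1 : ℝ) ≤ S := by exact_mod_cast hS
  have hQne : Q.Nonempty := card_pos.1 (by omega)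
  have hIne : I.Nonempty := card_pos.1 (by omega)
  have hFτ : ∀ (τ : Equiv.Perm ι) x, |relabel τ F x| ≤ 1 := fun τ x => hF _
  have hseg : ∀ i j, Disjoint (segments grp i j) Q := fun i j =>
    hgQ.mono_left (segments_subset_range i j)
  have hsegI : ∀ i j, Disjoint (segments grp i j) I := fun i j =>
    hgI.mono_left (segments_subset_range i j)
  have hgr : ∀ l, Disjoint (group grp l) Q := fun l => hgQ.mono_left (group_subset_range l)
  have hgrI : ∀ l, Disjoint (group grp l) I := fun l => hgI.mono_left (group_subset_range l)
  have hcU : ∀ i j (K : Finset ι), K ⊆ segments grp i j → (#K : ℝ) ≤ S * L := fun i j K hK => by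
    exact_mod_cast (card_le_card (hK.trans (segments_subset_range i j))).trans card_range_le
  have hcG : ∀ l (K : Finset ι), K ⊆ group grp l → (#K : ℝ) ≤ S * L := fun l K hK => by
    exact_mod_cast (card_le_card (hK.trans (group_subset_range l))).trans card_range_le
  have hρQ : √(q / #Q) ≤ ρ := sqrt_card_le hN hNQ
  have hρI : √(q / #I) ≤ ρ := sqrt_card_le hN hNI
  have e1 : ∀ l i a, 𝔼 τ : Equiv.Perm ι,
      (covDefect I (group grp l) (chain grp a₀ l i a) (relabel τ F) +
      covDefect (I ∪ group grp l)ᶜ (group grp l) (chain grp a₀ l i a) (relabel τ F)) ≤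
      4 * (S * L * ρ) := by
    intro l i a
    rw [expect_add_distrib]
    have h1 := expect_covDefect_le hQne (hgr l) (hgrI l).symm hIQ hF (chain grp a₀ l i a)
    have h2 := expect_covDefect_le (T := (I ∪ group grp l)ᶜ) hIne (hgrI l)
      (disjoint_left.2 fun p hp hp' => (mem_compl.1 hp) (mem_union_right _ hp'))
      (disjoint_left.2 fun p hp hp' => (mem_compl.1 hp) (mem_union_left _ hp')) hF
      (chain grp a₀ l i a)
    have h3 : (#(group grp l) : ℝ) * √(q / #Q) ≤ S * L * ρ :=
      mul_le_mul (hcG l _ subset_rfl) hρQ (Real.sqrt_nonneg _) (by positivity)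
    have h4 : (#(group grp l) : ℝ) * √(q / #I) ≤ S * L * ρ :=
      mul_le_mul (hcG l _ subset_rfl) hρI (Real.sqrt_nonneg _) (by positivity)
    linarith
  have hmean : ∀ (g : ((ι → α) → ℝ) → (ι → α) → ℝ) (B : ℝ) (K : Finset ι) (w : ι → α), 0 ≤ B →
      Disjoint K Q → SwapEquivariant g K Q → (∀ F x, (∀ x, |F x| ≤ 1) → |g F x| ≤ B) →
      (#K : ℝ) ≤ S * L → 𝔼 τ : Equiv.Perm ι, meanDefect g K w (relabel τ F) ≤ B * (S * L * ρ) := by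
    intro g B K w hB hK hg hgB hc
    refine (expect_perm_piecewise_sub_le hB hQne hK hg F (fun τ x => hgB _ _ (hFτ τ)) w).trans ?_
    have : (#K : ℝ) * √(q / #Q) ≤ S * L * ρ :=
      mul_le_mul hc hρQ (Real.sqrt_nonneg _) (by positivity)
    calc (#K : ℝ) * (B * √(q / #Q)) = B * (#K * √(q / #Q)) := by ring
      _ ≤ _ := by gcongr
  have e2 : ∀ l i j a, 𝔼 τ : Equiv.Perm ι,
      (meanDefect (changeSq I (segment grp l i j) a₀ a) (group grp l \ segment grp l i j)
        (chain grp a₀ l i a) (relabel τ F) +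
      𝔼 b, meanDefect (changeSq I (segment grp l i j) a₀ a)
        (segments grp i j \ segment grp l i j) (groupwise grp a₀ b) (relabel τ F)) ≤
      8 * (S * L * ρ) := by
    intro l i j a
    rw [expect_add_distrib, Finset.expect_comm]
    have hsQ : Disjoint (segment grp l i j) Q :=
      (hgr l).mono_left (segment_subset_group l i j)
    have h1 := hmean (changeSq I (segment grp l i j) a₀ a) 4 (group grp l \ segment grp l i j)
      (chain grp a₀ l i a) (by norm_num) ((hgr l).mono_left sdiff_subset)
      (swapEquivariant_changeSq ((hgrI l).mono_left sdiff_subset).symm hIQ disjoint_sdiff hsQ a₀ a)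
      (fun F x hF => abs_changeSq_le hF x) (hcG l _ sdiff_subset)
    have h2 : 𝔼 b, 𝔼 τ : Equiv.Perm ι, meanDefect (changeSq I (segment grp l i j) a₀ a)
        (segments grp i j \ segment grp l i j) (groupwise grp a₀ b) (relabel τ F) ≤
        4 * (S * L * ρ) := expect_le_of_le (by positivity) fun b =>
      hmean (changeSq I (segment grp l i j) a₀ a) 4 (segments grp i j \ segment grp l i j)
      _ (by norm_num) ((hseg i j).mono_left sdiff_subset)
      (swapEquivariant_changeSq ((hsegI i j).mono_left sdiff_subset).symm hIQ disjoint_sdiff hsQ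
        a₀ a) (fun F x hF => abs_changeSq_le hF x) (hcU i j _ sdiff_subset)
    linarith
  have e3 : ∀ i j, 𝔼 τ : Equiv.Perm ι,
      (𝔼 b, meanDefect (fun F x => eigProj I F x ^ 2) (segments grp i j) (groupwise grp a₀ b)
        (relabel τ F) +
      𝔼 b, meanDefect (fun F => F) (segments grp i j) (groupwise grp a₀ b) (relabel τ F)) ≤
      2 * (S * L * ρ) := by
    intro i j
    rw [expect_add_distrib, Finset.expect_comm]
    have h1 : 𝔼 b, 𝔼 τ : Equiv.Perm ι, meanDefect (fun F x => eigProj I F x ^ 2)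
        (segments grp i j) (groupwise grp a₀ b) (relabel τ F) ≤ 1 * (S * L * ρ) :=
      expect_le_of_le (by positivity) fun b => hmean _ 1 _ _ zero_le_one (hseg i j)
        (fun F e he e' he' x => by
          simp only [eigProj_comp_swap (fun h => disjoint_left.1 (hsegI i j) he h)
            (fun h => disjoint_left.1 hIQ h he')])
        (fun F x hF => by
          rw [abs_of_nonneg (sq_nonneg _)]
          exact (sq_le_one_iff_abs_le_one _).2 (abs_eigProj_le hF x)) (hcU i j _ subset_rfl)
    have h2 : 𝔼 τ : Equiv.Perm ι, 𝔼 b, meanDefect (fun F => F) (segments grp i j)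
        (groupwise grp a₀ b) (relabel τ F) ≤ 1 * (S * L * ρ) := by
      rw [Finset.expect_comm]
      exact expect_le_of_le (by positivity) fun b => hmean _ 1 _ _ zero_le_one (hseg i j)
        (fun F e he e' he' x => rfl) (fun F x hF => hF x) (hcU i j _ subset_rfl)
    linarith
  simp only [totalDefect, expect_add_distrib, expect_sum_comm]
  simp only [expect_add_distrib] at e1 e2 e3
  have t1 : ∑ l : Fin S, ∑ i ∈ range (L + 1), ∑ a : α, (4 * (S * L * ρ)) =
      4 * S * (L + 1) * q * (S * L * ρ) := by
    simp only [Finset.sum_const, card_univ, Fintype.card_fin, card_range, nsmul_eq_mul, ← hq]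
    push_cast; ring
  have t2 : ∑ l : Fin S, ∑ i ∈ range (L + 1), ∑ j ∈ range (L + 1), ∑ a : α, (8 * (S * L * ρ)) =
      8 * S * (L + 1) ^ 2 * q * (S * L * ρ) := by
    simp only [Finset.sum_const, card_univ, Fintype.card_fin, card_range, nsmul_eq_mul, ← hq]
    push_cast; ring
  have t3 : ∑ i ∈ range (L + 1), ∑ j ∈ range (L + 1), (2 * (S * L * ρ)) =
      2 * (L + 1) ^ 2 * (S * L * ρ) := by
    simp only [Finset.sum_const, card_range, nsmul_eq_mul]
    push_cast; ring
  have s1 := Finset.sum_le_sum fun l (_ : l ∈ (univ : Finset (Fin S))) =>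
    Finset.sum_le_sum fun i (_ : i ∈ range (L + 1)) =>
    Finset.sum_le_sum fun a (_ : a ∈ (univ : Finset α)) => e1 l i a
  have s2 := Finset.sum_le_sum fun l (_ : l ∈ (univ : Finset (Fin S))) =>
    Finset.sum_le_sum fun i (_ : i ∈ range (L + 1)) =>
    Finset.sum_le_sum fun j (_ : j ∈ range (L + 1)) =>
    Finset.sum_le_sum fun a (_ : a ∈ (univ : Finset α)) => e2 l i j a
  have s3 := Finset.sum_le_sum fun i (_ : i ∈ range (L + 1)) =>
    Finset.sum_le_sum fun j (_ : j ∈ range (L + 1)) => e3 i j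
  rw [t1] at s1
  rw [t2] at s2
  rw [t3] at s3
  refine (add_le_add (add_le_add s1 s2) s3).trans ?_
  set ℓ : ℝ := (L : ℝ)
  have hℓ : 0 ≤ ℓ := Nat.cast_nonneg L
  have hA : ℓ ≤ ℓ + 1 := by linarith
  have b1 : 4 * S * (ℓ + 1) * q * (S * ℓ * ρ) ≤ 4 * S * (ℓ + 1) ^ 2 * q * (S * (ℓ + 1) * ρ) := by
    gcongr
    nlinarith
  have b2 : 8 * S * (ℓ + 1) ^ 2 * q * (S * ℓ * ρ) ≤
      8 * S * (ℓ + 1) ^ 2 * q * (S * (ℓ + 1) * ρ) := by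
    gcongr
  have b3 : 2 * (ℓ + 1) ^ 2 * (S * ℓ * ρ) ≤ 2 * (S * (ℓ + 1) ^ 2 * q) * (S * (ℓ + 1) * ρ) := by
    have : (1 : ℝ) ≤ S * q := by nlinarith
    gcongr
    · calc (ℓ + 1) ^ 2 = (ℓ + 1) ^ 2 * 1 := by ring
        _ ≤ (ℓ + 1) ^ 2 * (S * q) := by gcongr
        _ = S * (ℓ + 1) ^ 2 * q := by ring
  calc _ ≤ 4 * S * (ℓ + 1) ^ 2 * q * (S * (ℓ + 1) * ρ) +
        8 * S * (ℓ + 1) ^ 2 * q * (S * (ℓ + 1) * ρ) +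
        2 * (S * (ℓ + 1) ^ 2 * q) * (S * (ℓ + 1) * ρ) := add_le_add (add_le_add b1 b2) b3
    _ = _ := by ring

end Blocks

/-! ### From a large box norm to segments of small influence. -/

section Structure
variable {ι α : Type*} [Fintype ι] [DecidableEq ι] [Fintype α] [DecidableEq α] [Nonempty α]

lemma expect_kernel_sq_le {X : Type*} [Fintype X] (k : X → X → ℝ) (φ : X → ℝ)
    (hφ : 𝔼 x, φ x ^ 2 ≤ 1) :
    𝔼 x, (𝔼 y, k x y * φ y) ^ 2 ≤ 𝔼 x, 𝔼 y, k x y ^ 2 := by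
  refine expect_mono fun x => (expect_mul_sq_le _ _).trans ?_
  exact mul_le_of_le_one_right (expect_nonneg' fun _ => sq_nonneg _) hφ

/-- Restrictions of `eigProj` are approximate eigenvectors of the complementary covariance. -/
lemma expect_sq_covariance_eigProj_le {I K M : Finset ι} (hIK : Disjoint I K) (hM : M = (I ∪ K)ᶜ)
    {F : (ι → α) → ℝ} (hF : ∀ x, |F x| ≤ 1) (w : ι → α) {Λ : ℝ}
    (hΛ : ∀ x, 𝔼 x', cov I F x x' * topVec (cov I F) x' = Λ * topVec (cov I F) x) :
    𝔼 y, ((𝔼 y', cov M F y y' * eigProj I F (K.piecewise w y')) -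
      Λ * eigProj I F (K.piecewise w y)) ^ 2 ≤ 2 * (covDefect I K w F + covDefect M K w F) := by
  set e := topVec (cov I F) with he
  set φ : (ι → α) → ℝ := fun y => eigProj I F (K.piecewise w y) with hφ
  -- For the correlation operator T of `F` with `K` fixed at `w`, the kernels `Cw` and `Kw` are T* T
  -- and T T*, and φ = T e. Thus `Kw` maps φ exactly to T applied to the image of e under `Cw`;
  -- passing to `cov I F` and `cov M F` costs the two defects.
  let Cw : (ι → α) → (ι → α) → ℝ := fun u u' =>
    𝔼 x, F (I.piecewise u (K.piecewise w x)) * F (I.piecewise u' (K.piecewise w x))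
  let Kw : (ι → α) → (ι → α) → ℝ := fun u u' =>
    𝔼 x, F (M.piecewise u (K.piecewise w x)) * F (M.piecewise u' (K.piecewise w x))
  let d : (ι → α) → ℝ := fun x => 𝔼 u, (Cw x u - cov I F x u) * e u
  have hswap : ∀ x y : ι → α,
      M.piecewise y (K.piecewise w x) = I.piecewise x (K.piecewise w y) := by
    intro x y
    subst hM
    funext p
    by_cases h1 : p ∈ I
    · have h2 : p ∉ K := disjoint_left.1 hIK h1
      simp [h1, h2]
    · by_cases h2 : p ∈ K <;> simp [h1, h2]
  have hφ1 : 𝔼 y, φ y ^ 2 ≤ 1 :=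
    expect_le_of_le zero_le_one fun y => (sq_le_one_iff_abs_le_one _).2 (abs_eigProj_le hF _)
  have hKφ : ∀ y, 𝔼 y', Kw y y' * φ y' =
      𝔼 x, F (I.piecewise x (K.piecewise w y)) * 𝔼 u, Cw x u * e u := by
    intro y
    simp only [Kw, Cw, φ, eigProj, hswap, expect_mul, mul_expect, ← he]
    rw [Finset.expect_comm]
    conv_rhs => rw [Finset.expect_comm]
    refine Finset.expect_congr rfl fun u _ => ?_
    rw [Finset.expect_comm]
    refine Finset.expect_congr rfl fun x _ => Finset.expect_congr rfl fun y' _ => by ring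
  have hΛφ : ∀ y, Λ * φ y =
      𝔼 x, F (I.piecewise x (K.piecewise w y)) * 𝔼 u, cov I F x u * e u := by
    intro y
    simp only [hΛ, φ, eigProj, mul_expect, ← he]
    exact Finset.expect_congr rfl fun x _ => by ring
  have hdiff : ∀ y, (𝔼 y', cov M F y y' * φ y') - Λ * φ y =
      (𝔼 y', (cov M F y y' - Kw y y') * φ y') +
        𝔼 x, F (I.piecewise x (K.piecewise w y)) * d x := by
    intro y
    have h1 : 𝔼 x, F (I.piecewise x (K.piecewise w y)) * d x =
        (𝔼 y', Kw y y' * φ y') - Λ * φ y := by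
      rw [hKφ, hΛφ, ← expect_sub_distrib]
      refine Finset.expect_congr rfl fun x _ => ?_
      rw [← mul_sub, ← expect_sub_distrib]
      simp only [d, sub_mul]
    rw [h1]
    simp only [sub_mul, expect_sub_distrib]
    ring
  have h1 : 𝔼 y, (𝔼 y', (cov M F y y' - Kw y y') * φ y') ^ 2 ≤ covDefect M K w F := by
    refine (expect_kernel_sq_le _ _ hφ1).trans (le_of_eq ?_)
    refine Finset.expect_congr rfl fun y _ => Finset.expect_congr rfl fun y' _ => by
      simp only [Kw]; ring
  have hd : 𝔼 x, d x ^ 2 ≤ covDefect I K w F :=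
    expect_kernel_sq_le (fun x u => Cw x u - cov I F x u) e (expect_topVec_sq_le _)
  have h2 : 𝔼 y, (𝔼 x, F (I.piecewise x (K.piecewise w y)) * d x) ^ 2 ≤ covDefect I K w F := by
    refine expect_le_of_le (covDefect_nonneg _ _ _ _) fun y => (expect_mul_sq_le _ _).trans ?_
    refine le_trans (mul_le_of_le_one_left (expect_nonneg' fun _ => sq_nonneg _) ?_) hd
    exact expect_le_of_le zero_le_one fun x => (sq_le_one_iff_abs_le_one _).2 (hF _)
  have h3 : ∀ y, ((𝔼 y', cov M F y y' * φ y') - Λ * φ y) ^ 2 ≤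
      2 * (𝔼 y', (cov M F y y' - Kw y y') * φ y') ^ 2 +
        2 * (𝔼 x, F (I.piecewise x (K.piecewise w y)) * d x) ^ 2 := by
    intro y
    rw [hdiff]
    nlinarith [sq_nonneg ((𝔼 y', (cov M F y y' - Kw y y') * φ y') -
      𝔼 x, F (I.piecewise x (K.piecewise w y)) * d x)]
  refine (expect_mono h3).trans ?_
  rw [expect_add_distrib, ← mul_expect, ← mul_expect]
  linarith

/-- Since |k| ≥ k², the mean of |k| + k is at least ε + m, and |k| + k is 2k or 0. -/
lemma exists_le_of_expect_sq {X : Type*} [Fintype X] [Nonempty X] {k : X → ℝ}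
    (hk : ∀ x, |k x| ≤ 1) {ε m : ℝ} (hε : ε ≤ 𝔼 x, k x ^ 2) (hm : m ≤ 𝔼 x, k x)
    (hpos : 0 < ε + m) : ∃ x, (ε + m) / 2 ≤ k x := by
  have h1 : ε + m ≤ 𝔼 x, (|k x| + k x) := by
    rw [expect_add_distrib]
    refine add_le_add (hε.trans (expect_mono fun x => ?_)) hm
    rw [← sq_abs, sq]
    exact mul_le_of_le_one_left (abs_nonneg _) (hk x)
  obtain ⟨x, -, hx⟩ := exists_le_of_le_expect univ_nonempty h1
  refine ⟨x, ?_⟩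
  rcases le_or_gt (k x) 0 with h | h
  · rw [abs_of_nonpos h] at hx
    linarith
  · rw [abs_of_pos h] at hx
    linarith

variable {S L : ℕ} {grp : Fin S × Fin L → ι}

/-- If the box norm is large and all the errors are small, then some combinatorial subspace carries
a large mean. -/
lemma exists_context_of_totalDefect_le (hg : Injective grp) {I : Finset ι}
    (hgI : Disjoint (univ.image grp) I) (a₀ : α) {F : (ι → α) → ℝ} (hF : ∀ x, |F x| ≤ 1)
    {ξ ε γ : ℝ} (hε : 0 < ε) (hbox : ε ≤ boxNorm I F) (hξ : totalDefect grp I a₀ F ≤ ξ)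
    {R c s : ℕ} (hR : 2 / ε ≤ R) (hc : 0 < c) (hL : (2 * c + 1) ^ (Fintype.card α * R) ≤ L)
    (hs0 : 0 < s) (hs : (L + 1) ^ 2 * s ≤ S) (hγ : R / (c : ℝ) ^ 2 + 32 * ξ / ε ^ 2 + 2 * ξ ≤ γ)
    (hpos : 0 < ε - ξ - 4 * s * Fintype.card α * γ + ((𝔼 x, F x) - ξ)) :
    ∃ i j, i < j ∧ j ≤ L ∧ ∃ Q : Finset (Fin S), #Q = s ∧ ∃ (x : ι → α) (b : Fin S → α),
      (ε - ξ - 4 * s * Fintype.card α * γ + ((𝔼 x, F x) - ξ)) / 2 ≤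
        𝔼 b', F ((segments grp i j).piecewise (groupwise grp a₀ (Q.piecewise b' b)) x) := by
  set q : ℝ := (Fintype.card α : ℝ) with hq
  obtain ⟨he1, Λ, hΛ1, hΛ⟩ := topVec_cov_spec (I := I) hF
  have hεΛ : ε ≤ Λ := hbox.trans hΛ1
  have hΛ0 : 0 < Λ := hε.trans_le hεΛ
  have hP := expect_eigProj_sq he1 hΛ
  have hmem : ∀ {i}, i ≤ L → i ∈ range (L + 1) := fun h => mem_range.2 (by omega)
  -- each summand of the total error is small
  have A1 : ∀ l i a, 0 ≤ covDefect I (group grp l) (chain grp a₀ l i a) F +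
      covDefect (I ∪ group grp l)ᶜ (group grp l) (chain grp a₀ l i a) F := fun l i a =>
    add_nonneg (covDefect_nonneg _ _ _ _) (covDefect_nonneg _ _ _ _)
  have A2 : ∀ l i j a, 0 ≤ meanDefect (changeSq I (segment grp l i j) a₀ a)
      (group grp l \ segment grp l i j) (chain grp a₀ l i a) F +
    𝔼 b, meanDefect (changeSq I (segment grp l i j) a₀ a) (segments grp i j \ segment grp l i j)
      (groupwise grp a₀ b) F := fun l i j a =>
    add_nonneg (meanDefect_nonneg _ _ _ _) (expect_nonneg' fun _ => meanDefect_nonneg _ _ _ _)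
  have A3 : ∀ i j, 0 ≤
      𝔼 b, meanDefect (fun F x => eigProj I F x ^ 2) (segments grp i j) (groupwise grp a₀ b) F +
      𝔼 b, meanDefect (fun F => F) (segments grp i j) (groupwise grp a₀ b) F := fun i j =>
    add_nonneg (expect_nonneg' fun _ => meanDefect_nonneg _ _ _ _)
      (expect_nonneg' fun _ => meanDefect_nonneg _ _ _ _)
  unfold totalDefect at hξ
  have N1 := Finset.sum_nonneg fun l (_ : l ∈ (univ : Finset (Fin S))) =>
    Finset.sum_nonneg fun i (_ : i ∈ range (L + 1)) =>
    Finset.sum_nonneg fun a (_ : a ∈ (univ : Finset α)) => A1 l i a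
  have N2 := Finset.sum_nonneg fun l (_ : l ∈ (univ : Finset (Fin S))) =>
    Finset.sum_nonneg fun i (_ : i ∈ range (L + 1)) =>
    Finset.sum_nonneg fun j (_ : j ∈ range (L + 1)) =>
    Finset.sum_nonneg fun a (_ : a ∈ (univ : Finset α)) => A2 l i j a
  have N3 := Finset.sum_nonneg fun i (_ : i ∈ range (L + 1)) =>
    Finset.sum_nonneg fun j (_ : j ∈ range (L + 1)) => A3 i j
  have B1 : ∀ l, ∀ i ≤ L, ∀ a, covDefect I (group grp l) (chain grp a₀ l i a) F +
      covDefect (I ∪ group grp l)ᶜ (group grp l) (chain grp a₀ l i a) F ≤ ξ := by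
    intro l i hi a
    have h1 := Finset.single_le_sum (fun a _ => A1 l i a) (mem_univ a)
    have h2 := Finset.single_le_sum (fun i _ => Finset.sum_nonneg fun a (_ : a ∈ univ) => A1 l i a)
      (hmem hi)
    have h3 := Finset.single_le_sum (fun l _ => Finset.sum_nonneg fun i (_ : i ∈ range (L + 1)) =>
      Finset.sum_nonneg fun a (_ : a ∈ univ) => A1 l i a) (mem_univ l)
    linarith
  have B2 : ∀ l, ∀ i ≤ L, ∀ j ≤ L, ∀ a, meanDefect (changeSq I (segment grp l i j) a₀ a)
      (group grp l \ segment grp l i j) (chain grp a₀ l i a) F +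
    𝔼 b, meanDefect (changeSq I (segment grp l i j) a₀ a) (segments grp i j \ segment grp l i j)
      (groupwise grp a₀ b) F ≤ ξ := by
    intro l i hi j hj a
    have h1 := Finset.single_le_sum (fun a _ => A2 l i j a) (mem_univ a)
    have h2 := Finset.single_le_sum (fun j _ => Finset.sum_nonneg fun a (_ : a ∈ univ) =>
      A2 l i j a) (hmem hj)
    have h3 := Finset.single_le_sum (fun i _ => Finset.sum_nonneg fun j (_ : j ∈ range (L + 1)) =>
      Finset.sum_nonneg fun a (_ : a ∈ univ) => A2 l i j a) (hmem hi)
    have h4 := Finset.single_le_sum (fun l _ => Finset.sum_nonneg fun i (_ : i ∈ range (L + 1)) =>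
      Finset.sum_nonneg fun j (_ : j ∈ range (L + 1)) =>
      Finset.sum_nonneg fun a (_ : a ∈ univ) => A2 l i j a) (mem_univ l)
    linarith
  have B3 : ∀ i ≤ L, ∀ j ≤ L,
      𝔼 b, meanDefect (fun F x => eigProj I F x ^ 2) (segments grp i j) (groupwise grp a₀ b) F +
      𝔼 b, meanDefect (fun F => F) (segments grp i j) (groupwise grp a₀ b) F ≤ ξ := by
    intro i hi j hj
    have h1 := Finset.single_le_sum (fun j _ => A3 i j) (hmem hj)
    have h2 := Finset.single_le_sum (fun i _ => Finset.sum_nonneg fun j (_ : j ∈ range (L + 1)) =>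
      A3 i j) (hmem hi)
    linarith
  have hξ0 : 0 ≤ ξ := (add_nonneg (add_nonneg N1 N2) N3).trans hξ
  have hRΛ : 2 / Λ ≤ R := (div_le_div_of_nonneg_left zero_le_two hε hεΛ).trans hR
  -- in each group some segment hardly matters
  have hgood : ∀ l : Fin S, ∃ p : ℕ × ℕ, p ∈ range (L + 1) ×ˢ range (L + 1) ∧ p.1 < p.2 ∧
      ∀ a, 𝔼 x, changeSq I (segment grp l p.1 p.2) a₀ a F x ≤
        R / (c : ℝ) ^ 2 + 32 * ξ / ε ^ 2 + ξ := by
    intro l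
    have hIg : Disjoint I (group grp l) := (hgI.mono_left (group_subset_range l)).symm
    -- The chain restrictions of `eigProj` for i = 0, …, L are approximate eigenvectors of a single
    -- kernel, so two of them are close, for all letters at once. The value 2ξ of η covers the two
    -- covariance defects.
    obtain ⟨i, j, hij, hj, h⟩ := exists_lt_expect_sub_sq_le
      (fun x y => F ((I ∪ group grp l)ᶜ.piecewise y x)) (fun _ _ => hF _) hΛ0 hRΛ hc hL
      (fun i a y => eigProj I F ((group grp l).piecewise (chain grp a₀ l i a) y))
      (fun i a => expect_le_of_le zero_le_one fun y =>
        (sq_le_one_iff_abs_le_one _).2 (abs_eigProj_le hF _)) (η := 2 * ξ)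
      (fun i hi a => (expect_sq_covariance_eigProj_le hIg rfl hF _ hΛ).trans
        (by linarith [B1 l i hi a]))
    refine ⟨(i, j), by simp only [mem_product, mem_range]; omega, hij, fun a => ?_⟩
    have h1 := h a
    simp only [chain_step hg a₀ a l hij.le, chain_same hg a₀ a l (i := i) (j := j)] at h1
    have h2 : 𝔼 x, changeSq I (segment grp l i j) a₀ a F
        ((group grp l \ segment grp l i j).piecewise (chain grp a₀ l i a) x) ≤
        R / (c : ℝ) ^ 2 + 32 * ξ / ε ^ 2 := by
      refine h1.trans ?_
      have : 16 * (2 * ξ) / Λ ^ 2 ≤ 32 * ξ / ε ^ 2 := by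
        rw [← mul_assoc]
        norm_num
        gcongr
      linarith
    have h3 : meanDefect (changeSq I (segment grp l i j) a₀ a)
      (group grp l \ segment grp l i j) (chain grp a₀ l i a) F ≤ ξ := by
      have := B2 l i (by omega) j hj a
      have h4 : 0 ≤ 𝔼 b, meanDefect (changeSq I (segment grp l i j) a₀ a)
        (segments grp i j \ segment grp l i j) (groupwise grp a₀ b) F :=
        expect_nonneg' fun _ => meanDefect_nonneg _ _ _ _
      linarith
    have h5 := (abs_le.1 h3).1
    simp only
    linarith
  choose pr hpr using hgood
  -- There are (L + 1)² pairs, so `s` of the groups share the same one.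
  obtain ⟨⟨i, j⟩, hij, hfib⟩ := Finset.exists_le_card_fiber_of_mul_le_card_of_maps_to
    (s := (univ : Finset (Fin S))) (t := range (L + 1) ×ˢ range (L + 1)) (f := pr) (n := s)
    (fun l _ => (hpr l).1) (by simp) (by simpa [card_product, sq] using hs)
  obtain ⟨Q, hQ, hQs⟩ := exists_subset_card_eq hfib
  simp only [mem_product, mem_range] at hij
  have hi : i ≤ L := by omega
  have hj : j ≤ L := by omega
  have hlt : i < j := by
    obtain ⟨l, hl⟩ := card_pos.1 (hQs.symm ▸ hs0)
    have h1 := (mem_filter.1 (hQ hl)).2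
    have h2 := (hpr l).2.1
    rwa [h1] at h2
  -- The smallness was found next to a chain; it is moved to random letters on the other blocks
  -- through the unrestricted mean. Each of the two passages costs ξ.
  have hch : ∀ l ∈ Q, ∀ a, 𝔼 b, 𝔼 x, changeSq I (segment grp l i j) a₀ a F
      ((segments grp i j \ segment grp l i j).piecewise (groupwise grp a₀ b) x) ≤ γ := by
    intro l hl a
    have h1 := (mem_filter.1 (hQ hl)).2
    have h2 := (hpr l).2.2 a
    rw [h1] at h2
    simp only at h2
    have h3 := B2 l i hi j hj a
    have h4 := meanDefect_nonneg (changeSq I (segment grp l i j) a₀ a)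
      (group grp l \ segment grp l i j) (chain grp a₀ l i a) F
    have h5 : 𝔼 b, 𝔼 x, changeSq I (segment grp l i j) a₀ a F
      ((segments grp i j \ segment grp l i j).piecewise (groupwise grp a₀ b) x) ≤
      𝔼 b : Fin S → α, (meanDefect (changeSq I (segment grp l i j) a₀ a)
        (segments grp i j \ segment grp l i j) (groupwise grp a₀ b) F +
        𝔼 x, changeSq I (segment grp l i j) a₀ a F x) := by
      refine expect_mono fun b => ?_
      have := le_abs_self ((𝔼 x, changeSq I (segment grp l i j) a₀ a F
        ((segments grp i j \ segment grp l i j).piecewise (groupwise grp a₀ b) x)) -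
        𝔼 x, changeSq I (segment grp l i j) a₀ a F x)
      rw [meanDefect]
      linarith
    rw [expect_add_distrib, Fintype.expect_const] at h5
    linarith
  -- the projection keeps its norm after averaging over the good blocks
  set U := segments grp i j with hU
  let Γ : (ι → α) → (Fin S → α) → ℝ := fun x b => eigProj I F (U.piecewise (groupwise grp a₀ b) x)
  -- Both letters are compared with `a₀`, and each square is bounded by the sum over all letters;
  -- this gives 4q.
  have hinf : ∀ l ∈ Q, 𝔼 x, 𝔼 b, 𝔼 c, (Γ x b - Γ x (update b l c)) ^ 2 ≤ 4 * q * γ := by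
    intro l hl
    have h1 : ∀ x b c, (Γ x b - Γ x (update b l c)) ^ 2 ≤
        4 * ∑ a, changeSq I (segment grp l i j) a₀ a F
          ((U \ segment grp l i j).piecewise (groupwise grp a₀ b) x) := by
      intro x b c
      simp only [Γ]
      rw [groupwise_split hg a₀ b l i j x, groupwise_update_split hg a₀ b l c i j x]
      set z := (segments grp i j \ segment grp l i j).piecewise (groupwise grp a₀ b) x
      have h2 := Finset.single_le_sum (f := fun a => changeSq I (segment grp l i j) a₀ a F z)
        (fun a _ => sq_nonneg _) (mem_univ (b l))
      have h3 := Finset.single_le_sum (f := fun a => changeSq I (segment grp l i j) a₀ a F z)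
        (fun a _ => sq_nonneg _) (mem_univ c)
      simp only [changeSq] at h2 h3 ⊢
      nlinarith [sq_nonneg (eigProj I F ((segment grp l i j).piecewise (fun _ => b l) z) +
        eigProj I F ((segment grp l i j).piecewise (fun _ => c) z) -
        2 * eigProj I F ((segment grp l i j).piecewise (fun _ => a₀) z))]
    refine (expect_mono fun x => expect_mono fun b => expect_mono fun c => h1 x b c).trans ?_
    simp only [Fintype.expect_const, ← mul_expect, expect_sum_comm]
    have h4 : ∑ a, 𝔼 x, 𝔼 b, changeSq I (segment grp l i j) a₀ a F
        ((U \ segment grp l i j).piecewise (groupwise grp a₀ b) x) ≤ ∑ _a : α, γ := by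
      refine Finset.sum_le_sum fun a _ => ?_
      rw [Finset.expect_comm]
      exact hch l hl a
    rw [Finset.sum_const, card_univ, nsmul_eq_mul] at h4
    linarith
  have hΓ : Λ - ξ ≤ 𝔼 x, 𝔼 b, Γ x b ^ 2 := by
    rw [Finset.expect_comm]
    have h1 : 𝔼 b : Fin S → α, (Λ - meanDefect (fun F x => eigProj I F x ^ 2) U
        (groupwise grp a₀ b) F) ≤ 𝔼 b, 𝔼 x, Γ x b ^ 2 := by
      refine expect_mono fun b => ?_
      have := neg_abs_le ((𝔼 x, eigProj I F (U.piecewise (groupwise grp a₀ b) x) ^ 2) -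
        𝔼 x, eigProj I F x ^ 2)
      simp only [meanDefect, Γ]
      linarith
    rw [expect_sub_distrib, Fintype.expect_const] at h1
    have h2 := B3 i hi j hj
    have h3 : 0 ≤ 𝔼 b, meanDefect (fun F => F) U (groupwise grp a₀ b) F :=
      expect_nonneg' fun _ => meanDefect_nonneg _ _ _ _
    linarith
  have hES : 𝔼 x, 𝔼 b, Γ x b ^ 2 - 𝔼 x, 𝔼 b, (𝔼 b', Γ x (Q.piecewise b' b)) ^ 2 ≤
      s * (4 * q * γ) := by
    rw [← expect_sub_distrib]
    refine (expect_mono fun x => expect_sq_sub_expect_piecewise_sq_le (Γ x) Q).trans ?_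
    rw [expect_sum_comm]
    refine (Finset.sum_le_sum hinf).trans ?_
    rw [Finset.sum_const, hQs, nsmul_eq_mul]
  let k : (ι → α) × (Fin S → α) → ℝ := fun p =>
    𝔼 b', F (U.piecewise (groupwise grp a₀ (Q.piecewise b' p.2)) p.1)
  have hUI : Disjoint U I := hgI.mono_left (segments_subset_range i j)
  -- The blocks avoid `I`, so averaging over them commutes with taking the correlation with the
  -- eigenvector. Cauchy–Schwarz then drops the eigenvector.
  have hk2 : 𝔼 x, 𝔼 b, (𝔼 b', Γ x (Q.piecewise b' b)) ^ 2 ≤ 𝔼 p, k p ^ 2 := by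
    rw [← expect_expect_eq_prod (fun x b => k (x, b) ^ 2),
      ← expect_piecewise' I (fun x => 𝔼 b, k (x, b) ^ 2)]
    refine expect_mono fun x => ?_
    rw [Finset.expect_comm]
    refine expect_mono fun b => ?_
    have h1 : 𝔼 b', Γ x (Q.piecewise b' b) = 𝔼 u, topVec (cov I F) u * k (I.piecewise u x, b) := by
      simp only [Γ, k, eigProj, mul_expect]
      rw [Finset.expect_comm]
      refine Finset.expect_congr rfl fun u _ => Finset.expect_congr rfl fun b' _ => ?_
      congr 2
      funext p
      by_cases h1 : p ∈ I
      · have : p ∉ U := fun h => disjoint_left.1 hUI h h1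
        simp [h1, this]
      · by_cases h2 : p ∈ U <;> simp [h1, h2]
    rw [h1]
    refine (expect_mul_sq_le _ _).trans ?_
    exact mul_le_of_le_one_left (expect_nonneg' fun _ => sq_nonneg _) (expect_topVec_sq_le _)
  have hkm : (𝔼 x, F x) - ξ ≤ 𝔼 p, k p := by
    rw [← expect_expect_eq_prod (fun x b => k (x, b))]
    have h1 : ∀ x, 𝔼 b, k (x, b) = 𝔼 b, F (U.piecewise (groupwise grp a₀ b) x) := fun x =>
      expect_piecewise' Q (fun b => F (U.piecewise (groupwise grp a₀ b) x))
    simp only [h1]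
    rw [Finset.expect_comm]
    have h2 : 𝔼 b : Fin S → α, ((𝔼 x, F x) - meanDefect (fun F => F) U (groupwise grp a₀ b) F) ≤
        𝔼 b, 𝔼 x, F (U.piecewise (groupwise grp a₀ b) x) := by
      refine expect_mono fun b => ?_
      have := neg_abs_le ((𝔼 x, F (U.piecewise (groupwise grp a₀ b) x)) - 𝔼 x, F x)
      simp only [meanDefect]
      linarith
    rw [expect_sub_distrib, Fintype.expect_const] at h2
    have h3 := B3 i hi j hj
    have h4 : 0 ≤ 𝔼 b, meanDefect (fun F x => eigProj I F x ^ 2) U (groupwise grp a₀ b) F :=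
      expect_nonneg' fun _ => meanDefect_nonneg _ _ _ _
    linarith
  obtain ⟨⟨x, b⟩, hxb⟩ := exists_le_of_expect_sq (k := k)
    (fun p => abs_expect_le_of_le zero_le_one fun _ => hF _)
    (ε := ε - ξ - 4 * s * q * γ) (m := (𝔼 x, F x) - ξ) (by linarith) hkm hpos
  exact ⟨i, j, hlt, hj, Q, hQs, x, b, hxb⟩

end Structure

/-! ### Combinatorial subspaces and the choice of parameters. -/

section Subspace
variable {ι α κ : Type*}

/-- The point with parameters `x` of the combinatorial subspace given by `r`: the coordinates `i`
with `r i = inl a` are equal to `a`, those with `r i = inr k` are equal to `x k`. -/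
def subpoint (r : ι → α ⊕ κ) (x : κ → α) : ι → α := fun i => Sum.elim id x (r i)

variable [Fintype ι] [DecidableEq ι] [Fintype α] [DecidableEq α] [Nonempty α]
variable {S L : ℕ} {grp : Fin S × Fin L → ι}

lemma totalDefect_nonneg (I : Finset ι) (a₀ : α) (F : (ι → α) → ℝ) :
    0 ≤ totalDefect grp I a₀ F := by
  unfold totalDefect
  refine add_nonneg (add_nonneg ?_ ?_) ?_
  · exact sum_nonneg fun l _ => sum_nonneg fun i _ => sum_nonneg fun a _ =>
      add_nonneg (covDefect_nonneg _ _ _ _) (covDefect_nonneg _ _ _ _)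
  · exact sum_nonneg fun l _ => sum_nonneg fun i _ => sum_nonneg fun j _ => sum_nonneg fun a _ =>
      add_nonneg (meanDefect_nonneg _ _ _ _) (expect_nonneg' fun _ => meanDefect_nonneg _ _ _ _)
  · exact sum_nonneg fun i _ => sum_nonneg fun j _ =>
      add_nonneg (expect_nonneg' fun _ => meanDefect_nonneg _ _ _ _)
        (expect_nonneg' fun _ => meanDefect_nonneg _ _ _ _)

lemma boxNorm_le_one (I : Finset ι) {F : (ι → α) → ℝ} (hF : ∀ x, |F x| ≤ 1) :
    boxNorm I F ≤ 1 := by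
  refine expect_le_of_le zero_le_one fun u => expect_le_of_le zero_le_one fun u' => ?_
  rw [sq_le_one_iff_abs_le_one]
  refine abs_expect_le_of_le zero_le_one fun x => ?_
  rw [abs_mul]
  exact mul_le_one₀ (hF _) (abs_nonneg _) (hF _)

/-- Restricting to the constant values on segments is restricting to a combinatorial subspace. -/
lemma exists_subpoint_of_segments (hg : Injective grp) {i j s : ℕ} (hij : i < j) (hj : j ≤ L)
    {Q : Finset (Fin S)} (hQ : #Q = s) (τ : Equiv.Perm ι) (F : (ι → α) → ℝ) (a₀ : α) (x : ι → α)
    (b : Fin S → α) : ∃ r : ι → α ⊕ Fin s, (∀ k, ∃ p, r p = Sum.inr k) ∧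
      𝔼 y, F (subpoint r y) = 𝔼 b', relabel τ F
        ((segments grp i j).piecewise (groupwise grp a₀ (Q.piecewise b' b)) x) := by
  classical
  let e : Fin s ≃ Q := (Q.equivFinOfCardEq hQ).symm
  have he : Injective fun m => (e m : Fin S) := Subtype.val_injective.comp e.injective
  -- The wildcard set of the parameter `m` is the preimage under `τ` of the segment of the `m`-th
  -- group in `Q`, nonempty since i < j ≤ L.
  let r : ι → α ⊕ Fin s := fun p =>
    if h : ∃ m : Fin s, τ p ∈ segment grp (e m) i j then Sum.inr h.choose
    else Sum.inl ((segments grp i j).piecewise (groupwise grp a₀ b) x (τ p))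
  have huniq : ∀ {p l l'}, p ∈ segment grp l i j → p ∈ segment grp l' i j → l = l' := by
    intro p l l' h h'
    obtain ⟨k, -, rfl⟩ := mem_segment.1 h
    exact ((apply_mem_segment hg).1 h').1
  have hr : ∀ p m, τ p ∈ segment grp (e m) i j → r p = Sum.inr m := by
    intro p m h
    have h' : ∃ m : Fin s, τ p ∈ segment grp (e m) i j := ⟨m, h⟩
    simp only [r, dif_pos h']
    exact congrArg _ (he (huniq h'.choose_spec h))
  refine ⟨r, fun k => ⟨τ.symm (grp (e k, ⟨i, by omega⟩)), hr _ _ ?_⟩, ?_⟩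
  · rw [Equiv.apply_symm_apply, apply_mem_segment hg]
    exact ⟨rfl, le_rfl, hij⟩
  · rw [← expect_comp_injective he]
    refine Finset.expect_congr rfl fun b' _ => ?_
    rw [relabel]
    congr 1
    funext p
    by_cases h : ∃ m : Fin s, τ p ∈ segment grp (e m) i j
    · obtain ⟨m, hm⟩ := h
      have h1 : τ p ∈ segments grp i j := mem_segments.2 ⟨_, hm⟩
      rw [subpoint, hr p m hm, comp_apply, piecewise_eq_of_mem _ _ _ h1]
      obtain ⟨k, -, hk⟩ := mem_segment.1 hm
      rw [← hk, groupwise_apply hg, piecewise_eq_of_mem _ _ _ (e m).2]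
      rfl
    · rw [subpoint]
      simp only [r, dif_neg h, Sum.elim_inl, id, comp_apply]
      by_cases h1 : τ p ∈ segments grp i j
      · rw [piecewise_eq_of_mem _ _ _ h1, piecewise_eq_of_mem _ _ _ h1]
        obtain ⟨l, hl⟩ := mem_segments.1 h1
        have hlQ : l ∉ Q := fun hlQ => h ⟨e.symm ⟨l, hlQ⟩, by simpa using hl⟩
        obtain ⟨k, -, hk⟩ := mem_segment.1 hl
        rw [← hk, groupwise_apply hg, groupwise_apply hg, piecewise_eq_of_notMem _ _ _ hlQ]
      · rw [piecewise_eq_of_notMem _ _ _ h1, piecewise_eq_of_notMem _ _ _ h1]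

/-- The length of the groups of coordinates. -/
def groupLength (q D s : ℕ) : ℕ := (32 * s * q * D + 1) ^ (4 * q * D)

/-- A number of coordinates that makes all planting errors negligible. -/
def poolSize (q D s : ℕ) : ℕ :=
  q * (2 ^ 18 * s ^ 3 * (groupLength q D s + 1) ^ 7 * q ^ 2 * D ^ 4) ^ 2

lemma mul_groupLength_le {q D s : ℕ} (hq : 0 < q) (hD : 0 < D) :
    (groupLength q D s + 1) ^ 2 * s * groupLength q D s ≤ poolSize q D s := by
  rw [poolSize]
  set L := groupLength q D s
  have h1 : (L + 1) ^ 2 * s * L ≤ s * (L + 1) ^ 3 := by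
    nlinarith [Nat.zero_le (s * (L + 1) ^ 2)]
  have h2 : s * (L + 1) ^ 3 ≤ 2 ^ 18 * s ^ 3 * (L + 1) ^ 7 * q ^ 2 * D ^ 4 := by
    calc s * (L + 1) ^ 3 ≤ s ^ 3 * (L + 1) ^ 7 := by
          refine Nat.mul_le_mul (Nat.le_self_pow (by norm_num) s)
            (Nat.pow_le_pow_right (by omega) (by norm_num))
      _ = 1 * s ^ 3 * (L + 1) ^ 7 * 1 * 1 := by ring
      _ ≤ _ := by
          gcongr
          · norm_num
          · exact Nat.one_le_pow _ _ hq
          · exact Nat.one_le_pow _ _ hD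
  refine h1.trans (h2.trans ?_)
  exact (Nat.le_self_pow two_ne_zero _).trans (Nat.le_mul_of_pos_left _ hq)

/-- `poolSize` is q times a square, so the square root is the reciprocal of an integer, whose factor
(L + 1) ^ 7 cancels those from the number of groups squared and from the count of error terms. -/
lemma plantingError_le {q D s : ℕ} (hq : 0 < q) (hD : 0 < D) (hs : 0 < s) {ε : ℝ}
    (hDε : 1 / D ≤ ε) :
    14 * (((groupLength q D s + 1) ^ 2 * s : ℕ) : ℝ) ^ 2 * (groupLength q D s + 1) ^ 3 * q *
      √((q : ℝ) / poolSize q D s) ≤ ε ^ 4 / (16640 * s * q) := by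
  have h1 : √((q : ℝ) / poolSize q D s) =
      1 / (2 ^ 18 * s ^ 3 * (groupLength q D s + 1) ^ 7 * q ^ 2 * D ^ 4) := by
    rw [poolSize, Nat.cast_mul, ← div_div, div_self (by positivity), Nat.cast_pow,
      ← one_div_pow, Real.sqrt_sq (by positivity)]
    norm_cast
  rw [h1]
  generalize groupLength q D s = L
  push_cast
  have h2 : 1 / (D : ℝ) ^ 4 ≤ ε ^ 4 := by
    rw [← one_div_pow]
    exact pow_le_pow_left₀ (by positivity) hDε 4
  have h3 : 0 ≤ 1 / (D : ℝ) ^ 4 := by positivity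
  calc (14 * (((L : ℝ) + 1) ^ 2 * s) ^ 2 * (L + 1) ^ 3 * q *
        (1 / (2 ^ 18 * s ^ 3 * (L + 1) ^ 7 * q ^ 2 * D ^ 4)) : ℝ)
      = 14 / 2 ^ 18 * (1 / D ^ 4) / (s * q) := by field_simp
    _ ≤ 1 / 16640 * ε ^ 4 / (s * q) := by
        refine div_le_div_of_nonneg_right ?_ (by positivity)
        linarith
    _ = _ := by field_simp

/-- Rounding of coefficients takes one half of the target; the spectral tail and the planting errors
share the other. -/
lemma segmentError_le {q D s ε ξ : ℝ} (hq : 1 ≤ q) (hD : 1 ≤ D) (hs : 1 ≤ s) (hDε : 1 / D ≤ ε)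
    (hε1 : ε ≤ 1) (hξ0 : 0 ≤ ξ) (hξ : ξ ≤ ε ^ 3 / (8320 * s * q)) :
    4 * D / (16 * s * q * D) ^ 2 + 32 * ξ / (ε / 2) ^ 2 + 2 * ξ ≤ ε / (32 * s * q) := by
  have hε : 0 < ε := lt_of_lt_of_le (by positivity) hDε
  have hsq : 1 ≤ s * q := by nlinarith
  have hs0 : 0 < s := by linarith
  have hq0 : 0 < q := by linarith
  have h1 : 4 * D / (16 * s * q * D) ^ 2 ≤ ε / (64 * s * q) := by
    calc 4 * D / (16 * s * q * D) ^ 2 = 1 / D / (64 * s * q) * (1 / (s * q)) := by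
          field_simp; norm_num
      _ ≤ ε / (64 * s * q) * 1 := by
          refine mul_le_mul (div_le_div_of_nonneg_right hDε (by positivity)) ?_ (by positivity)
            (by positivity)
          rw [div_le_one (by positivity)]
          exact hsq
      _ = _ := mul_one _
  have h2 : 32 * ξ / (ε / 2) ^ 2 + 2 * ξ ≤ 130 * ξ / ε ^ 2 := by
    have h3 : 32 * ξ / (ε / 2) ^ 2 = 128 * ξ / ε ^ 2 := by
      rw [div_pow, div_div_eq_mul_div]
      ring
    have h4 : 2 * ξ ≤ 2 * ξ / ε ^ 2 :=
      le_div_self (by positivity) (by positivity) (pow_le_one₀ hε.le hε1)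
    rw [h3]
    refine (add_le_add_right h4 _).trans (le_of_eq ?_)
    ring
  have h3 : 130 * ξ / ε ^ 2 ≤ ε / (64 * s * q) := by
    rw [div_le_iff₀ (by positivity)]
    calc 130 * ξ ≤ 130 * (ε ^ 3 / (8320 * s * q)) := by linarith
      _ = ε / (64 * s * q) * ε ^ 2 := by
        field_simp
        norm_num
  have h4 : ε / (64 * s * q) + ε / (64 * s * q) = ε / (32 * s * q) := by
    field_simp
    norm_num
  linarith

/-- A function that has a large box norm on average over relabelings of the coordinates
has a large mean on some combinatorial subspace. -/
theorem exists_subpoint_of_boxNorm {q D s : ℕ} (hq : q = Fintype.card α) (hD : 0 < D) (hs : 0 < s)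
    {I : Finset ι} (hI : 2 * poolSize q D s ≤ #I) (hJ : 2 * poolSize q D s ≤ #Iᶜ)
    {F : (ι → α) → ℝ} (hF : ∀ x, |F x| ≤ 1) {ε : ℝ} (hDε : 1 / D ≤ ε)
    (hbox : ε ≤ 𝔼 τ : Equiv.Perm ι, boxNorm I (relabel τ F)) (hm : -(ε / 16) ≤ 𝔼 x, F x) :
    ∃ r : ι → α ⊕ Fin s, (∀ k, ∃ p, r p = Sum.inr k) ∧ ε / 8 ≤ 𝔼 y, F (subpoint r y) := by
  classical
  have hq0 : 0 < q := hq ▸ Fintype.card_pos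
  have hqr : (q : ℝ) = Fintype.card α := by rw [hq]
  set L := groupLength q D s with hL
  set S := (L + 1) ^ 2 * s with hS
  set N := poolSize q D s with hN
  have hL0 : 0 < L := by rw [hL, groupLength]; positivity
  have hS0 : 0 < S := by positivity
  have hN0 : 0 < N := by rw [hN, poolSize]; positivity
  set a₀ : α := Classical.arbitrary α
  have hD' : (1 : ℝ) ≤ D := by exact_mod_cast hD
  have hs' : (1 : ℝ) ≤ s := by exact_mod_cast hs
  have hq' : (1 : ℝ) ≤ q := by exact_mod_cast hq0
  have hε : 0 < ε := lt_of_lt_of_le (by positivity) hDε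
  have hε1 : ε ≤ 1 := hbox.trans (expect_le_of_le zero_le_one fun τ => boxNorm_le_one I fun _ =>
    hF _)
  have hSL : S * L ≤ N := mul_groupLength_le hq0 hD
  obtain ⟨G, hGJ, hG⟩ := exists_subset_card_eq (s := Iᶜ) (n := S * L) (by omega)
  have hcard : Fintype.card (Fin S × Fin L) = Fintype.card G := by simp [hG]
  let eG : Fin S × Fin L ≃ G := Fintype.equivOfCardEq hcard
  let grp : Fin S × Fin L → ι := fun p => eG p
  have hg : Injective grp := Subtype.val_injective.comp eG.injective
  have hrange : univ.image grp ⊆ G := by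
    intro p hp
    obtain ⟨k, -, rfl⟩ := mem_image.1 hp
    exact (eG k).2
  have hGI : Disjoint G I := disjoint_left.2 fun p hp hp' => (mem_compl.1 (hGJ hp)) hp'
  have hgI : Disjoint (univ.image grp) I := hGI.mono_left hrange
  have hgQ : Disjoint (univ.image grp) (Iᶜ \ G) := (disjoint_sdiff).mono_left hrange
  have hIQ : Disjoint I (Iᶜ \ G) := disjoint_compl_right.mono_right sdiff_subset
  have hNQ : N ≤ #(Iᶜ \ G) := by
    rw [card_sdiff_of_subset hGJ, hG]; omega
  have herr := expect_totalDefect_le I (Iᶜ \ G) a₀ hN0 (by omega) hNQ hS0 hgI hgQ hIQ hF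
  set ξ₀ : ℝ := 14 * S ^ 2 * (L + 1) ^ 3 * Fintype.card α * √((Fintype.card α : ℝ) / N) with hξ₀
  have hξ₀pos : 0 < ξ₀ := by
    rw [hξ₀, ← hqr]
    have : 0 < √((q : ℝ) / N) := Real.sqrt_pos.2 (by positivity)
    positivity
  have hξ₀le : ξ₀ ≤ ε ^ 4 / (16640 * s * q) := by
    rw [hξ₀, ← hqr]
    exact plantingError_le hq0 hD hs hDε
  -- The weight ε / (2ξ₀) makes the expected penalty at most ε / 2, so one arrangement has both box
  -- norm at least ε / 2 and total error at most 2ξ₀ / ε.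
  have hcomb : ε / 2 ≤ 𝔼 τ : Equiv.Perm ι, (boxNorm I (relabel τ F) -
      ε / (2 * ξ₀) * totalDefect grp I a₀ (relabel τ F)) := by
    rw [expect_sub_distrib, ← mul_expect]
    have := mul_le_mul_of_nonneg_left herr (by positivity : 0 ≤ ε / (2 * ξ₀))
    have h2 : ε / (2 * ξ₀) * ξ₀ = ε / 2 := by field_simp
    linarith
  obtain ⟨τ, -, hτ⟩ := exists_le_of_le_expect univ_nonempty hcomb
  have hT0 := totalDefect_nonneg (grp := grp) I a₀ (relabel τ F)
  have hb1 : boxNorm I (relabel τ F) ≤ 1 := boxNorm_le_one I fun _ => hF _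
  have hbox' : ε / 2 ≤ boxNorm I (relabel τ F) := by
    have : 0 ≤ ε / (2 * ξ₀) * totalDefect grp I a₀ (relabel τ F) := by positivity
    linarith
  set ξ : ℝ := 2 * ξ₀ / ε with hξ
  have hdef : totalDefect grp I a₀ (relabel τ F) ≤ ξ := by
    have h1 : ε / (2 * ξ₀) * totalDefect grp I a₀ (relabel τ F) ≤ 1 := by linarith
    rw [hξ, le_div_iff₀ hε]
    rw [div_mul_eq_mul_div, div_le_one (by positivity)] at h1
    linarith
  have hξle : ξ ≤ ε ^ 3 / (8320 * s * q) := by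
    rw [hξ, div_le_iff₀ hε]
    calc 2 * ξ₀ ≤ 2 * (ε ^ 4 / (16640 * s * q)) := by linarith
      _ = _ := by field_simp; norm_num
  have hmean : 𝔼 x, relabel τ F x = 𝔼 x, F x := expect_comp_perm τ F
  have hξε : ξ ≤ ε / 100 := by
    refine hξle.trans ?_
    have h2 : ε ^ 3 ≤ ε := by
      have := pow_le_pow_of_le_one hε.le hε1 (by norm_num : 1 ≤ 3)
      simpa using this
    rw [div_le_div_iff₀ (by positivity) (by norm_num)]
    have : (1 : ℝ) ≤ s * q := by nlinarith
    nlinarith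
  set γ : ℝ := ε / (32 * s * q) with hγ
  have hγ' : ((4 * D : ℕ) : ℝ) / ((16 * s * q * D : ℕ) : ℝ) ^ 2 + 32 * ξ / (ε / 2) ^ 2 + 2 * ξ ≤
      γ := by
    push_cast
    exact segmentError_le hq' hD' hs' hDε hε1 (by positivity) hξle
  have hsγ : 4 * (s : ℝ) * Fintype.card α * γ = ε / 8 := by
    rw [← hqr, hγ]; field_simp; norm_num
  -- With 4sqγ = ε / 8, ξ ≤ ε / 100 and mean at least −ε / 16, half of ε / 2 − ε / 8 − ε / 16 − 2ξ
  -- still exceeds ε / 8. `groupLength` is (2c + 1) ^ (qR) for the chosen `R` and `c`.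
  obtain ⟨i, j, hij, hj, Q, hQ, x, b, h⟩ := exists_context_of_totalDefect_le (L := L) (S := S) hg
    hgI a₀ (F := relabel τ F) (fun _ => hF _) (half_pos hε) hbox' hdef (R := 4 * D)
    (c := 16 * s * q * D) (s := s) (γ := γ)
    (by
      push_cast
      rw [div_le_iff₀ (half_pos hε)]
      rw [div_le_iff₀ (by positivity)] at hDε
      linarith) (by positivity)
    (by rw [hL, groupLength, ← hq]; exact le_of_eq (by congr 1 <;> ring)) hs le_rfl hγ'
    (by rw [hsγ, hmean]; linarith)
  obtain ⟨r, hr, hrF⟩ := exists_subpoint_of_segments hg hij hj hQ τ F a₀ x b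
  refine ⟨r, hr, ?_⟩
  rw [hrF]
  refine le_trans ?_ h
  rw [hsγ, hmean]
  linarith

end Subspace

/-! ### Doubly stochastic kernels and Cauchy–Schwarz. -/

section Kernel
variable {W W' : Type*} [Fintype W] [Fintype W']

/-- A doubly stochastic kernel on a finite set with its uniform measure. -/
structure IsKernel (k : W → W → ℝ) : Prop where
  nonneg : ∀ a b, 0 ≤ k a b
  row : ∀ a, 𝔼 b, k a b = 1
  col : ∀ b, 𝔼 a, k a b = 1

/-- The composition of two kernels. -/
noncomputable def kcomp (p k : W → W → ℝ) (a b : W) : ℝ := 𝔼 c, p a c * k c b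

/-- The composition of the transpose of a kernel with the kernel. -/
noncomputable def ksq (k : W → W → ℝ) (a b : W) : ℝ := 𝔼 c, k c a * k c b

lemma expect_const_of_kernel {k : W → W → ℝ} (hk : IsKernel k) [Nonempty W] :
    𝔼 a, 𝔼 b, k a b = 1 := by
  simp only [hk.row, Fintype.expect_const]

lemma IsKernel.kcomp {p k : W → W → ℝ} (hp : IsKernel p) (hk : IsKernel k) :
    IsKernel (kcomp p k) where
  nonneg a b := expect_nonneg' fun c => mul_nonneg (hp.nonneg _ _) (hk.nonneg _ _)
  row a := by
    simp only [TripleDensity.kcomp]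
    rw [Finset.expect_comm]
    simp only [← mul_expect, hk.row, mul_one, hp.row]
  col b := by
    simp only [TripleDensity.kcomp]
    rw [Finset.expect_comm]
    simp only [← expect_mul, hp.col, one_mul, hk.col]

lemma IsKernel.ksq {k : W → W → ℝ} (hk : IsKernel k) : IsKernel (ksq k) where
  nonneg a b := expect_nonneg' fun c => mul_nonneg (hk.nonneg _ _) (hk.nonneg _ _)
  row a := by
    simp only [TripleDensity.ksq]
    rw [Finset.expect_comm]
    simp only [← mul_expect, hk.row, mul_one, hk.col]
  col b := by
    simp only [TripleDensity.ksq]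
    rw [Finset.expect_comm]
    simp only [← expect_mul, hk.row, one_mul, hk.col]

lemma expect_sq_kernel (n : W → W → ℝ) (h : W → ℝ) :
    𝔼 c, (𝔼 a, n c a * h a) ^ 2 = 𝔼 a, 𝔼 b, ksq n a b * (h a * h b) := by
  simp only [sq, ksq, expect_mul, mul_expect]
  rw [Finset.expect_comm]
  refine Finset.expect_congr rfl fun a _ => ?_
  rw [Finset.expect_comm]
  exact Finset.expect_congr rfl fun b _ => Finset.expect_congr rfl fun c _ => by ring

/-- The Cauchy–Schwarz inequality removing a bounded function that the kernel preserves. -/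
lemma sq_expect_mul_le {K : W → W → ℝ} (hK : IsKernel K) {F : W → ℝ} (hF : ∀ a, |F a| ≤ 1)
    (hinv : ∀ a b, K a b ≠ 0 → F a = F b) (h : W → ℝ) :
    (𝔼 a, F a * h a) ^ 2 ≤ 𝔼 c, (𝔼 a, K c a * h a) ^ 2 := by
  have h1 : 𝔼 a, F a * h a = 𝔼 c, F c * 𝔼 a, K c a * h a := by
    simp only [mul_expect]
    rw [Finset.expect_comm]
    refine Finset.expect_congr rfl fun a _ => ?_
    have h2 : ∀ c, F c * (K c a * h a) = K c a * (F a * h a) := by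
      intro c
      by_cases hc : K c a = 0
      · simp [hc]
      · rw [hinv c a hc]; ring
    simp only [h2]
    rw [← expect_mul, hK.col, one_mul]
  rw [h1]
  refine (expect_mul_sq_le _ _).trans ?_
  refine mul_le_of_le_one_left (expect_nonneg' fun _ => sq_nonneg _) ?_
  exact expect_le_of_le zero_le_one fun a => (sq_le_one_iff_abs_le_one _).2 (hF _)

/-- One copy of `A` is removed as a function preserved by `p`, the other one is doubled; the kernel
k becomes (p k)ᵀ (p k). -/
lemma sq_expect_kernel_le {p k : W → W → ℝ} (hp : IsKernel p) {A : W → ℝ}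
    (hA : ∀ a, |A a| ≤ 1) (hinv : ∀ a b, p a b ≠ 0 → A a = A b) :
    (𝔼 a, 𝔼 b, k a b * (A a * A b)) ^ 2 ≤ 𝔼 a, 𝔼 b, ksq (kcomp p k) a b * (A a * A b) := by
  have h1 : 𝔼 a, 𝔼 b, k a b * (A a * A b) = 𝔼 a, A a * 𝔼 b, k a b * A b := by
    simp only [mul_expect]
    exact Finset.expect_congr rfl fun a _ => Finset.expect_congr rfl fun b _ => by ring
  rw [h1, ← expect_sq_kernel]
  refine (sq_expect_mul_le hp hA hinv _).trans (le_of_eq ?_)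
  refine Finset.expect_congr rfl fun c _ => ?_
  congr 1
  simp only [kcomp, mul_expect, expect_mul]
  rw [Finset.expect_comm]
  exact Finset.expect_congr rfl fun b _ => Finset.expect_congr rfl fun a _ => by ring

lemma sq_expect_weight_le {w q : W → ℝ} (hw : ∀ a, 0 ≤ w a) (h1 : 𝔼 a, w a = 1) :
    (𝔼 a, w a * q a) ^ 2 ≤ 𝔼 a, w a * q a ^ 2 := by
  set m := 𝔼 a, w a * q a with hm
  have h2 : 0 ≤ 𝔼 a, w a * (q a - m) ^ 2 := expect_nonneg' fun a =>
    mul_nonneg (hw a) (sq_nonneg _)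
  have h3 : 𝔼 a, w a * (q a - m) ^ 2 = 𝔼 a, w a * q a ^ 2 - m ^ 2 := by
    have : ∀ a, w a * (q a - m) ^ 2 = w a * q a ^ 2 - 2 * m * (w a * q a) + m ^ 2 * w a :=
      fun a => by ring
    simp only [this, expect_add_distrib, expect_sub_distrib, ← mul_expect, h1, ← hm]
    ring
  linarith

lemma sq_expect_kernel_weight_le [Nonempty W] {L : W → W → ℝ} (hL : IsKernel L)
    (q : W → W → ℝ) :
    (𝔼 a, 𝔼 b, L a b * q a b) ^ 2 ≤ 𝔼 a, 𝔼 b, L a b * q a b ^ 2 := by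
  rw [expect_expect_eq_prod (fun a b => L a b * q a b),
    expect_expect_eq_prod (fun a b => L a b * q a b ^ 2)]
  refine sq_expect_weight_le (w := fun p : W × W => L p.1 p.2) (fun p => hL.nonneg _ _) ?_
  rw [← expect_expect_eq_prod]
  exact expect_const_of_kernel hL

/-- The box average of `g` with respect to two kernels. -/
noncomputable def kbox (K : W → W → ℝ) (L : W' → W' → ℝ) (g : W → W' → ℝ) : ℝ :=
  𝔼 a, 𝔼 a', K a a' * 𝔼 b, 𝔼 b', L b b' * ((g a b * g a' b) * (g a b' * g a' b'))

lemma kbox_comm (K : W → W → ℝ) (L : W' → W' → ℝ) (g : W → W' → ℝ) :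
    kbox K L g = kbox L K (fun b a => g a b) := by
  simp only [kbox, mul_expect]
  rw [expect_expect_eq_prod (fun a a' => 𝔼 b, 𝔼 b',
    K a a' * (L b b' * ((g a b * g a' b) * (g a b' * g a' b'))))]
  simp only [expect_expect_eq_prod (fun b b' => K _ _ * (L b b' * _))]
  rw [Finset.expect_comm, expect_expect_eq_prod (fun b b' => 𝔼 a, 𝔼 a',
    L b b' * (K a a' * ((g a b * g a b') * (g a' b * g a' b'))))]
  refine Finset.expect_congr rfl fun p _ => ?_
  rw [expect_expect_eq_prod (fun a a' => L p.1 p.2 * (K a a' *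
    ((g a p.1 * g a p.2) * (g a' p.1 * g a' p.2))))]
  exact Finset.expect_congr rfl fun q _ => by ring

lemma kbox_eq (K : W → W → ℝ) (L : W' → W' → ℝ) (g : W → W' → ℝ) :
    kbox K L g = 𝔼 b, 𝔼 b', L b b' * 𝔼 a, 𝔼 a', K a a' * ((g a b * g a b') * (g a' b * g a' b')) :=
  kbox_comm K L g

lemma abs_mul_le_one {a b : ℝ} (ha : |a| ≤ 1) (hb : |b| ≤ 1) : |a * b| ≤ 1 := by
  rw [abs_mul]
  exact mul_le_one₀ ha (abs_nonneg _) hb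

lemma sq_kbox_le_left [Nonempty W'] {p K : W → W → ℝ} {L : W' → W' → ℝ} {g : W → W' → ℝ}
    (hp : IsKernel p) (hL : IsKernel L) (hg : ∀ a b, |g a b| ≤ 1)
    (hinv : ∀ a a', p a a' ≠ 0 → g a = g a') :
    kbox K L g ^ 2 ≤ kbox (ksq (kcomp p K)) L g := by
  rw [kbox_eq, kbox_eq]
  refine (sq_expect_kernel_weight_le hL _).trans ?_
  refine expect_mono fun b => expect_mono fun b' =>
    mul_le_mul_of_nonneg_left ?_ (hL.nonneg _ _)
  refine sq_expect_kernel_le (A := fun a => g a b * g a b') hp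
    (fun a => abs_mul_le_one (hg _ _) (hg _ _)) ?_
  intro a a' h
  simp only [hinv a a' h]

lemma sq_kbox_le_right [Nonempty W] {p L : W' → W' → ℝ} {K : W → W → ℝ} {g : W → W' → ℝ}
    (hp : IsKernel p) (hK : IsKernel K) (hg : ∀ a b, |g a b| ≤ 1)
    (hinv : ∀ a b b', p b b' ≠ 0 → g a b = g a b') :
    kbox K L g ^ 2 ≤ kbox K (ksq (kcomp p L)) g := by
  rw [kbox_comm, kbox_comm K]
  exact sq_kbox_le_left hp hK (fun a b => hg b a) fun a a' h => funext fun b => hinv b a a' h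

/-- Two applications of the Cauchy–Schwarz inequality bound a trilinear average by a box average. -/
lemma pow_four_trilinear_le [Nonempty W] {K : W → W → ℝ} {L : W' → W' → ℝ}
    {F g H : W → W' → ℝ} (hK : IsKernel K) (hL : IsKernel L) (hF : ∀ a b, |F a b| ≤ 1)
    (hH : ∀ a b, |H a b| ≤ 1)
    (hFK : ∀ a a' b, K a a' ≠ 0 → F a b = F a' b)
    (hHL : ∀ a b b', L b b' ≠ 0 → H a b = H a b') :
    (𝔼 a, 𝔼 b, F a b * g a b * H a b) ^ 4 ≤ kbox (ksq K) (ksq L) g := by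
  -- For fixed `b`, resampling `a` preserves `F`, which removes `F` and doubles `a`. Afterwards, for
  -- fixed `a` and `a'`, resampling `b` removes both copies of `H` in the same way.
  have h1 : (𝔼 a, 𝔼 b, F a b * g a b * H a b) ^ 2 ≤
      𝔼 a, 𝔼 a', ksq K a a' * 𝔼 b, (H a b * H a' b) * (g a b * g a' b) := by
    rw [Finset.expect_comm]
    refine (sq_expect_le _).trans ?_
    have h2 : ∀ b, (𝔼 a, F a b * g a b * H a b) ^ 2 ≤
        𝔼 a, 𝔼 a', ksq K a a' * ((H a b * H a' b) * (g a b * g a' b)) := by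
      intro b
      have := sq_expect_mul_le hK (F := fun a => F a b) (fun a => hF a b)
        (fun a a' h => hFK a a' b h) (fun a => g a b * H a b)
      rw [expect_sq_kernel] at this
      simp only [mul_assoc] at this ⊢
      refine this.trans (le_of_eq ?_)
      exact Finset.expect_congr rfl fun a _ => Finset.expect_congr rfl fun b _ => by ring
    refine (expect_mono h2).trans (le_of_eq ?_)
    rw [Finset.expect_comm]
    refine Finset.expect_congr rfl fun a _ => ?_
    rw [Finset.expect_comm]
    simp only [mul_expect]
  have h3 := pow_le_pow_left₀ (sq_nonneg _) h1 2
  rw [← pow_mul] at h3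
  refine h3.trans ((sq_expect_kernel_weight_le hK.ksq _).trans ?_)
  refine expect_mono fun a => expect_mono fun a' =>
    mul_le_mul_of_nonneg_left ?_ (hK.ksq.nonneg _ _)
  have h4 := sq_expect_mul_le hL (F := fun b => H a b * H a' b)
    (fun b => abs_mul_le_one (hH _ _) (hH _ _))
    (fun b b' h => by simp only [hHL a b b' h, hHL a' b b' h]) (fun b => g a b * g a' b)
  rwa [expect_sq_kernel] at h4

end Kernel

/-! ### Product kernels and link kernels. -/

section Tensor
variable {Ω I α : Type*} [Fintype Ω] [Fintype I] [DecidableEq I]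

lemma expect_pi_prod (f : I → Ω → ℝ) : 𝔼 c : I → Ω, ∏ i, f i (c i) = ∏ i, 𝔼 x, f i x := by
  simp only [Fintype.expect_eq_sum_div_card, Fintype.card_fun, Finset.prod_div_distrib,
    Finset.prod_const, card_univ, Nat.cast_pow]
  rw [Finset.prod_univ_sum, Fintype.piFinset_univ]

/-- The product kernel. -/
def tens (k : Ω → Ω → ℝ) (a b : I → Ω) : ℝ := ∏ i, k (a i) (b i)

lemma IsKernel.tens {k : Ω → Ω → ℝ} (hk : IsKernel k) :
    IsKernel (tens k : (I → Ω) → (I → Ω) → ℝ) where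
  nonneg a b := prod_nonneg fun i _ => hk.nonneg _ _
  row a := by
    simp only [TripleDensity.tens]
    rw [expect_pi_prod (fun i x => k (a i) x)]
    simp [hk.row]
  col b := by
    simp only [TripleDensity.tens]
    rw [expect_pi_prod (fun i x => k x (b i))]
    simp [hk.col]

lemma ksq_tens (k : Ω → Ω → ℝ) : ksq (tens k : (I → Ω) → (I → Ω) → ℝ) = tens (ksq k) := by
  funext a b
  simp only [ksq, tens, ← prod_mul_distrib]
  exact expect_pi_prod (fun i x => k x (a i) * k x (b i))

lemma kcomp_tens (p k : Ω → Ω → ℝ) :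
    kcomp (tens p : (I → Ω) → (I → Ω) → ℝ) (tens k) = tens (kcomp p k) := by
  funext a b
  simp only [kcomp, tens, ← prod_mul_distrib]
  exact expect_pi_prod (fun i x => p (a i) x * k x (b i))

variable [DecidableEq α]

/-- The kernel that resamples a point among those with the same value of `X`. -/
noncomputable def fiberKernel (X : Ω → α) (a b : Ω) : ℝ :=
  if X a = X b then (Fintype.card Ω : ℝ) / #{c | X c = X a} else 0

lemma fiberKernel_pos {X : Ω → α} {a b : Ω} : 0 < fiberKernel X a b ↔ X a = X b := by
  unfold fiberKernel
  split_ifs with h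
  · refine iff_of_true ?_ h
    have h1 : 0 < Fintype.card Ω := Fintype.card_pos_iff.2 ⟨a⟩
    have h2 : 0 < #{c | X c = X a} := card_pos.2 ⟨a, by simp⟩
    positivity
  · simp [h]

lemma fiberKernel_comm (X : Ω → α) (a b : Ω) : fiberKernel X a b = fiberKernel X b a := by
  unfold fiberKernel
  by_cases h : X a = X b
  · simp [h]
  · simp [h, Ne.symm h]

lemma isKernel_fiberKernel (X : Ω → α) : IsKernel (fiberKernel X) := by
  have hrow : ∀ a, 𝔼 b, fiberKernel X a b = 1 := by
    intro a
    have h1 : 0 < Fintype.card Ω := Fintype.card_pos_iff.2 ⟨a⟩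
    have h2 : 0 < #{c | X c = X a} := card_pos.2 ⟨a, by simp⟩
    simp only [fiberKernel, Fintype.expect_eq_sum_div_card]
    rw [← Finset.sum_filter, Finset.sum_const, nsmul_eq_mul]
    have h3 : (univ.filter fun b => X a = X b) = univ.filter fun c => X c = X a := by
      ext; simp [eq_comm]
    rw [h3]
    field_simp
  refine ⟨fun a b => ?_, hrow, fun b => ?_⟩
  · unfold fiberKernel
    split_ifs <;> positivity
  · simp only [fiberKernel_comm X _ b, hrow]

lemma tens_fiberKernel_ne_zero {X : Ω → α} {a b : I → Ω} (h : tens (fiberKernel X) a b ≠ 0) :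
    X ∘ a = X ∘ b := by
  funext i
  by_contra hne
  refine h (prod_eq_zero (mem_univ i) ?_)
  exact if_neg hne

/-- The kernels obtained from the kernel resampling fibers of `X` by repeated squaring,
interlaced with resampling fibers of `Y`. -/
noncomputable def linkKernel (X Y : Ω → α) : ℕ → Ω → Ω → ℝ
  | 0 => ksq (fiberKernel X)
  | j + 1 => ksq (kcomp (fiberKernel Y) (linkKernel X Y j))

lemma isKernel_linkKernel (X Y : Ω → α) : ∀ j, IsKernel (linkKernel X Y j)
  | 0 => (isKernel_fiberKernel X).ksq
  | j + 1 => ((isKernel_fiberKernel Y).kcomp (isKernel_linkKernel X Y j)).ksq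

lemma expect_pos_of_exists {Z : Type*} [Fintype Z] {f : Z → ℝ} (h0 : ∀ z, 0 ≤ f z) (z : Z)
    (hz : 0 < f z) : 0 < 𝔼 z, f z :=
  expect_pos' (fun i _ => h0 i) ⟨z, mem_univ _, hz⟩

lemma ksq_pos {k : Ω → Ω → ℝ} (hk : IsKernel k) {a b : Ω} (c : Ω) (ha : 0 < k c a)
    (hb : 0 < k c b) : 0 < ksq k a b :=
  expect_pos_of_exists (fun c => mul_nonneg (hk.nonneg c a) (hk.nonneg c b)) c (mul_pos ha hb)

lemma kcomp_pos {p k : Ω → Ω → ℝ} (hp : IsKernel p) (hk : IsKernel k) {a b : Ω} (c : Ω)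
    (ha : 0 < p a c) (hb : 0 < k c b) : 0 < kcomp p k a b :=
  expect_pos_of_exists (fun c => mul_nonneg (hp.nonneg a c) (hk.nonneg c b)) c (mul_pos ha hb)

lemma linkKernel_comm (X Y : Ω → α) : ∀ j a b, linkKernel X Y j a b = linkKernel X Y j b a
  | 0, _, _ => Finset.expect_congr rfl fun _ _ => mul_comm _ _
  | _ + 1, _, _ => Finset.expect_congr rfl fun _ _ => mul_comm _ _

lemma linkKernel_self_pos (X Y : Ω → α) (a : Ω) : ∀ j, 0 < linkKernel X Y j a a
  | 0 => ksq_pos (isKernel_fiberKernel X) a (fiberKernel_pos.2 rfl) (fiberKernel_pos.2 rfl)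
  | j + 1 => by
    have := kcomp_pos (isKernel_fiberKernel Y) (isKernel_linkKernel X Y j) (b := a) a
      (fiberKernel_pos.2 rfl) (linkKernel_self_pos X Y a j)
    exact ksq_pos ((isKernel_fiberKernel Y).kcomp (isKernel_linkKernel X Y j)) a this this

/-- A squaring concatenates two walks, with a move inside a fiber of `Y` in between. -/
lemma linkKernel_succ_pos {X Y : Ω → α} {j : ℕ} {a b c c' : Ω} (h1 : 0 < linkKernel X Y j a c)
    (h2 : Y c = Y c') (h3 : 0 < linkKernel X Y j c' b) : 0 < linkKernel X Y (j + 1) a b := by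
  rw [linkKernel_comm] at h1
  refine ksq_pos ((isKernel_fiberKernel Y).kcomp (isKernel_linkKernel X Y j)) c ?_ ?_
  · exact kcomp_pos (isKernel_fiberKernel Y) (isKernel_linkKernel X Y j) c
      (fiberKernel_pos.2 rfl) h1
  · exact kcomp_pos (isKernel_fiberKernel Y) (isKernel_linkKernel X Y j) c'
      (fiberKernel_pos.2 h2) h3

lemma linkKernel_pos_mono {X Y : Ω → α} {i j : ℕ} (hij : i ≤ j) {a b : Ω}
    (h : 0 < linkKernel X Y i a b) : 0 < linkKernel X Y j a b := by
  induction j, hij using Nat.le_induction with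
  | base => exact h
  | succ j _ ih => exact linkKernel_succ_pos ih rfl (linkKernel_self_pos X Y b j)

/-- If any two points can be linked by steps that preserve `X` or `Y`, then the kernels are
eventually positive. -/
lemma exists_linkKernel_pos {X Y : Ω → α}
    (h : ∀ a b, Relation.ReflTransGen (fun a b => X a = X b ∨ Y a = Y b) a b) :
    ∃ j, ∀ a b, 0 < linkKernel X Y j a b := by
  have h1 : ∀ a b, ∃ j, 0 < linkKernel X Y j a b := by
    intro a b
    induction h a b with
    | refl => exact ⟨0, linkKernel_self_pos X Y a 0⟩
    | @tail b c _ hbc ih =>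
      obtain ⟨j, hj⟩ := ih
      rcases hbc with hX | hY
      · refine ⟨j + 1, linkKernel_succ_pos hj rfl (linkKernel_pos_mono (Nat.zero_le j) ?_)⟩
        exact ksq_pos (isKernel_fiberKernel X) b (fiberKernel_pos.2 rfl) (fiberKernel_pos.2 hX)
      · exact ⟨j + 1, linkKernel_succ_pos hj hY (linkKernel_self_pos X Y c j)⟩
  choose j hj using h1
  refine ⟨univ.sup fun p : Ω × Ω => j p.1 p.2, fun a b => linkKernel_pos_mono ?_ (hj a b)⟩
  exact Finset.le_sup (f := fun p : Ω × Ω => j p.1 p.2) (mem_univ (a, b))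

variable {J : Type*} [Fintype J] [DecidableEq J]

/-- A trilinear average is controlled by the box average of its middle function with respect to
link kernels. -/
lemma pow_trilinear_le_kbox_linkKernel [Nonempty Ω] {X Y Z : Ω → α}
    {F G H : (I → α) → (J → α) → ℝ} (hF : ∀ a b, |F a b| ≤ 1) (hG : ∀ a b, |G a b| ≤ 1)
    (hH : ∀ a b, |H a b| ≤ 1) (j j' : ℕ) :
    (𝔼 a : I → Ω, 𝔼 b : J → Ω, F (X ∘ a) (X ∘ b) * G (Y ∘ a) (Y ∘ b) * H (Z ∘ a) (Z ∘ b)) ^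
      (4 * 2 ^ (j + j')) ≤
      kbox (tens (linkKernel X Y j)) (tens (linkKernel Z Y j'))
        (fun (a : I → Ω) (b : J → Ω) => G (Y ∘ a) (Y ∘ b)) := by
  have hstep : ∀ {x y z : ℝ} {m : ℕ}, x ^ (4 * 2 ^ m) ≤ y → y ^ 2 ≤ z →
      x ^ (4 * 2 ^ (m + 1)) ≤ z := by
    intro x y z m h1 h2
    have h3 : (x ^ (4 * 2 ^ m)) ^ 2 ≤ y ^ 2 := by
      refine pow_le_pow_left₀ ?_ h1 2
      refine Even.pow_nonneg ?_ _
      exact Even.mul_right (by decide) _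
    rw [← pow_mul] at h3
    rw [pow_succ, ← mul_assoc]
    exact h3.trans h2
  -- Each increase of `j` or `j'` is one more Cauchy–Schwarz step in the variable `a` or `b`, and
  -- doubles the exponent.
  induction j' with
  | zero =>
    induction j with
    | zero =>
      simp only [linkKernel, ← ksq_tens, add_zero, pow_zero, mul_one]
      refine pow_four_trilinear_le (F := fun a b => F (X ∘ a) (X ∘ b))
        (g := fun a b => G (Y ∘ a) (Y ∘ b)) (H := fun a b => H (Z ∘ a) (Z ∘ b))
        (isKernel_fiberKernel X).tens (isKernel_fiberKernel Z).tens (fun _ _ => hF _ _)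
        (fun _ _ => hH _ _) ?_ ?_
      · intro a a' b h
        simp only [tens_fiberKernel_ne_zero h]
      · intro a b b' h
        simp only [tens_fiberKernel_ne_zero h]
    | succ j ih =>
      rw [add_right_comm]
      refine hstep ih ?_
      have := sq_kbox_le_left (p := tens (fiberKernel Y)) (K := tens (linkKernel X Y j))
        (L := tens (linkKernel Z Y 0)) (g := fun (a : I → Ω) (b : J → Ω) => G (Y ∘ a) (Y ∘ b))
        (isKernel_fiberKernel Y).tens (isKernel_linkKernel Z Y 0).tens (fun _ _ => hG _ _)
        (fun a a' h => by simp only [tens_fiberKernel_ne_zero h])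
      rwa [kcomp_tens, ksq_tens] at this
  | succ j' ih =>
    rw [← add_assoc]
    refine hstep ih ?_
    have := sq_kbox_le_right (p := tens (fiberKernel Y)) (L := tens (linkKernel Z Y j'))
      (K := tens (linkKernel X Y j)) (g := fun (a : I → Ω) (b : J → Ω) => G (Y ∘ a) (Y ∘ b))
      (isKernel_fiberKernel Y).tens (isKernel_linkKernel X Y j).tens (fun _ _ => hG _ _)
      (fun a b b' h => by simp only [tens_fiberKernel_ne_zero h])
    rwa [kcomp_tens, ksq_tens] at this

end Tensor

/-! ### The uniform box average and its Cauchy–Schwarz inequality. -/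

section UniformBox
variable {U V : Type*} [Fintype U] [Fintype V]

/-- The box average of a function of two variables with respect to the uniform measures. -/
noncomputable def ubox (g : U → V → ℝ) : ℝ := 𝔼 u, 𝔼 u', (𝔼 v, g u v * g u' v) ^ 2

lemma expect_mul_expect_eq_prod (f : U → ℝ) (g : V → ℝ) :
    (𝔼 u, f u) * 𝔼 v, g v = 𝔼 p : U × V, f p.1 * g p.2 := by
  rw [← expect_expect_eq_prod (fun u v => f u * g v), expect_mul]
  simp only [mul_expect]

lemma expect_sq_inner (g h : U → V → ℝ) :
    𝔼 u, 𝔼 u', (𝔼 v, g u v * h u' v) ^ 2 =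
      𝔼 v, 𝔼 v', (𝔼 u, g u v * g u v') * 𝔼 u', h u' v * h u' v' := by
  rw [expect_expect_eq_prod (fun u u' => (𝔼 v, g u v * h u' v) ^ 2),
    expect_expect_eq_prod (fun v v' => (𝔼 u, g u v * g u v') * 𝔼 u', h u' v * h u' v')]
  simp only [sq, expect_mul_expect_eq_prod]
  rw [Finset.expect_comm]
  exact Finset.expect_congr rfl fun p _ => Finset.expect_congr rfl fun q _ => by ring

/-- The left side is the inner product of the Gram kernels of `g` and `h`, whose squared norms are
the two box averages. -/
lemma expect_sq_inner_le (g h : U → V → ℝ) :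
    𝔼 u, 𝔼 u', (𝔼 v, g u v * h u' v) ^ 2 ≤ (ubox g + ubox h) / 2 := by
  have hg : ubox g = 𝔼 v, 𝔼 v', (𝔼 u, g u v * g u v') ^ 2 := by
    rw [ubox, expect_sq_inner]
    simp only [sq]
  have hh : ubox h = 𝔼 v, 𝔼 v', (𝔼 u, h u v * h u v') ^ 2 := by
    rw [ubox, expect_sq_inner]
    simp only [sq]
  rw [expect_sq_inner, hg, hh, ← expect_add_distrib, expect_div]
  refine expect_mono fun v => ?_
  rw [← expect_add_distrib, expect_div]
  refine expect_mono fun v' => ?_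
  nlinarith [sq_nonneg ((𝔼 u, g u v * g u v') - 𝔼 u, h u v * h u v')]

/-- The Gowers–Cauchy–Schwarz inequality for the box norm in its additive form. -/
lemma expect_box_le (g₁ g₂ g₃ g₄ : U → V → ℝ) :
    𝔼 u, 𝔼 u', 𝔼 v, 𝔼 v', (g₁ u v * g₂ u' v) * (g₃ u v' * g₄ u' v') ≤
      (ubox g₁ + ubox g₂ + ubox g₃ + ubox g₄) / 4 := by
  have h1 := expect_sq_inner_le g₁ g₂
  have h2 := expect_sq_inner_le g₃ g₄
  have h3 : 𝔼 u, 𝔼 u', 𝔼 v, 𝔼 v', (g₁ u v * g₂ u' v) * (g₃ u v' * g₄ u' v') ≤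
      ((𝔼 u, 𝔼 u', (𝔼 v, g₁ u v * g₂ u' v) ^ 2) +
        𝔼 u, 𝔼 u', (𝔼 v, g₃ u v * g₄ u' v) ^ 2) / 2 := by
    rw [← expect_add_distrib, expect_div]
    refine expect_mono fun u => ?_
    rw [← expect_add_distrib, expect_div]
    refine expect_mono fun u' => ?_
    simp only [← mul_expect, ← expect_mul]
    nlinarith [sq_nonneg ((𝔼 v, g₁ u v * g₂ u' v) - 𝔼 v, g₃ u v * g₄ u' v)]
  linarith

lemma abs_ubox_le_one {g : U → V → ℝ} (hg : ∀ u v, |g u v| ≤ 1) : |ubox g| ≤ 1 := by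
  refine abs_expect_le_of_le zero_le_one fun u => abs_expect_le_of_le zero_le_one fun u' => ?_
  rw [abs_pow]
  refine pow_le_one₀ (abs_nonneg _) (abs_expect_le_of_le zero_le_one fun v => ?_)
  exact abs_mul_le_one (hg _ _) (hg _ _)

end UniformBox

/-! ### Mixtures with a uniform part. -/

section Mixture
variable {I X Y : Type*} [Fintype I] [DecidableEq I] [Fintype X] [DecidableEq X] [Fintype Y]
  [DecidableEq Y]

/-- The weights of a mixture of a weight on `X` and `β` times the image of the counting measure
on `Y`. -/
def mixWeight (w : X → ℝ) (d : Y → X) (β : ℝ) : X ⊕ Y → ℝ :=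
  Sum.elim (fun x => w x - if x ∈ univ.image d then β else 0) fun _ => β

/-- The point whose components on the coordinates in `Y` are resampled by `y`. -/
def mixPoint (d : Y → X) (ξ : I → X ⊕ Y) (y : I → Y) : I → X :=
  fun i => Sum.elim id (fun _ => d (y i)) (ξ i)

lemma mixWeight_nonneg {w : X → ℝ} {d : Y → X} {β : ℝ} (hβ : 0 ≤ β) (hw : ∀ x, β ≤ w x)
    (e : X ⊕ Y) : 0 ≤ mixWeight w d β e := by
  rcases e with x | y
  · simp only [mixWeight, Sum.elim_inl]
    split_ifs <;> linarith [hw x]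
  · exact hβ

lemma sum_fiber_mixWeight (w : X → ℝ) {d : Y → X} (hd : Injective d) (β : ℝ) (x : X) :
    ∑ e ∈ univ.filter (fun e : X ⊕ Y => Sum.elim id d e = x), mixWeight w d β e = w x := by
  rw [Finset.sum_filter, Fintype.sum_sum_type]
  simp only [Sum.elim_inl, Sum.elim_inr, id, mixWeight]
  by_cases hx : ∃ y, d y = x
  · obtain ⟨y, rfl⟩ := hx
    simp [hd.eq_iff]
  · have h1 : ∀ y, d y ≠ x := fun y h => hx ⟨y, h⟩
    simp [h1]

lemma sum_mixWeight (w : X → ℝ) {d : Y → X} (hd : Injective d) (β : ℝ) :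
    ∑ e, mixWeight w d β e = ∑ x, w x := by
  rw [← Finset.sum_fiberwise univ (Sum.elim id d : X ⊕ Y → X)]
  exact Finset.sum_congr rfl fun x _ => sum_fiber_mixWeight w hd β x

lemma sum_prod_mixWeight (w : X → ℝ) {d : Y → X} (hd : Injective d) (β : ℝ)
    (Φ : (I → X) → ℝ) : ∑ U : I → X, (∏ i, w (U i)) * Φ U =
      ∑ ξ : I → X ⊕ Y, (∏ i, mixWeight w d β (ξ i)) * Φ fun i => Sum.elim id d (ξ i) := by
  rw [← Finset.sum_fiberwise univ (fun (ξ : I → X ⊕ Y) i => Sum.elim id d (ξ i))]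
  refine Finset.sum_congr rfl fun U _ => ?_
  have h1 : ∏ i, w (U i) = ∑ ξ ∈ univ.filter
      (fun ξ : I → X ⊕ Y => (fun i => Sum.elim id d (ξ i)) = U), ∏ i, mixWeight w d β (ξ i) := by
    simp only [← sum_fiber_mixWeight w hd β]
    rw [Finset.prod_univ_sum]
    refine Finset.sum_congr ?_ fun _ _ => rfl
    ext ξ
    simp [Fintype.mem_piFinset, funext_iff]
  rw [h1, Finset.sum_mul]
  refine Finset.sum_congr rfl fun ξ hξ => ?_
  rw [← (mem_filter.1 hξ).2]

/-- The weight does not see which element of `Y` occurs, so those that occur may be exchanged with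
independent uniform ones; the exchange is an involution. -/
lemma sum_resample [Nonempty Y] (v : X ⊕ Y → ℝ) (hv : ∀ y y', v (Sum.inr y) = v (Sum.inr y'))
    (Ψ : (I → X ⊕ Y) → ℝ) : ∑ ξ : I → X ⊕ Y, (∏ i, v (ξ i)) * Ψ ξ =
      ∑ ξ : I → X ⊕ Y, (∏ i, v (ξ i)) *
        𝔼 y : I → Y, Ψ fun i => Sum.elim Sum.inl (fun _ => Sum.inr (y i)) (ξ i) := by
  let t : ((I → X ⊕ Y) × (I → Y)) → ((I → X ⊕ Y) × (I → Y)) := fun p =>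
    (fun i => Sum.elim Sum.inl (fun _ => Sum.inr (p.2 i)) (p.1 i),
      fun i => Sum.elim (fun _ => p.2 i) id (p.1 i))
  have ht : Involutive t := by
    rintro ⟨ξ, y⟩
    refine Prod.ext (funext fun i => ?_) (funext fun i => ?_) <;>
    · simp only [t]
      rcases ξ i with x | z <;> simp
  have h1 : ∀ ξ : I → X ⊕ Y, (∏ i, v (ξ i)) * Ψ ξ = 𝔼 _y : I → Y, (∏ i, v (ξ i)) * Ψ ξ :=
    fun ξ => by rw [Fintype.expect_const]
  rw [Finset.sum_congr rfl fun ξ _ => h1 ξ]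
  simp only [mul_expect]
  simp only [Fintype.expect_eq_sum_div_card, ← Finset.sum_div]
  congr 1
  rw [← Fintype.sum_prod_type' (fun (ξ : I → X ⊕ Y) (_ : I → Y) => (∏ i, v (ξ i)) * Ψ ξ),
    ← Fintype.sum_prod_type' (fun (ξ : I → X ⊕ Y) (y : I → Y) => (∏ i, v (ξ i)) *
      Ψ fun i => Sum.elim Sum.inl (fun _ => Sum.inr (y i)) (ξ i))]
  rw [← Equiv.sum_comp ht.toPerm]
  refine Finset.sum_congr rfl fun p _ => ?_
  have h2 : ∀ i, v ((t p).1 i) = v (p.1 i) := by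
    intro i
    simp only [t]
    rcases p.1 i with x | z
    · rfl
    · exact hv _ _
  change (∏ i, v ((t p).1 i)) * Ψ (t p).1 = _
  rw [Finset.prod_congr rfl fun i _ => h2 i]

lemma sum_prod_eq_sum_mixPoint [Nonempty Y] (w : X → ℝ) {d : Y → X} (hd : Injective d) (β : ℝ)
    (Φ : (I → X) → ℝ) : ∑ U : I → X, (∏ i, w (U i)) * Φ U =
      ∑ ξ : I → X ⊕ Y, (∏ i, mixWeight w d β (ξ i)) * 𝔼 y : I → Y, Φ (mixPoint d ξ y) := by
  rw [sum_prod_mixWeight w hd β, sum_resample _ (fun _ _ => rfl)]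
  refine Finset.sum_congr rfl fun ξ _ => ?_
  congr 1
  refine Finset.expect_congr rfl fun y _ => ?_
  congr 1
  funext i
  simp only [mixPoint]
  rcases ξ i with x | z <;> rfl

lemma sum_prod_weight (v : X → ℝ) : ∑ ξ : I → X, ∏ i, v (ξ i) = (∑ x, v x) ^ Fintype.card I := by
  have := Finset.prod_univ_sum (fun _ : I => (univ : Finset X)) fun _ x => v x
  rw [Fintype.piFinset_univ] at this
  rw [← this, Finset.prod_const, card_univ]

/-- It is unlikely that few components come from the second part of the mixture. -/
lemma sum_prod_few_le {w : X → ℝ} {d : Y → X} (hd : Injective d) {β : ℝ} (hβ : 0 ≤ β)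
    (hw : ∀ x, β ≤ w x) (hw1 : ∑ x, w x = 1) (N : ℕ) :
    ∑ ξ : I → X ⊕ Y, (∏ i, mixWeight w d β (ξ i)) *
      (if #{i | (ξ i).isRight} < N then 1 else 0) ≤
      2 ^ N * (1 - β * Fintype.card Y / 2) ^ Fintype.card I := by
  -- An exponential moment bound: each component from the second part is discounted by 1 / 2.
  let v : X ⊕ Y → ℝ := fun e => mixWeight w d β e * if e.isRight then 1 / 2 else 1
  have hv : ∑ e, v e = 1 - β * Fintype.card Y / 2 := by
    have h1 := sum_mixWeight w hd β
    rw [Fintype.sum_sum_type, hw1] at h1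
    simp only [mixWeight, Sum.elim_inr, Finset.sum_const, card_univ, nsmul_eq_mul] at h1
    rw [Fintype.sum_sum_type]
    simp only [v, mixWeight, Sum.elim_inr, Sum.isRight_inr, Sum.isRight_inl, if_true,
      Finset.sum_const, card_univ, nsmul_eq_mul, Bool.false_eq_true, if_false, mul_one]
    linarith
  rw [← hv, ← sum_prod_weight, Finset.mul_sum]
  refine Finset.sum_le_sum fun ξ _ => ?_
  have h2 : ∏ i, v (ξ i) = (∏ i, mixWeight w d β (ξ i)) * (1 / 2) ^ #{i | (ξ i).isRight} := by
    simp only [v, Finset.prod_mul_distrib]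
    rw [Finset.prod_ite]
    simp
  have h0 : 0 ≤ ∏ i, mixWeight w d β (ξ i) := prod_nonneg fun i _ => mixWeight_nonneg hβ hw _
  rw [h2, mul_left_comm]
  refine mul_le_mul_of_nonneg_left ?_ h0
  split_ifs with h
  · have h3 : (1 / 2 : ℝ) ^ N ≤ (1 / 2) ^ #{i | (ξ i).isRight} :=
      pow_le_pow_of_le_one (by norm_num) (by norm_num) h.le
    have h4 : (2 : ℝ) ^ N * (1 / 2) ^ N = 1 := by rw [← mul_pow]; norm_num
    calc (1 : ℝ) = 2 ^ N * (1 / 2) ^ N := h4.symm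
      _ ≤ _ := mul_le_mul_of_nonneg_left h3 (by positivity)
  · positivity

lemma one_sub_mixWeight_nonneg {w : X → ℝ} {d : Y → X} (hd : Injective d) {β : ℝ} (hβ : 0 ≤ β)
    (hw : ∀ x, β ≤ w x) (hw1 : ∑ x, w x = 1) : 0 ≤ 1 - β * Fintype.card Y / 2 := by
  have h1 := sum_mixWeight w hd β
  rw [Fintype.sum_sum_type, hw1] at h1
  have h2 : 0 ≤ ∑ x : X, mixWeight w d β (Sum.inl x : X ⊕ Y) :=
    sum_nonneg fun x _ => mixWeight_nonneg hβ hw _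
  have h3 : ∑ y : Y, mixWeight w d β (Sum.inr y : X ⊕ Y) = β * Fintype.card Y := by
    simp [mixWeight, mul_comm]
  have h4 : 0 ≤ β * Fintype.card Y := by positivity
  linarith

end Mixture

/-! ### From trilinear averages to box norms of random restrictions. -/

section Patterns
variable {I J Ω α : Type*} [Fintype I] [DecidableEq I] [Fintype J] [DecidableEq J] [Fintype Ω]
  [DecidableEq Ω] [Fintype α] [DecidableEq α]

lemma expect_pow_two_pow_le {X : Type*} [Fintype X] (k : ℕ) (f : X → ℝ) :
    (𝔼 x, f x) ^ 2 ^ (k + 1) ≤ 𝔼 x, f x ^ 2 ^ (k + 1) := by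
  induction k generalizing f with
  | zero => simpa using sq_expect_le f
  | succ k ih =>
    have h1 := pow_le_pow_left₀ (sq_nonneg _) (sq_expect_le f) (2 ^ (k + 1))
    have h2 := h1.trans (ih fun x => f x ^ 2)
    simp only [← pow_mul, ← pow_succ'] at h2
    exact h2

/-- The assignment that follows the pattern `p` and is equal to `u` where the pattern is blank. -/
def fill (p : I → Option α) (u : I → α) : I → α := fun i => (p i).getD (u i)

lemma expect_pair_eq (h : (I → Ω) → (I → Ω) → ℝ) :
    𝔼 a, 𝔼 a', h a a' = 𝔼 U : I → Ω × Ω, h (fun i => (U i).1) fun i => (U i).2 := by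
  rw [expect_expect_eq_prod]
  exact (Fintype.expect_equiv (Equiv.arrowProdEquivProdArrow I (fun _ => Ω) fun _ => Ω) _ _
    fun U => rfl).symm

lemma expect_tens_mul_eq (k : Ω → Ω → ℝ) (h : (I → Ω) → (I → Ω) → ℝ) :
    𝔼 a, 𝔼 a', tens k a a' * h a a' = ∑ U : I → Ω × Ω,
      (∏ i, k (U i).1 (U i).2 / Fintype.card (Ω × Ω)) *
        h (fun i => (U i).1) fun i => (U i).2 := by
  rw [expect_pair_eq (fun a a' => tens k a a' * h a a'), Fintype.expect_eq_sum_div_card,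
    Finset.sum_div]
  refine Finset.sum_congr rfl fun U _ => ?_
  rw [Finset.prod_div_distrib, Finset.prod_const, card_univ, Fintype.card_fun, Nat.cast_pow, tens]
  ring

/-- The pattern that records the value of `Y` at one of the two endpoints. -/
def pairPattern {A : Type*} (Y : Ω → α) (e : Ω × Ω → Ω) (ξ : I → Ω × Ω ⊕ A) : I → Option α :=
  fun i => Sum.elim (fun x => some (Y (e x))) (fun _ => none) (ξ i)

omit [Fintype Ω] [DecidableEq Ω] [DecidableEq I] [Fintype α] [DecidableEq α] in
lemma card_pairPattern {A : Type*} (Y : Ω → α) (e : Ω × Ω → Ω) (ξ : I → Ω × Ω ⊕ A) :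
    #{i | pairPattern Y e ξ i = none} = #{i | (ξ i).isRight} := by
  refine congrArg card (filter_congr fun i _ => ?_)
  rcases h : ξ i with x | y <;> simp [pairPattern, h]

omit [Fintype Ω] [DecidableEq Ω] [DecidableEq I] [Fintype I] [Fintype α] [DecidableEq α] in
lemma comp_mixPoint {Y : Ω → α} {δ : α → Ω} (hδ : ∀ a, Y (δ a) = a) (ξ : I → Ω × Ω ⊕ α × α)
    (y : I → α × α) :
    (Y ∘ fun i => (mixPoint (Prod.map δ δ) ξ y i).1) =
        fill (pairPattern Y Prod.fst ξ) (fun i => (y i).1) ∧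
      (Y ∘ fun i => (mixPoint (Prod.map δ δ) ξ y i).2) =
        fill (pairPattern Y Prod.snd ξ) fun i => (y i).2 := by
  constructor <;>
  · funext i
    simp only [mixPoint, fill, pairPattern, comp_apply]
    rcases ξ i with x | x <;> simp [hδ]

/-- The box average for product kernels is a mixture of averages over partly filled patterns. -/
lemma kbox_tens_eq [Nonempty α] {k l : Ω → Ω → ℝ} {d : α × α → Ω × Ω} (hd : Injective d)
    (β β' : ℝ) (g : (I → Ω) → (J → Ω) → ℝ) :
    kbox (tens k) (tens l) g = ∑ ξ : I → Ω × Ω ⊕ α × α, ∑ ζ : J → Ω × Ω ⊕ α × α,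
      (∏ i, mixWeight (fun x : Ω × Ω => k x.1 x.2 / Fintype.card (Ω × Ω)) d β (ξ i)) *
      (∏ j, mixWeight (fun x : Ω × Ω => l x.1 x.2 / Fintype.card (Ω × Ω)) d β' (ζ j)) *
      𝔼 y : I → α × α, 𝔼 z : J → α × α,
        (g (fun i => (mixPoint d ξ y i).1) (fun j => (mixPoint d ζ z j).1) *
          g (fun i => (mixPoint d ξ y i).2) (fun j => (mixPoint d ζ z j).1)) *
        (g (fun i => (mixPoint d ξ y i).1) (fun j => (mixPoint d ζ z j).2) *
          g (fun i => (mixPoint d ξ y i).2) (fun j => (mixPoint d ζ z j).2)) := by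
  rw [kbox]
  simp only [expect_tens_mul_eq]
  have h1 : ∀ a a' : I → Ω, ∑ V : J → Ω × Ω, (∏ j, l (V j).1 (V j).2 / Fintype.card (Ω × Ω)) *
      (g a (fun j => (V j).1) * g a' (fun j => (V j).1) *
        (g a (fun j => (V j).2) * g a' (fun j => (V j).2))) = _ := fun a a' =>
    sum_prod_eq_sum_mixPoint (fun x : Ω × Ω => l x.1 x.2 / Fintype.card (Ω × Ω)) hd β'
      (fun V => (g a (fun j => (V j).1) * g a' (fun j => (V j).1) *
        (g a (fun j => (V j).2) * g a' (fun j => (V j).2))))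
  simp only [h1]
  rw [sum_prod_eq_sum_mixPoint (fun x : Ω × Ω => k x.1 x.2 / Fintype.card (Ω × Ω)) hd β
    (fun U => ∑ ζ : J → Ω × Ω ⊕ α × α,
      (∏ j, mixWeight (fun x : Ω × Ω => l x.1 x.2 / Fintype.card (Ω × Ω)) d β' (ζ j)) *
      𝔼 z : J → α × α,
        (g (fun i => (U i).1) (fun j => (mixPoint d ζ z j).1) *
          g (fun i => (U i).2) (fun j => (mixPoint d ζ z j).1)) *
        (g (fun i => (U i).1) (fun j => (mixPoint d ζ z j).2) *
          g (fun i => (U i).2) (fun j => (mixPoint d ζ z j).2)))]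
  refine Finset.sum_congr rfl fun ξ _ => ?_
  rw [expect_sum_comm, Finset.mul_sum]
  refine Finset.sum_congr rfl fun ζ _ => ?_
  rw [← mul_expect, mul_assoc]

/-- The average over the blanks of two pairs of patterns is at most the average of the four
box averages. -/
lemma expect_mixPoint_le {Y : Ω → α} {δ : α → Ω} (hδ : ∀ a, Y (δ a) = a)
    (G : (I → α) → (J → α) → ℝ) (ξ : I → Ω × Ω ⊕ α × α) (ζ : J → Ω × Ω ⊕ α × α) :
    𝔼 y : I → α × α, 𝔼 z : J → α × α,
        (G (Y ∘ fun i => (mixPoint (Prod.map δ δ) ξ y i).1)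
            (Y ∘ fun j => (mixPoint (Prod.map δ δ) ζ z j).1) *
          G (Y ∘ fun i => (mixPoint (Prod.map δ δ) ξ y i).2)
            (Y ∘ fun j => (mixPoint (Prod.map δ δ) ζ z j).1)) *
        (G (Y ∘ fun i => (mixPoint (Prod.map δ δ) ξ y i).1)
            (Y ∘ fun j => (mixPoint (Prod.map δ δ) ζ z j).2) *
          G (Y ∘ fun i => (mixPoint (Prod.map δ δ) ξ y i).2)
            (Y ∘ fun j => (mixPoint (Prod.map δ δ) ζ z j).2)) ≤
      (ubox (fun u v => G (fill (pairPattern Y Prod.fst ξ) u) (fill (pairPattern Y Prod.fst ζ) v)) +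
       ubox (fun u v => G (fill (pairPattern Y Prod.snd ξ) u) (fill (pairPattern Y Prod.fst ζ) v)) +
       ubox (fun u v => G (fill (pairPattern Y Prod.fst ξ) u) (fill (pairPattern Y Prod.snd ζ) v)) +
       ubox (fun u v => G (fill (pairPattern Y Prod.snd ξ) u) (fill (pairPattern Y Prod.snd ζ) v)))
        / 4 := by
  simp only [(comp_mixPoint hδ _ _).1, (comp_mixPoint hδ _ _).2]
  refine le_trans (le_of_eq ?_) (expect_box_le _ _ _ _)
  rw [expect_pair_eq]
  refine Finset.expect_congr rfl fun y _ => ?_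
  rw [expect_pair_eq]

/-- If a trilinear average is large for a family of functions, then the middle functions have
a large average box norm on some pattern. -/
theorem pow_le_of_ubox_le [Nonempty α] {X Y Z : Ω → α} {δ : α → Ω} (hδ : ∀ a, Y (δ a) = a)
    (hXY : ∀ a b, Relation.ReflTransGen (fun a b => X a = X b ∨ Y a = Y b) a b)
    (hZY : ∀ a b, Relation.ReflTransGen (fun a b => Z a = Z b ∨ Y a = Y b) a b) :
    ∃ (m : ℕ) (ρ : ℝ), 0 ≤ ρ ∧ ρ < 1 ∧
      ∀ (I J : Type) [Fintype I] [DecidableEq I] [Fintype J] [DecidableEq J] (Θ : Type _)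
        [Fintype Θ] (F G H : Θ → (I → α) → (J → α) → ℝ), (∀ θ a b, |F θ a b| ≤ 1) →
        (∀ θ a b, |G θ a b| ≤ 1) → (∀ θ a b, |H θ a b| ≤ 1) →
        ∀ η ε : ℝ, 0 ≤ η → 0 ≤ ε →
        η ≤ |𝔼 θ, 𝔼 a : I → Ω, 𝔼 b : J → Ω,
          F θ (X ∘ a) (X ∘ b) * G θ (Y ∘ a) (Y ∘ b) * H θ (Z ∘ a) (Z ∘ b)| →
        ∀ N : ℕ, (∀ (p : I → Option α) (r : J → Option α), N ≤ #{i | p i = none} →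
          N ≤ #{j | r j = none} → 𝔼 θ, ubox (fun u v => G θ (fill p u) (fill r v)) ≤ ε) →
        η ^ m ≤ ε + 2 ^ N * ρ ^ Fintype.card I + 2 ^ N * ρ ^ Fintype.card J := by
  have hΩ : Nonempty Ω := ⟨δ (Classical.arbitrary α)⟩
  obtain ⟨j, hj⟩ := exists_linkKernel_pos hXY
  obtain ⟨j', hj'⟩ := exists_linkKernel_pos hZY
  set k := linkKernel X Y j with hk
  set l := linkKernel Z Y j' with hl
  have hkk : IsKernel k := isKernel_linkKernel X Y j
  have hlk : IsKernel l := isKernel_linkKernel Z Y j'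
  set wk : Ω × Ω → ℝ := fun x => k x.1 x.2 / Fintype.card (Ω × Ω) with hwk
  set wl : Ω × Ω → ℝ := fun x => l x.1 x.2 / Fintype.card (Ω × Ω) with hwl
  have hc : (0 : ℝ) < Fintype.card (Ω × Ω) := by exact_mod_cast Fintype.card_pos
  -- β is the least normalized weight of the two kernels on a single coordinate. It does not depend
  -- on `I`, `J` or the functions, so neither does ρ.
  obtain ⟨x₀, -, hx₀⟩ := exists_min_image univ (fun x => min (wk x) (wl x)) univ_nonempty
  set β := min (wk x₀) (wl x₀) with hβ
  have hβ0 : 0 < β := lt_min (div_pos (hj _ _) hc) (div_pos (hj' _ _) hc)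
  have hβk : ∀ x, β ≤ wk x := fun x => (hx₀ x (mem_univ _)).trans (min_le_left _ _)
  have hβl : ∀ x, β ≤ wl x := fun x => (hx₀ x (mem_univ _)).trans (min_le_right _ _)
  have hsum : ∀ {k : Ω → Ω → ℝ}, IsKernel k →
      ∑ x : Ω × Ω, k x.1 x.2 / Fintype.card (Ω × Ω) = 1 := by
    intro k hk
    rw [← Finset.sum_div, ← Fintype.expect_eq_sum_div_card,
      ← expect_expect_eq_prod (fun a b => k a b)]
    exact expect_const_of_kernel hk
  have hδi : Injective δ := fun a b h => by rw [← hδ a, h, hδ]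
  have hd : Injective (Prod.map δ δ) := hδi.prodMap hδi
  set ρ : ℝ := 1 - β * Fintype.card (α × α) / 2 with hρ
  refine ⟨4 * 2 ^ (j + j'), ρ, one_sub_mixWeight_nonneg hd hβ0.le hβk (hsum hkk), ?_, ?_⟩
  · have : (0 : ℝ) < Fintype.card (α × α) := by exact_mod_cast Fintype.card_pos
    have := mul_pos hβ0 this
    rw [hρ]
    linarith
  intro I J _ _ _ _ Θ _ F G H hF hG hH η ε hη hε hT N hbox
  -- The exponent is a power of two, so Jensen's inequality moves it inside the average over θ.
  have h1 : η ^ (4 * 2 ^ (j + j')) ≤ 𝔼 θ, kbox (tens k) (tens l)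
      (fun (a : I → Ω) (b : J → Ω) => G θ (Y ∘ a) (Y ∘ b)) := by
    refine (pow_le_pow_left₀ hη hT _).trans ?_
    rw [Even.pow_abs (Even.mul_right (by decide) _)]
    have h4 : 4 * 2 ^ (j + j') = 2 ^ ((j + j' + 1) + 1) := by ring
    rw [h4]
    refine (expect_pow_two_pow_le _ _).trans (expect_mono fun θ => ?_)
    rw [← h4]
    exact pow_trilinear_le_kbox_linkKernel (hF θ) (hG θ) (hH θ) j j'
  refine h1.trans ?_
  have h2 : ∀ θ, kbox (tens k) (tens l) (fun (a : I → Ω) (b : J → Ω) => G θ (Y ∘ a) (Y ∘ b)) ≤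
      ∑ ξ : I → Ω × Ω ⊕ α × α, ∑ ζ : J → Ω × Ω ⊕ α × α,
      (∏ i, mixWeight wk (Prod.map δ δ) β (ξ i)) * (∏ j, mixWeight wl (Prod.map δ δ) β (ζ j)) *
      ((ubox (fun u v => G θ (fill (pairPattern Y Prod.fst ξ) u)
          (fill (pairPattern Y Prod.fst ζ) v)) +
        ubox (fun u v => G θ (fill (pairPattern Y Prod.snd ξ) u)
          (fill (pairPattern Y Prod.fst ζ) v)) +
        ubox (fun u v => G θ (fill (pairPattern Y Prod.fst ξ) u)
          (fill (pairPattern Y Prod.snd ζ) v)) +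
        ubox (fun u v => G θ (fill (pairPattern Y Prod.snd ξ) u)
          (fill (pairPattern Y Prod.snd ζ) v))) / 4) := by
    intro θ
    rw [kbox_tens_eq hd β β]
    refine Finset.sum_le_sum fun ξ _ => Finset.sum_le_sum fun ζ _ => ?_
    refine mul_le_mul_of_nonneg_left (expect_mixPoint_le hδ (G θ) ξ ζ) ?_
    exact mul_nonneg (prod_nonneg fun i _ => mixWeight_nonneg hβ0.le hβk _)
      (prod_nonneg fun i _ => mixWeight_nonneg hβ0.le hβl _)
  refine (expect_mono h2).trans ?_
  simp only [expect_sum_comm, ← mul_expect, ← expect_div, expect_add_distrib]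
  have hub : ∀ (p : I → Option α) (r : J → Option α),
      𝔼 θ, ubox (fun u v => G θ (fill p u) (fill r v)) ≤ 1 := fun p r =>
    expect_le_of_le zero_le_one fun θ => (abs_le.1 (abs_ubox_le_one fun _ _ => hG _ _ _)).2
  -- A pattern with fewer than `N` blanks is charged with the trivial bound 1.
  have h3 : ∀ (ξ : I → Ω × Ω ⊕ α × α) (ζ : J → Ω × Ω ⊕ α × α) (e e' : Ω × Ω → Ω),
      𝔼 θ, ubox (fun u v => G θ (fill (pairPattern Y e ξ) u) (fill (pairPattern Y e' ζ) v)) ≤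
        ε + (if #{i | (ξ i).isRight} < N then 1 else 0) +
          (if #{j | (ζ j).isRight} < N then 1 else 0) := by
    intro ξ ζ e e'
    by_cases hξ : #{i | (ξ i).isRight} < N
    · rw [if_pos hξ]
      have := hub (pairPattern Y e ξ) (pairPattern Y e' ζ)
      split_ifs <;> linarith
    · by_cases hζ : #{j | (ζ j).isRight} < N
      · rw [if_pos hζ, if_neg hξ]
        have := hub (pairPattern Y e ξ) (pairPattern Y e' ζ)
        linarith
      · rw [if_neg hξ, if_neg hζ]
        have := hbox (pairPattern Y e ξ) (pairPattern Y e' ζ)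
          (by rw [card_pairPattern]; omega) (by rw [card_pairPattern]; omega)
        linarith
  have hP : ∀ (K : Type) [Fintype K] [DecidableEq K] {w : Ω × Ω → ℝ}, (∀ x, β ≤ w x) →
      ∑ x, w x = 1 →
      ∑ ξ : K → Ω × Ω ⊕ α × α, ∏ i, mixWeight w (Prod.map δ δ) β (ξ i) = 1 := by
    intro K _ _ w hw hw1
    rw [sum_prod_weight, sum_mixWeight w hd, hw1, one_pow]
  have h4 : ∀ (ξ : I → Ω × Ω ⊕ α × α) (ζ : J → Ω × Ω ⊕ α × α) (t : ℝ),
      t ≤ ε + (if #{i | (ξ i).isRight} < N then 1 else 0) +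
          (if #{j | (ζ j).isRight} < N then 1 else 0) →
      (∏ i, mixWeight wk (Prod.map δ δ) β (ξ i)) * (∏ j, mixWeight wl (Prod.map δ δ) β (ζ j)) * t ≤
      (∏ i, mixWeight wk (Prod.map δ δ) β (ξ i)) * (∏ j, mixWeight wl (Prod.map δ δ) β (ζ j)) *
        (ε + (if #{i | (ξ i).isRight} < N then 1 else 0) +
          (if #{j | (ζ j).isRight} < N then 1 else 0)) := by
    intro ξ ζ t ht
    refine mul_le_mul_of_nonneg_left ht ?_
    exact mul_nonneg (prod_nonneg fun i _ => mixWeight_nonneg hβ0.le hβk _)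
      (prod_nonneg fun i _ => mixWeight_nonneg hβ0.le hβl _)
  refine (Finset.sum_le_sum fun ξ _ => Finset.sum_le_sum fun ζ _ => h4 ξ ζ _ ?_).trans ?_
  · have e1 := h3 ξ ζ Prod.fst Prod.fst
    have e2 := h3 ξ ζ Prod.snd Prod.fst
    have e3 := h3 ξ ζ Prod.fst Prod.snd
    have e4 := h3 ξ ζ Prod.snd Prod.snd
    linarith
  have h5 := sum_prod_few_le (I := I) hd hβ0.le hβk (hsum hkk) N
  have h6 := sum_prod_few_le (I := J) hd hβ0.le hβl (hsum hlk) N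
  have hPI := hP I hβk (hsum hkk)
  have hPJ := hP J hβl (hsum hlk)
  refine le_trans (le_of_eq ?_) (add_le_add (add_le_add (le_refl ε) h5) h6)
  have h7 : ∀ (ξ : I → Ω × Ω ⊕ α × α), ∑ ζ : J → Ω × Ω ⊕ α × α,
      (∏ i, mixWeight wk (Prod.map δ δ) β (ξ i)) * (∏ j, mixWeight wl (Prod.map δ δ) β (ζ j)) *
        (ε + (if #{i | (ξ i).isRight} < N then 1 else 0) +
          (if #{j | (ζ j).isRight} < N then 1 else 0)) =
      (∏ i, mixWeight wk (Prod.map δ δ) β (ξ i)) *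
        (ε + (if #{i | (ξ i).isRight} < N then 1 else 0)) +
      (∏ i, mixWeight wk (Prod.map δ δ) β (ξ i)) * ∑ ζ : J → Ω × Ω ⊕ α × α,
        (∏ j, mixWeight wl (Prod.map δ δ) β (ζ j)) *
          (if #{j | (ζ j).isRight} < N then 1 else 0) := by
    intro ξ
    generalize (∏ i, mixWeight wk (Prod.map δ δ) β (ξ i)) = A
    generalize (ε + (if #{i | (ξ i).isRight} < N then 1 else 0)) = B
    have h8 : A * B = ∑ ζ : J → Ω × Ω ⊕ α × α,
        A * B * ∏ j, mixWeight wl (Prod.map δ δ) β (ζ j) := by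
      rw [← Finset.mul_sum, hPJ, mul_one]
    rw [h8, Finset.mul_sum, ← Finset.sum_add_distrib]
    exact Finset.sum_congr rfl fun ζ _ => by ring
  simp only [h7]
  rw [Finset.sum_add_distrib, ← Finset.sum_mul, hPI, one_mul]
  simp only [mul_add, Finset.sum_add_distrib, ← Finset.sum_mul, hPI, one_mul]

end Patterns

/-! ### Connectivity as linking of triples. -/

section Linked
variable {Ω α : Type*}

/-- The edges of a walk lift to points of `Ω`; consecutive edges share a vertex, that is, a value of
`X` or of `Y`. -/
lemma linked_of_connected {R : Set (α × α)} (hR : (bipartiteGraph R).Connected) {X Y : Ω → α}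
    (hXY : ∀ a b, (a, b) ∈ R → ∃ ω, X ω = a ∧ Y ω = b) (ω ω' : Ω) :
    Relation.ReflTransGen (fun a b => X a = X b ∨ Y a = Y b) ω ω' := by
  have key : ∀ v, Relation.ReflTransGen (bipartiteGraph R).Adj (Sum.inl (X ω)) v →
      ∀ ω', v = Sum.inl (X ω') ∨ v = Sum.inr (Y ω') →
        Relation.ReflTransGen (fun a b => X a = X b ∨ Y a = Y b) ω ω' := by
    intro v hv
    induction hv with
    | refl =>
      rintro ω' (h | h)
      · exact Relation.ReflTransGen.single (Or.inl (Sum.inl_injective h))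
      · exact absurd h (by simp)
    | @tail u v _ huv ih =>
      intro ω' h
      rcases huv with ⟨a, b, hab, rfl, rfl⟩ | ⟨a, b, hab, rfl, rfl⟩
      · obtain ⟨ω₀, rfl, rfl⟩ := hXY a b hab
        refine (ih ω₀ (Or.inl rfl)).tail ?_
        rcases h with h | h
        · exact absurd h (by simp)
        · exact Or.inr (Sum.inr_injective h)
      · obtain ⟨ω₀, rfl, rfl⟩ := hXY a b hab
        refine (ih ω₀ (Or.inr rfl)).tail ?_
        rcases h with h | h
        · exact Or.inl (Sum.inl_injective h)
        · exact absurd h (by simp)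
  exact key _ ((SimpleGraph.reachable_iff_reflTransGen _ _).1 (hR.preconnected _ _)) ω' (Or.inl rfl)

end Linked

/-! ### Labeled coordinates of a random arrangement. -/

section Labels
variable {ι α L : Type*} [Fintype ι] [DecidableEq ι] [Fintype α] [DecidableEq α] [Nonempty α]
  [Fintype L] [DecidableEq L]

/-- The point with the letters `w` on the coordinates labeled by `e` and the letters of `θ.2`
elsewhere, with coordinates permuted by `θ.1`. -/
noncomputable def labelPoint (e : L → ι) (θ : Equiv.Perm ι × (ι → α)) (w : L → α) : ι → α :=
  extend e w θ.2 ∘ θ.1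

/-- The bound for the change of an average when letters are planted on labeled coordinates. -/
noncomputable def plantBound (q l n : ℕ) : ℝ := l * √((q : ℝ) / (n - l : ℕ))

/-- The planting bound with all unlabeled coordinates as the spare ones. -/
lemma abs_expect_labelPoint_sub_le {e : L → ι} (he : Injective e)
    (hn : Fintype.card L < Fintype.card ι) {h : (ι → α) → ℝ} (hh : ∀ x, |h x| ≤ 1) (w : L → α) :
    |𝔼 θ : Equiv.Perm ι × (ι → α), h (labelPoint e θ w) - 𝔼 x, h x| ≤
      plantBound (Fintype.card α) (Fintype.card L) (Fintype.card ι) := by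
  have hK : #(univ.image e) = Fintype.card L := card_image_of_injective _ he
  have hQ : #(univ.image e)ᶜ = Fintype.card ι - Fintype.card L := by rw [card_compl, hK]
  have h1 := expect_perm_piecewise_sub_le (g := fun F : (ι → α) → ℝ => F) zero_le_one
    (K := univ.image e) (Q := (univ.image e)ᶜ) (card_pos.1 (by omega)) disjoint_compl_right
    (fun F e _ e' _ x => rfl) h (fun τ x => hh _)
    (extend e w fun _ => Classical.arbitrary α)
  rw [hK, hQ, one_mul] at h1
  refine le_trans ?_ h1
  have h2 : ∀ τ x, relabel τ h ((univ.image e).piecewise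
      (extend e w fun _ => Classical.arbitrary α) x) = h (labelPoint e (τ, x) w) := by
    intro τ x
    simp only [relabel, labelPoint]
    congr 2
    funext i
    by_cases hi : ∃ l, e l = i
    · obtain ⟨l, rfl⟩ := hi
      simp [he.extend_apply]
    · have hi' : i ∉ univ.image e := by simpa using hi
      rw [piecewise_eq_of_notMem _ _ _ hi', extend_apply' _ _ _ hi]
  have h3 : ∀ τ : Equiv.Perm ι, 𝔼 x, relabel τ h x = 𝔼 x, h x := fun τ => expect_comp_perm τ h
  simp only [h2, h3]
  rw [← expect_expect_eq_prod (fun τ x => h (labelPoint e (τ, x) w))]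
  have h4 : 𝔼 _τ : Equiv.Perm ι, 𝔼 x, h x = 𝔼 x, h x := Fintype.expect_const _
  rw [← h4, ← expect_sub_distrib, h4]
  exact abs_expect_le _ _

lemma ubox_comp_injective {U V U' V' : Type*} [Fintype U] [DecidableEq U] [Fintype V]
    [DecidableEq V] [Fintype U'] [DecidableEq U'] [Fintype V'] [DecidableEq V'] {a : U' → U}
    {b : V' → V} (ha : Injective a) (hb : Injective b) (h : (U' → α) → (V' → α) → ℝ) :
    ubox (fun (u : U → α) (v : V → α) => h (u ∘ a) (v ∘ b)) = ubox h := by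
  unfold ubox
  rw [← expect_comp_injective ha]
  refine Finset.expect_congr rfl fun u _ => ?_
  rw [← expect_comp_injective ha]
  refine Finset.expect_congr rfl fun u' _ => ?_
  rw [← expect_comp_injective hb]

lemma boxNorm_image_inl {P P' : Type*} [Fintype P] [DecidableEq P] [Fintype P'] [DecidableEq P']
    (F : (P ⊕ P' → α) → ℝ) :
    boxNorm (univ.image Sum.inl) F = ubox fun (a : P → α) (b : P' → α) => F (Sum.elim a b) := by
  rw [← ubox_comp_injective (U := P ⊕ P') (V := P ⊕ P') Sum.inl_injective Sum.inr_injective]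
  unfold boxNorm ubox cov
  have h1 : ∀ y z : P ⊕ P' → α, (univ.image (Sum.inl : P → P ⊕ P')).piecewise y z =
      Sum.elim (y ∘ Sum.inl) (z ∘ Sum.inr) := by
    intro y z
    funext p
    rcases p with p | p <;> simp [Finset.piecewise]
  simp only [h1]

/-- The coordinates of the permuted labeled point are those of a combinatorial subspace. -/
lemma labelPoint_subpoint {κ : Type*} (e : L → ι) (θ : Equiv.Perm ι × (ι → α)) (r : L → α ⊕ κ)
    (y : κ → α) : labelPoint e θ (subpoint r y) =
      subpoint (fun i => extend e r (fun j => Sum.inl (θ.2 j)) (θ.1 i)) y := by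
  funext i
  exact (apply_extend (Sum.elim id y) e (fun j => Sum.inl (θ.2 j)) (θ.1 i)).symm

lemma subpoint_subpoint {κ κ' : Type*} (r : ι → α ⊕ κ) (r' : κ → α ⊕ κ') (y : κ' → α) :
    subpoint r (subpoint r' y) = subpoint (fun i => Sum.elim Sum.inl r' (r i)) y := by
  funext i
  simp only [subpoint]
  rcases r i with a | k <;> rfl

/-- Permuting the free labels amounts to a permutation of the coordinates. -/
lemma exists_perm_labelPoint {κ : Type*} {e : L → ι} (he : Injective e) {r : L → α ⊕ κ}
    {c : κ → L} (hc : ∀ l k, r l = Sum.inr k ↔ l = c k) (π : Equiv.Perm κ) :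
    ∃ σ : Equiv.Perm ι, ∀ (θ : Equiv.Perm ι × (ι → α)) (y : κ → α),
      labelPoint e θ (subpoint r (y ∘ π)) = labelPoint e (σ * θ.1, θ.2) (subpoint r y) := by
  have hci : Injective c := fun k k' h => by
    have h1 := (hc (c k) k).2 rfl
    rw [h, (hc (c k') k').2 rfl] at h1
    exact (Sum.inr_injective h1).symm
  let E : κ ↪ ι := ⟨e ∘ c, he.comp hci⟩
  refine ⟨π.viaEmbedding E, fun θ y => ?_⟩
  have h1 : extend e (subpoint r (y ∘ π)) θ.2 =
      extend e (subpoint r y) θ.2 ∘ π.viaEmbedding E := by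
    funext i
    by_cases hi : i ∈ Set.range E
    · obtain ⟨k, rfl⟩ := hi
      rw [comp_apply, Equiv.Perm.viaEmbedding_apply]
      simp only [E, Embedding.coeFn_mk, comp_apply, he.extend_apply, subpoint,
        (hc _ _).2 rfl, Sum.elim_inr]
    · rw [comp_apply, Equiv.Perm.viaEmbedding_apply_of_notMem _ _ _ hi]
      by_cases hl : ∃ l, e l = i
      · obtain ⟨l, rfl⟩ := hl
        rw [he.extend_apply, he.extend_apply, subpoint, subpoint]
        rcases h : r l with a | k
        · rfl
        · exact absurd ⟨k, by simp [E, ← (hc l k).1 h]⟩ hi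
      · rw [extend_apply' _ _ _ hl, extend_apply' _ _ _ hl]
  rw [labelPoint, labelPoint, h1]
  rfl

/-- If the average box norm of the fibers of `f` is large, then `f` has a positive mean on some
large combinatorial subspace. -/
lemma exists_subpoint_of_fiber_boxNorm {P P' : Type} [Fintype P] [DecidableEq P] [Fintype P']
    [DecidableEq P'] {q D s : ℕ} (hq : q = Fintype.card α) (hD : 0 < D) (hs : 0 < s)
    (hP : 2 * poolSize q D s ≤ Fintype.card P) (hP' : 2 * poolSize q D s ≤ Fintype.card P')
    (hsP : s ≤ Fintype.card P) {e : L → ι} (he : Injective e)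
    (hn : Fintype.card L < Fintype.card ι) {r : L → α ⊕ (P ⊕ P')} {c : P ⊕ P' → L}
    (hc : ∀ l k, r l = Sum.inr k ↔ l = c k) {f : (ι → α) → ℝ} (hf : ∀ x, |f x| ≤ 1)
    (hf0 : 𝔼 x, f x = 0) {ε γ : ℝ} (hDε : 1 / D ≤ ε / 2) (hγ0 : 0 ≤ γ)
    (hγε : γ ≤ ε / 16)
    (hγ : γ + plantBound q (Fintype.card L) (Fintype.card ι) < ε ^ 2 / 64)
    (hbox : ε ≤ 𝔼 θ : Equiv.Perm ι × (ι → α),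
      ubox fun a b => f (labelPoint e θ (subpoint r (Sum.elim a b)))) :
    ∃ m, s ≤ m ∧ ∃ r' : ι → α ⊕ Fin m, (∀ k, ∃ i, r' i = Sum.inr k) ∧
      γ ≤ 𝔼 y, f (subpoint r' y) := by
  have hD' : (0 : ℝ) < D := by exact_mod_cast hD
  have hε : 0 < ε := by
    have : 0 < 1 / (D : ℝ) := by positivity
    linarith
  set F : Equiv.Perm ι × (ι → α) → (P ⊕ P' → α) → ℝ := fun θ y =>
    f (labelPoint e θ (subpoint r y)) with hF
  set rθ : Equiv.Perm ι × (ι → α) → ι → α ⊕ (P ⊕ P') := fun θ i =>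
    extend e r (fun j => Sum.inl (θ.2 j)) (θ.1 i) with hrθ
  have hFr : ∀ θ y, F θ y = f (subpoint (rθ θ) y) := fun θ y => by
    rw [hF, hrθ]
    simp only [labelPoint_subpoint]
  have hsurj : ∀ θ k, ∃ i, rθ θ i = Sum.inr k := by
    intro θ k
    refine ⟨θ.1.symm (e (c k)), ?_⟩
    simp only [hrθ, Equiv.apply_symm_apply, he.extend_apply]
    exact (hc _ _).2 rfl
  by_contra hno
  push Not at hno
  -- all the fibers have small mean
  have hmean : ∀ θ, 𝔼 y, F θ y ≤ γ := by
    intro θ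
    let E := Fintype.equivFin (P ⊕ P')
    have h1 := hno (Fintype.card (P ⊕ P')) (by rw [Fintype.card_sum]; omega)
      (fun i => Sum.map id E (rθ θ i)) (fun k => by
        obtain ⟨i, hi⟩ := hsurj θ (E.symm k)
        exact ⟨i, by simp [hi]⟩)
    refine le_of_eq_of_le ?_ h1.le
    refine Fintype.expect_equiv (Equiv.arrowCongr E (Equiv.refl α)) _ _ fun y => ?_
    rw [hFr]
    congr 1
    funext i
    simp only [subpoint]
    rcases rθ θ i with a | k <;> simp
  have hlow : -plantBound q (Fintype.card L) (Fintype.card ι) ≤ 𝔼 θ, 𝔼 y, F θ y := by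
    rw [Finset.expect_comm]
    have h1 : ∀ y, -plantBound q (Fintype.card L) (Fintype.card ι) ≤ 𝔼 θ, F θ y := by
      intro y
      have := abs_expect_labelPoint_sub_le he hn hf (subpoint r y)
      rw [hf0, sub_zero, ← hq] at this
      exact (abs_le.1 this).1
    have h2 := expect_mono h1
    rwa [Fintype.expect_const] at h2
  set I₀ : Finset (P ⊕ P') := univ.image Sum.inl with hI₀
  set B : Equiv.Perm ι × (ι → α) → ℝ := fun θ =>
    𝔼 π : Equiv.Perm (P ⊕ P'), boxNorm I₀ (relabel π (F θ)) with hB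
  -- A permutation of the free labels is absorbed by the random permutation in θ, so the average
  -- over relabelings needed for `exists_subpoint_of_boxNorm` is free.
  have hBε : ε ≤ 𝔼 θ, B θ := by
    rw [hB, Finset.expect_comm]
    have h1 : ∀ π : Equiv.Perm (P ⊕ P'), 𝔼 θ, boxNorm I₀ (relabel π (F θ)) =
        𝔼 θ, boxNorm I₀ (F θ) := by
      intro π
      obtain ⟨σ, hσ⟩ := exists_perm_labelPoint he hc π
      have h2 : ∀ θ, relabel π (F θ) = F (σ * θ.1, θ.2) := fun θ => by
        funext y
        simp only [relabel, hF, hσ]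
      simp only [h2]
      exact expect_equiv_perm ((Equiv.mulLeft σ).prodCongr (Equiv.refl _))
        fun θ => boxNorm I₀ (F θ)
    simp only [h1, Fintype.expect_const]
    refine hbox.trans (le_of_eq ?_)
    exact Finset.expect_congr rfl fun θ _ => (boxNorm_image_inl (F θ)).symm
  -- Fiber means are at most γ and hardly negative on average, so a penalty for low means costs at
  -- most ε / 2. The weight 32 / ε forces the selected fiber to have mean at least −ε / 32, as the
  -- box norm is at most 1.
  have hpen : ε / 2 ≤ 𝔼 θ, (B θ - 32 / ε * (γ - 𝔼 y, F θ y)) := by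
    rw [expect_sub_distrib, ← mul_expect, expect_sub_distrib, Fintype.expect_const]
    have h1 : 32 / ε * (γ - 𝔼 θ, 𝔼 y, F θ y) ≤ 32 / ε * (ε ^ 2 / 64) :=
      mul_le_mul_of_nonneg_left (by linarith) (by positivity)
    have h2 : 32 / ε * (ε ^ 2 / 64) = ε / 2 := by field_simp; norm_num
    linarith
  obtain ⟨θ, -, hθ⟩ := exists_le_of_le_expect univ_nonempty hpen
  have hFθ : ∀ y, |F θ y| ≤ 1 := fun y => hf _
  have hB1 : B θ ≤ 1 := expect_le_of_le zero_le_one fun π => boxNorm_le_one _ fun _ => hFθ _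
  have hpos : 0 ≤ γ - 𝔼 y, F θ y := by linarith [hmean θ]
  have hBθ : ε / 2 ≤ B θ := by
    have : 0 ≤ 32 / ε * (γ - 𝔼 y, F θ y) := by positivity
    linarith
  have hpb : 0 ≤ plantBound q (Fintype.card L) (Fintype.card ι) := by
    unfold plantBound; positivity
  have hmθ : -(ε / 2 / 16) ≤ 𝔼 y, F θ y := by
    have h1 : 32 / ε * (γ - 𝔼 y, F θ y) ≤ 1 - ε / 2 := by linarith
    rw [div_mul_eq_mul_div, div_le_iff₀ hε] at h1
    nlinarith
  have hcI : #I₀ = Fintype.card P := by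
    rw [hI₀, card_image_of_injective _ Sum.inl_injective, card_univ]
  have hcJ : #I₀ᶜ = Fintype.card P' := by
    rw [card_compl, hcI, Fintype.card_sum]; omega
  obtain ⟨r', hr', hmean'⟩ := exists_subpoint_of_boxNorm hq hD hs (I := I₀) (by rw [hcI]; exact hP)
    (by rw [hcJ]; exact hP') hFθ hDε hBθ hmθ
  refine absurd (hno s le_rfl (fun i => Sum.elim Sum.inl r' (rθ θ i)) fun k => ?_) ?_
  · obtain ⟨p, hp⟩ := hr' k
    obtain ⟨i, hi⟩ := hsurj θ p
    exact ⟨i, by simp [hi, hp]⟩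
  · push Not
    refine hγε.trans ?_
    simp only [hFr, subpoint_subpoint] at hmean'
    linarith

end Labels

/-! ### Large box norms on patterns give subspaces of large mean. -/

section Assembly
variable {ι α : Type*} [Fintype ι] [DecidableEq ι] [Fintype α] [DecidableEq α] [Nonempty α]

/-- The indicator function of a finite set. -/
def ind (A : Finset (ι → α)) (x : ι → α) : ℝ := if x ∈ A then 1 else 0

/-- The function `f` has mean at least `γ` on a combinatorial subspace of dimension at
least `s`. -/
def HasLargeMean (f : (ι → α) → ℝ) (s : ℕ) (γ : ℝ) : Prop :=
  ∃ m, s ≤ m ∧ ∃ r : ι → α ⊕ Fin m, (∀ k, ∃ i, r i = Sum.inr k) ∧ γ ≤ 𝔼 y, f (subpoint r y)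

variable {I J : Type} [Fintype I] [DecidableEq I] [Fintype J] [DecidableEq J]

/-- The labeled point with letters `a`, `b` and `c` on the three kinds of labels. -/
noncomputable def threePoint (e : (I ⊕ J) ⊕ Unit → ι) (c : α) (θ : Equiv.Perm ι × (ι → α))
    (a : I → α) (b : J → α) : ι → α :=
  labelPoint e θ (Sum.elim (Sum.elim a b) fun _ => c)

/-- The blanks of the two patterns are the free labels, split as the box norm requires; the other
labels carry fixed letters. -/
lemma hasLargeMean_of_lt_ubox {q D s N : ℕ} (hq : q = Fintype.card α) (hD : 0 < D) (hs : 0 < s)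
    (hN : 2 * poolSize q D s ≤ N) (hsN : s ≤ N) {e : (I ⊕ J) ⊕ Unit → ι} (he : Injective e)
    (hn : Fintype.card ((I ⊕ J) ⊕ Unit) < Fintype.card ι) {f : (ι → α) → ℝ}
    (hf : ∀ x, |f x| ≤ 1) (hf0 : 𝔼 x, f x = 0) {ε γ : ℝ} (hDε : 1 / D ≤ ε / 2) (hγ0 : 0 ≤ γ)
    (hγε : γ ≤ ε / 16)
    (hγ : γ + plantBound q (Fintype.card ((I ⊕ J) ⊕ Unit)) (Fintype.card ι) < ε ^ 2 / 64) (c : α)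
    (p : I → Option α) (r : J → Option α) (hp : N ≤ #{i | p i = none})
    (hr : N ≤ #{j | r j = none})
    (hbox : ε < 𝔼 θ, ubox fun u v => f (threePoint e c θ (fill p u) (fill r v))) :
    HasLargeMean f s γ := by
  let P := {i // p i = none}
  let P' := {j // r j = none}
  let R : (I ⊕ J) ⊕ Unit → α ⊕ (P ⊕ P') := Sum.elim (Sum.elim
    (fun i => if h : p i = none then Sum.inr (Sum.inl ⟨i, h⟩) else Sum.inl ((p i).getD c))
    (fun j => if h : r j = none then Sum.inr (Sum.inr ⟨j, h⟩) else Sum.inl ((r j).getD c)))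
    fun _ => Sum.inl c
  let C : P ⊕ P' → (I ⊕ J) ⊕ Unit :=
    Sum.elim (fun i => Sum.inl (Sum.inl i)) fun j => Sum.inl (Sum.inr j)
  have hC : ∀ l k, R l = Sum.inr k ↔ l = C k := by
    rintro ((i | j) | u) (⟨k, hk⟩ | ⟨k, hk⟩)
    · by_cases h : p i = none
      · simp only [R, C, Sum.elim_inl, dif_pos h, Sum.inr.injEq, Sum.inl.injEq]
        exact Subtype.mk_eq_mk
      · simp only [R, C, Sum.elim_inl, dif_neg h, Sum.inl.injEq, reduceCtorEq, false_iff]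
        rintro rfl
        exact h hk
    · by_cases h : p i = none <;> simp [R, C, h]
    · by_cases h : r j = none <;> simp [R, C, h]
    · by_cases h : r j = none
      · simp only [R, C, Sum.elim_inl, Sum.elim_inr, dif_pos h, Sum.inr.injEq, Sum.inl.injEq]
        exact Subtype.mk_eq_mk
      · simp only [R, C, Sum.elim_inl, Sum.elim_inr, dif_neg h, Sum.inl.injEq, reduceCtorEq,
          Sum.inr.injEq, false_iff]
        rintro rfl
        exact h hk
    · simp [R, C]
    · simp [R, C]
  have hfill : ∀ u v, (Sum.elim (Sum.elim (fill p u) (fill r v)) fun _ => c :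
      (I ⊕ J) ⊕ Unit → α) =
      subpoint R (Sum.elim (u ∘ Subtype.val : P → α) (v ∘ Subtype.val : P' → α)) := by
    intro u v
    funext l
    rcases l with (i | j) | u
    · by_cases h : p i = none
      · simp [R, subpoint, fill, h]
      · obtain ⟨a, ha⟩ := Option.ne_none_iff_exists'.1 h
        simp [R, subpoint, fill, ha]
    · by_cases h : r j = none
      · simp [R, subpoint, fill, h]
      · obtain ⟨a, ha⟩ := Option.ne_none_iff_exists'.1 h
        simp [R, subpoint, fill, ha]
    · simp [R, subpoint]
  have hcP : N ≤ Fintype.card P := by rwa [Fintype.card_subtype]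
  have hcP' : N ≤ Fintype.card P' := by rwa [Fintype.card_subtype]
  refine exists_subpoint_of_fiber_boxNorm hq hD hs (hN.trans hcP) (hN.trans hcP') (hsN.trans hcP)
    he hn hC hf hf0 hDε hγ0 hγε hγ (hbox.le.trans (le_of_eq ?_))
  refine Finset.expect_congr rfl fun θ _ => ?_
  simp only [threePoint, hfill]
  exact ubox_comp_injective Subtype.val_injective Subtype.val_injective
    fun a b => f (labelPoint e θ (subpoint R (Sum.elim a b)))

end Assembly

/-! ### Trilinear averages over a set without nontrivial triples. -/

section Triples
variable {α : Type*} {S : Set (α × α × α)}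

lemma linked_XY (hS : PairwiseConnected S) (a b : S) : Relation.ReflTransGen
    (fun a b : S => a.1.1 = b.1.1 ∨ a.1.2.1 = b.1.2.1) a b :=
  linked_of_connected hS.1 (X := fun t : S => t.1.1) (Y := fun t : S => t.1.2.1)
    (fun x y ⟨z, h⟩ => ⟨⟨(x, y, z), h⟩, rfl, rfl⟩) a b

lemma linked_ZX (hS : PairwiseConnected S) (a b : S) : Relation.ReflTransGen
    (fun a b : S => a.1.2.2 = b.1.2.2 ∨ a.1.1 = b.1.1) a b :=
  Relation.ReflTransGen.mono (fun _ _ h => Or.symm h) _ _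
    (linked_of_connected hS.2.1 (X := fun t : S => t.1.1) (Y := fun t : S => t.1.2.2)
      (fun x z ⟨y, h⟩ => ⟨⟨(x, y, z), h⟩, rfl, rfl⟩) a b)

lemma linked_ZY (hS : PairwiseConnected S) (a b : S) : Relation.ReflTransGen
    (fun a b : S => a.1.2.2 = b.1.2.2 ∨ a.1.2.1 = b.1.2.1) a b :=
  Relation.ReflTransGen.mono (fun _ _ h => Or.symm h) _ _
    (linked_of_connected hS.2.2 (X := fun t : S => t.1.2.1) (Y := fun t : S => t.1.2.2)
      (fun y z ⟨x, h⟩ => ⟨⟨(x, y, z), h⟩, rfl, rfl⟩) a b)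

/-- If all triples were diagonal, a step preserving a coordinate would preserve the letter, and
distinct letters could not be linked. -/
lemma exists_nondiagonal [Nontrivial α] (hd : ∀ a, (a, a, a) ∈ S) (hS : PairwiseConnected S) :
    ∃ x y z, (x, y, z) ∈ S ∧ ¬ (x = y ∧ y = z) := by
  by_contra hno
  push Not at hno
  obtain ⟨a, b, hab⟩ := exists_pair_ne α
  have h1 : ∀ t : S, Relation.ReflTransGen
      (fun a b : S => a.1.1 = b.1.1 ∨ a.1.2.1 = b.1.2.1) ⟨(a, a, a), hd a⟩ t → t.1.1 = a := by
    intro t ht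
    induction ht with
    | refl => rfl
    | @tail t t' _ h ih =>
      rcases h with h | h
      · rw [← h, ih]
      · rw [(hno _ _ _ t'.2).1, ← h, ← (hno _ _ _ t.2).1, ih]
  exact hab (h1 ⟨(b, b, b), hd b⟩ (linked_XY hS _ _)).symm

/-- Unlabeled coordinates carry one common letter, and diagonal triples belong to `S`. -/
lemma threePoint_mem {ι I J : Type} [Fintype ι] [DecidableEq ι] [Fintype I] [DecidableEq I]
    [Fintype J] [DecidableEq J] (hd : ∀ a, (a, a, a) ∈ S)
    {e : (I ⊕ J) ⊕ Unit → ι} (he : Injective e) (ω : S) (θ : Equiv.Perm ι × (ι → α)) (a : I → S)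
    (b : J → S) (i : ι) :
    (threePoint e ω.1.1 θ (fun i => (a i).1.1) (fun j => (b j).1.1) i,
      threePoint e ω.1.2.1 θ (fun i => (a i).1.2.1) (fun j => (b j).1.2.1) i,
      threePoint e ω.1.2.2 θ (fun i => (a i).1.2.2) (fun j => (b j).1.2.2) i) ∈ S := by
  simp only [threePoint, labelPoint, comp_apply]
  by_cases h : ∃ l, e l = θ.1 i
  · obtain ⟨l, hl⟩ := h
    rw [← hl, he.extend_apply, he.extend_apply, he.extend_apply]
    rcases l with (i | j) | u
    · exact (a i).2
    · exact (b j).2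
    · exact ω.2
  · rw [extend_apply' _ _ _ h, extend_apply' _ _ _ h, extend_apply' _ _ _ h]
    exact hd _

/-- A set without nontrivial triples is denser on a large combinatorial subspace. -/
theorem exists_parameters [Fintype α] [DecidableEq α] [Nontrivial α]
    (hd : ∀ a, (a, a, a) ∈ S) (hS : PairwiseConnected S) : ∃ (M : ℕ) (ρ : ℝ), 0 ≤ ρ ∧ ρ < 1 ∧
      ∀ (ι : Type) [Fintype ι] [DecidableEq ι] (A : Finset (ι → α)),
        (∀ x ∈ A, ∀ y ∈ A, ∀ z ∈ A, (∀ i, (x i, y i, z i) ∈ S) → x = y ∧ y = z) →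
        ∀ (D s N₀ N : ℕ) (δ ε γ : ℝ), δ = 𝔼 x, ind A x → 0 < δ → 0 < D → 0 < s →
        2 * poolSize (Fintype.card α) D s ≤ N₀ → s ≤ N₀ → 2 * N + 1 < Fintype.card ι →
        1 / D ≤ ε / 2 → 0 ≤ γ → γ ≤ ε / 16 →
        γ + plantBound (Fintype.card α) (2 * N + 1) (Fintype.card ι) < ε ^ 2 / 64 →
        plantBound (Fintype.card α) (2 * N + 1) (Fintype.card ι) ≤ δ / 2 →
        ε + 2 ^ N₀ * ρ ^ N + 2 ^ N₀ * ρ ^ N < (δ ^ 3 / 4) ^ M →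
        HasLargeMean (ind A) s (δ + γ) := by
  classical
  obtain ⟨x₀, y₀, z₀, hω, hne⟩ := exists_nondiagonal hd hS
  let δ₀ : α → S := fun a => ⟨(a, a, a), hd a⟩
  obtain ⟨m₁, ρ₁, hρ₁0, hρ₁1, H₁⟩ := pow_le_of_ubox_le (X := fun t : S => t.1.1)
    (Y := fun t : S => t.1.2.1) (Z := fun t : S => t.1.2.2) (δ := δ₀) (fun _ => rfl)
    (linked_XY hS) (linked_ZY hS)
  -- For the average with f in the first place: the first coordinate takes the middle role, and the
  -- second one will carry the constant 1.
  obtain ⟨m₂, ρ₂, hρ₂0, hρ₂1, H₂⟩ := pow_le_of_ubox_le (X := fun t : S => t.1.2.1)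
    (Y := fun t : S => t.1.1) (Z := fun t : S => t.1.2.2) (δ := δ₀) (fun _ => rfl)
    (fun a b => Relation.ReflTransGen.mono (fun _ _ h => Or.symm h) _ _ (linked_XY hS a b))
    (linked_ZX hS)
  refine ⟨max m₁ m₂, max ρ₁ ρ₂, le_max_of_le_left hρ₁0, max_lt hρ₁1 hρ₂1, ?_⟩
  intro ι _ _ A hA D s N₀ N δ ε γ hδ hδ0 hD hs hN₀ hsN hn hDε hγ0 hγε hγ hpl hlast
  have hLab : Fintype.card ((Fin N ⊕ Fin N) ⊕ Unit) = 2 * N + 1 := by simp; omega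
  obtain ⟨emb⟩ := Function.Embedding.nonempty_of_card_le (α := (Fin N ⊕ Fin N) ⊕ Unit) (β := ι)
    (by omega)
  let e : (Fin N ⊕ Fin N) ⊕ Unit → ι := emb
  have he : Injective e := emb.injective
  have hind0 : ∀ x, 0 ≤ ind A x := fun x => by unfold ind; split_ifs <;> norm_num
  have hind1 : ∀ x, ind A x ≤ 1 := fun x => by unfold ind; split_ifs <;> norm_num
  have hind : ∀ x, |ind A x| ≤ 1 := fun x => abs_le.2 ⟨by linarith [hind0 x], hind1 x⟩
  have hδ1 : δ ≤ 1 := hδ ▸ expect_le_of_le zero_le_one hind1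
  set f : (ι → α) → ℝ := fun x => ind A x - δ with hf
  have hf1 : ∀ x, |f x| ≤ 1 := fun x =>
    abs_le.2 ⟨by simp only [hf]; linarith [hind0 x], by simp only [hf]; linarith [hind1 x]⟩
  have hf0 : 𝔼 x, f x = 0 := by
    simp only [hf]
    rw [expect_sub_distrib, Fintype.expect_const, ← hδ, sub_self]
  by_contra hno
  have hno' : ¬ HasLargeMean f s γ := by
    rintro ⟨m, hm, r, hr, h⟩
    refine hno ⟨m, hm, r, hr, ?_⟩
    simp only [hf] at h
    rw [expect_sub_distrib, Fintype.expect_const] at h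
    linarith
  have hu : ∀ (c : α) (p r : Fin N → Option α), N₀ ≤ #{i | p i = none} →
      N₀ ≤ #{j | r j = none} →
      𝔼 θ, ubox (fun u v => f (threePoint e c θ (fill p u) (fill r v))) ≤ ε := by
    intro c p r hp hr
    by_contra hlt
    exact hno' (hasLargeMean_of_lt_ubox rfl hD hs hN₀ hsN he (by omega) hf1 hf0 hDε hγ0 hγε
      (by rw [hLab]; exact hγ) c p r hp hr (not_le.1 hlt))
  have hε0 : 0 ≤ ε := by
    have : (0 : ℝ) ≤ 1 / D := by positivity
    linarith
  set η := δ ^ 3 / 4 with hη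
  have hη0 : 0 ≤ η := by positivity
  have hη1 : η ≤ 1 := by
    have := pow_le_one₀ hδ0.le hδ1 (n := 3)
    linarith
  have hρ : ∀ {ρ}, 0 ≤ ρ → ρ ≤ max ρ₁ ρ₂ →
      (2 : ℝ) ^ N₀ * ρ ^ N ≤ 2 ^ N₀ * (max ρ₁ ρ₂) ^ N := fun h0 h1 =>
    mul_le_mul_of_nonneg_left (pow_le_pow_left₀ h0 h1 _) (by positivity)
  -- the two trilinear averages are small
  have hT₁ : |𝔼 θ, 𝔼 a : Fin N → S, 𝔼 b : Fin N → S,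
      ind A (threePoint e x₀ θ (fun i => (a i).1.1) (fun j => (b j).1.1)) *
      f (threePoint e y₀ θ (fun i => (a i).1.2.1) (fun j => (b j).1.2.1)) *
      ind A (threePoint e z₀ θ (fun i => (a i).1.2.2) (fun j => (b j).1.2.2))| < η := by
    by_contra hlt
    have := H₁ (Fin N) (Fin N) (Equiv.Perm ι × (ι → α))
      (fun θ a b => ind A (threePoint e x₀ θ a b)) (fun θ a b => f (threePoint e y₀ θ a b))
      (fun θ a b => ind A (threePoint e z₀ θ a b)) (fun _ _ _ => hind _) (fun _ _ _ => hf1 _)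
      (fun _ _ _ => hind _) η ε hη0 hε0 (not_lt.1 hlt) N₀ (hu y₀)
    have h1 : η ^ max m₁ m₂ ≤ η ^ m₁ := pow_le_pow_of_le_one hη0 hη1 (le_max_left _ _)
    have h2 := hρ hρ₁0 (le_max_left _ _)
    rw [Fintype.card_fin] at this
    linarith
  have hT₂ : |𝔼 θ, 𝔼 a : Fin N → S, 𝔼 b : Fin N → S,
      1 * f (threePoint e x₀ θ (fun i => (a i).1.1) (fun j => (b j).1.1)) *
      ind A (threePoint e z₀ θ (fun i => (a i).1.2.2) (fun j => (b j).1.2.2))| < η := by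
    by_contra hlt
    have := H₂ (Fin N) (Fin N) (Equiv.Perm ι × (ι → α))
      (fun θ a b => 1) (fun θ a b => f (threePoint e x₀ θ a b))
      (fun θ a b => ind A (threePoint e z₀ θ a b)) (fun _ _ _ => by simp) (fun _ _ _ => hf1 _)
      (fun _ _ _ => hind _) η ε hη0 hε0 (not_lt.1 hlt) N₀ (hu x₀)
    have h1 : η ^ max m₁ m₂ ≤ η ^ m₂ := pow_le_pow_of_le_one hη0 hη1 (le_max_right _ _)
    have h2 := hρ hρ₂0 (le_max_right _ _)
    rw [Fintype.card_fin] at this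
    linarith
  have hT₃ : δ / 2 ≤ 𝔼 θ, 𝔼 a : Fin N → S, 𝔼 b : Fin N → S,
      ind A (threePoint e z₀ θ (fun i => (a i).1.2.2) (fun j => (b j).1.2.2)) := by
    have hSne : Nonempty S := ⟨⟨_, hω⟩⟩
    simp only [expect_expect_eq_prod (fun (a b : Fin N → S) => ind A (threePoint e z₀ _ (fun i =>
      (a i).1.2.2) (fun j => (b j).1.2.2)))]
    rw [Finset.expect_comm]
    have h1 : ∀ p : (Fin N → S) × (Fin N → S), δ / 2 ≤ 𝔼 θ,
        ind A (threePoint e z₀ θ (fun i => (p.1 i).1.2.2) (fun j => (p.2 j).1.2.2)) := by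
      intro p
      have := abs_expect_labelPoint_sub_le he (by omega) hind
        (Sum.elim (Sum.elim (fun i => (p.1 i).1.2.2) (fun j => (p.2 j).1.2.2)) fun _ => z₀)
      rw [← hδ, hLab] at this
      have := (abs_le.1 this).1
      simp only [threePoint]
      linarith
    have h2 := expect_mono h1
    rwa [Fintype.expect_const] at h2
  -- This is the expansion of the product of three indicators. The product vanishes because the
  -- three points are not all equal at the coordinate labeled by `Unit`.
  have hzero : ∀ θ (a b : Fin N → S),
      ind A (threePoint e x₀ θ (fun i => (a i).1.1) (fun j => (b j).1.1)) *
      f (threePoint e y₀ θ (fun i => (a i).1.2.1) (fun j => (b j).1.2.1)) *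
      ind A (threePoint e z₀ θ (fun i => (a i).1.2.2) (fun j => (b j).1.2.2)) +
      δ * (1 * f (threePoint e x₀ θ (fun i => (a i).1.1) (fun j => (b j).1.1)) *
      ind A (threePoint e z₀ θ (fun i => (a i).1.2.2) (fun j => (b j).1.2.2))) +
      δ ^ 2 * ind A (threePoint e z₀ θ (fun i => (a i).1.2.2) (fun j => (b j).1.2.2)) = 0 := by
    intro θ a b
    have h1 : ind A (threePoint e x₀ θ (fun i => (a i).1.1) (fun j => (b j).1.1)) *
        ind A (threePoint e y₀ θ (fun i => (a i).1.2.1) (fun j => (b j).1.2.1)) *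
        ind A (threePoint e z₀ θ (fun i => (a i).1.2.2) (fun j => (b j).1.2.2)) = 0 := by
      by_contra h
      simp only [ind, mul_ne_zero_iff, ne_eq, ite_eq_right_iff, one_ne_zero, imp_false,
        not_not] at h
      obtain ⟨⟨hx, hy⟩, hz⟩ := h
      have := hA _ hx _ hy _ hz (threePoint_mem hd he ⟨(x₀, y₀, z₀), hω⟩ θ a b)
      have hev : ∀ (c : α) (a b : Fin N → α),
          threePoint e c θ a b (θ.1.symm (e (Sum.inr ()))) = c := by
        intro c a b
        simp [threePoint, labelPoint, he.extend_apply]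
      refine hne ⟨?_, ?_⟩
      · have h2 := congrFun this.1 (θ.1.symm (e (Sum.inr ())))
        rwa [hev, hev] at h2
      · have h2 := congrFun this.2 (θ.1.symm (e (Sum.inr ())))
        rwa [hev, hev] at h2
    simp only [hf]
    linear_combination h1
  have hsum : (𝔼 θ, 𝔼 a : Fin N → S, 𝔼 b : Fin N → S,
      ind A (threePoint e x₀ θ (fun i => (a i).1.1) (fun j => (b j).1.1)) *
      f (threePoint e y₀ θ (fun i => (a i).1.2.1) (fun j => (b j).1.2.1)) *
      ind A (threePoint e z₀ θ (fun i => (a i).1.2.2) (fun j => (b j).1.2.2))) +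
      δ * (𝔼 θ, 𝔼 a : Fin N → S, 𝔼 b : Fin N → S,
      1 * f (threePoint e x₀ θ (fun i => (a i).1.1) (fun j => (b j).1.1)) *
      ind A (threePoint e z₀ θ (fun i => (a i).1.2.2) (fun j => (b j).1.2.2))) +
      δ ^ 2 * (𝔼 θ, 𝔼 a : Fin N → S, 𝔼 b : Fin N → S,
      ind A (threePoint e z₀ θ (fun i => (a i).1.2.2) (fun j => (b j).1.2.2))) = 0 := by
    simp only [mul_expect, ← expect_add_distrib, hzero]
    simp
  -- The vanishing sum would exceed −η − δη + 2η ≥ 0.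
  have h1 := (abs_lt.1 hT₁).1
  have h2 := mul_le_mul_of_nonneg_left (abs_lt.1 hT₂).1.le hδ0.le
  have h3 := mul_le_mul_of_nonneg_left hT₃ (sq_nonneg δ)
  have h4 : δ * η ≤ η := mul_le_of_le_one_left hη0 hδ1
  have h5 : δ ^ 2 * (δ / 2) = 2 * η := by rw [hη]; ring
  linarith

end Triples

/-! ### Growth of the parameters. -/

section Growth

/-- The function `x` of `D ≥ 2` and `s ≥ 1` is at most `(s D) ^ (c D ^ p)` for some `c`. -/
def GrowthBound (p : ℕ) (x : ℕ → ℕ → ℕ) : Prop :=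
  ∃ c, ∀ D s, 2 ≤ D → 1 ≤ s → x D s ≤ (s * D) ^ (c * D ^ p)

variable {p : ℕ} {x y : ℕ → ℕ → ℕ}

lemma two_le_mul' {D s : ℕ} (hD : 2 ≤ D) (hs : 1 ≤ s) : 2 ≤ s * D := by nlinarith

lemma GrowthBound.of_pow (c : ℕ) (h : ∀ D s, 2 ≤ D → 1 ≤ s → x D s ≤ (s * D) ^ c) :
    GrowthBound p x :=
  ⟨c, fun D s hD hs => (h D s hD hs).trans (Nat.pow_le_pow_right
    (by have := two_le_mul' hD hs; omega) (Nat.le_mul_of_pos_right _ (by positivity)))⟩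

lemma GrowthBound.const (k : ℕ) : GrowthBound p fun _ _ => k :=
  .of_pow k fun _ _ hD hs => Nat.lt_two_pow_self.le.trans
    (Nat.pow_le_pow_left (two_le_mul' hD hs) k)

lemma GrowthBound.fst : GrowthBound p fun D _ => D :=
  .of_pow 1 fun D s _ hs => by rw [pow_one]; exact Nat.le_mul_of_pos_left _ hs

lemma GrowthBound.snd : GrowthBound p fun _ s => s :=
  .of_pow 1 fun D s hD _ => by rw [pow_one]; exact Nat.le_mul_of_pos_right _ (by omega)

lemma GrowthBound.mul (hx : GrowthBound p x) (hy : GrowthBound p y) :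
    GrowthBound p fun D s => x D s * y D s := by
  obtain ⟨c, hc⟩ := hx
  obtain ⟨c', hc'⟩ := hy
  refine ⟨c + c', fun D s hD hs => ?_⟩
  rw [add_mul, pow_add]
  exact Nat.mul_le_mul (hc D s hD hs) (hc' D s hD hs)

lemma GrowthBound.add (hx : GrowthBound p x) (hy : GrowthBound p y) :
    GrowthBound p fun D s => x D s + y D s := by
  have h1 : GrowthBound p fun D s => max (x D s) 1 * max (y D s) 1 := by
    have h : ∀ {z : ℕ → ℕ → ℕ}, GrowthBound p z → GrowthBound p fun D s => max (z D s) 1 := by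
      rintro z ⟨c, hc⟩
      refine ⟨c, fun D s hD hs => max_le (hc D s hD hs) (Nat.one_le_pow _ _ ?_)⟩
      have := two_le_mul' hD hs
      omega
    exact (h hx).mul (h hy)
  obtain ⟨c, hc⟩ := (GrowthBound.const 2).mul h1
  refine ⟨c, fun D s hD hs => le_trans ?_ (hc D s hD hs)⟩
  have h2 : x D s ≤ max (x D s) 1 := le_max_left _ _
  have h3 : y D s ≤ max (y D s) 1 := le_max_left _ _
  have h4 : 1 ≤ max (x D s) 1 := le_max_right _ _
  have h5 : 1 ≤ max (y D s) 1 := le_max_right _ _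
  have h6 := Nat.mul_le_mul_left (max (x D s) 1) h5
  have h7 := Nat.mul_le_mul_right (max (y D s) 1) h4
  simp only
  omega

lemma GrowthBound.pow (hx : GrowthBound p x) (k : ℕ) : GrowthBound p fun D s => x D s ^ k := by
  obtain ⟨c, hc⟩ := hx
  refine ⟨c * k, fun D s hD hs => (Nat.pow_le_pow_left (hc D s hD hs) k).trans (le_of_eq ?_)⟩
  rw [← pow_mul]
  congr 1
  ring

/-- The source of the exponent D ^ p: the group length is a polynomial raised to a multiple of D ^
p. -/
lemma GrowthBound.pow_pow (hx : GrowthBound 0 x) (k : ℕ) :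
    GrowthBound p fun D s => x D s ^ (k * D ^ p) := by
  obtain ⟨c, hc⟩ := hx
  refine ⟨c * k, fun D s hD hs => (Nat.pow_le_pow_left (hc D s hD hs) _).trans (le_of_eq ?_)⟩
  rw [← pow_mul]
  congr 1
  ring

lemma growthBound_groupLength (q : ℕ) : GrowthBound p fun D s => groupLength q (D ^ p) s :=
  .pow_pow (((((GrowthBound.const 32).mul .snd).mul (.const q)).mul (GrowthBound.fst.pow p)).add
    (.const 1)) (4 * q)

lemma growthBound_poolSize (q : ℕ) : GrowthBound p fun D s => poolSize q (D ^ p) s :=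
  (GrowthBound.const q).mul
    (((((GrowthBound.const (2 ^ 18)).mul (GrowthBound.snd.pow 3)).mul
      (((growthBound_groupLength q).add (.const 1)).pow 7)).mul ((GrowthBound.const q).pow 2)).mul
      ((GrowthBound.fst.pow p).pow 4) |>.pow 2)

/-- The number of labels of each kind. -/
def labelCount (q M t D s : ℕ) : ℕ := t * (2 * poolSize q (D ^ (5 * M + 2)) s + 3 + 5 * M * D)

/-- A number of coordinates that is sufficient for one step of the density increment. -/
def stepSize (q M t D s : ℕ) : ℕ :=
  2 * labelCount q M t D s + 1 +
    q * ((2 * labelCount q M t D s + 1) * D ^ (10 * M + 9)) ^ 2 + 1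

lemma growthBound_stepSize (q M t : ℕ) : GrowthBound (5 * M + 2) (stepSize q M t) := by
  have h1 : GrowthBound (5 * M + 2) (labelCount q M t) :=
    (GrowthBound.const t).mul ((((GrowthBound.const 2).mul (growthBound_poolSize q)).add
      (.const 3)).add ((GrowthBound.const (5 * M)).mul .fst))
  have h2 := ((GrowthBound.const 2).mul h1).add (.const 1)
  exact (h2.add ((GrowthBound.const q).mul ((h2.mul (GrowthBound.fst.pow _)).pow 2))).add
    (.const 1)

/-- The constant in the exponent is absorbed using c ≤ D ^ c. The lower bound on `K` keeps the
increment D ^ (-K) below the threshold ε² / 128 in `exists_density_increment`. -/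
lemma exists_stepSize_le (q M t : ℕ) : ∃ K, 10 * M + 10 ≤ K ∧ ∀ D s, 2 ≤ D → 1 ≤ s →
    stepSize q M t D s ≤ (s * D) ^ D ^ K := by
  obtain ⟨c, hc⟩ := growthBound_stepSize q M t
  refine ⟨max (10 * M + 10) (c + (5 * M + 2)), le_max_left _ _, fun D s hD hs => ?_⟩
  refine (hc D s hD hs).trans (Nat.pow_le_pow_right (by have := two_le_mul' hD hs; omega) ?_)
  calc c * D ^ (5 * M + 2) ≤ D ^ c * D ^ (5 * M + 2) :=
        Nat.mul_le_mul_right _ (Nat.lt_two_pow_self.le.trans (Nat.pow_le_pow_left hD c))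
    _ = D ^ (c + (5 * M + 2)) := (pow_add _ _ _).symm
    _ ≤ _ := Nat.pow_le_pow_right (by omega) (le_max_right _ _)

end Growth

/-! ### The density increment. -/

section Increment
variable {α : Type*} {S : Set (α × α × α)}

lemma plantBound_le {q l n k : ℕ} (hk : 0 < k) (hn : l + q * (l * k) ^ 2 + 1 ≤ n) :
    plantBound q l n ≤ 1 / k := by
  have h1 : (q : ℝ) * (l * k) ^ 2 ≤ (n - l : ℕ) := by
    have : q * (l * k) ^ 2 ≤ n - l := by omega
    exact_mod_cast this
  have hpos : (0 : ℝ) < (n - l : ℕ) := by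
    have : 0 < n - l := by omega
    exact_mod_cast this
  have hk' : (0 : ℝ) < k := by exact_mod_cast hk
  rw [plantBound, le_div_iff₀ hk']
  have h2 : (l * √((q : ℝ) / (n - l : ℕ)) * k) ^ 2 ≤ 1 := by
    rw [mul_pow, mul_pow, Real.sq_sqrt (by positivity)]
    calc (l : ℝ) ^ 2 * (q / (n - l : ℕ)) * k ^ 2 = q * (l * k) ^ 2 / (n - l : ℕ) := by ring
      _ ≤ 1 := by rw [div_le_one hpos]; exact h1
  nlinarith [sq_nonneg (l * √((q : ℝ) / (n - l : ℕ)) * k - 1)]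

/-- The density increment: a dense set without nontrivial triples is denser on a combinatorial
subspace of large dimension. -/
theorem exists_density_increment [Fintype α] [DecidableEq α] [Nontrivial α]
    (hd : ∀ a, (a, a, a) ∈ S) (hS : PairwiseConnected S) : ∃ K : ℕ,
      ∀ (ι : Type) [Fintype ι] [DecidableEq ι] (A : Finset (ι → α)),
        (∀ x ∈ A, ∀ y ∈ A, ∀ z ∈ A, (∀ i, (x i, y i, z i) ∈ S) → x = y ∧ y = z) →
        ∀ D s : ℕ, 2 ≤ D → 1 ≤ s → 1 / (D : ℝ) ≤ 𝔼 x, ind A x →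
          (s * D) ^ D ^ K ≤ Fintype.card ι →
          HasLargeMean (ind A) s (𝔼 x, ind A x + 1 / (D : ℝ) ^ K) := by
  obtain ⟨M, ρ, hρ0, hρ1, H⟩ := exists_parameters hd hS
  obtain ⟨t, ht⟩ := exists_pow_lt_of_lt_one (show (0 : ℝ) < 1 / 2 by norm_num) hρ1
  set q := Fintype.card α with hq
  obtain ⟨K, hMK, hK⟩ := exists_stepSize_le q M t
  refine ⟨K, fun ι _ _ A hA D s hD hs hδ hn => ?_⟩
  have hDr : (2 : ℝ) ≤ D := by exact_mod_cast hD
  have hD0 : (0 : ℝ) < D := by linarith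
  have hD1 : (1 : ℝ) ≤ D := by linarith
  set δ := 𝔼 x, ind A x with hδd
  have hδ0 : 0 < δ := lt_of_lt_of_le (by positivity) hδ
  set P := 2 * poolSize q (D ^ (5 * M + 2)) s with hP
  set N := labelCount q M t D s with hN
  have hn' := (hK D s hD hs).trans hn
  rw [stepSize, ← hN] at hn'
  -- Since δ ≥ 1 / D and D ≥ 2, (δ³ / 4) ^ M is at least D ^ (-5M) = 2ε; the two tail terms will be
  -- at most ε / 4 each.
  set ε : ℝ := 1 / (2 * D ^ (5 * M)) with hε
  have hpow2 : ∀ k : ℕ, (2 : ℝ) ^ k ≤ D ^ k := fun k => pow_le_pow_left₀ (by norm_num) hDr k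
  have hεsq : ε ^ 2 = 1 / (4 * D ^ (10 * M)) := by
    rw [hε, div_pow, mul_pow, ← pow_mul]
    norm_num
    ring_nf
  have hX : (0 : ℝ) < D ^ (10 * M) := by positivity
  have hpb : plantBound q (2 * N + 1) (Fintype.card ι) ≤ 1 / D ^ (10 * M + 9) := by
    have := plantBound_le (q := q) (l := 2 * N + 1) (n := Fintype.card ι)
      (k := D ^ (10 * M + 9)) (by positivity) hn'
    rwa [Nat.cast_pow] at this
  have hpb1 : (1 : ℝ) / D ^ (10 * M + 9) ≤ ε ^ 2 / 128 := by
    rw [hεsq, div_div, pow_add]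
    refine one_div_le_one_div_of_le (by positivity) ?_
    have := mul_le_mul_of_nonneg_left (hpow2 9) hX.le
    linarith
  have hγ1 : (1 : ℝ) / D ^ K < ε ^ 2 / 128 := by
    have h1 : (1 : ℝ) / D ^ K ≤ 1 / D ^ (10 * M + 10) :=
      one_div_le_one_div_of_le (by positivity) (pow_le_pow_right₀ hD1 hMK)
    refine h1.trans_lt ?_
    rw [hεsq, div_div, pow_add]
    refine one_div_lt_one_div_of_lt (by positivity) ?_
    have := mul_le_mul_of_nonneg_left (hpow2 10) hX.le
    linarith
  have hε0 : 0 < ε := by rw [hε]; positivity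
  have hε1 : ε ≤ 1 := by
    rw [hε, div_le_one (by positivity)]
    have := one_le_pow₀ hD1 (n := 5 * M)
    linarith
  have hε2 : ε ^ 2 ≤ ε := by nlinarith
  refine H ι A hA (D ^ (5 * M + 2)) s P N δ ε (1 / D ^ K) rfl hδ0 (by positivity) hs le_rfl ?_
    (by omega) ?_ (by positivity) (by linarith) (by linarith) ?_ ?_
  · have hq0 : 0 < q := Fintype.card_pos
    rw [hP, poolSize]
    have h1 : s ≤ 2 ^ 18 * s ^ 3 * (groupLength q (D ^ (5 * M + 2)) s + 1) ^ 7 * q ^ 2 *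
        (D ^ (5 * M + 2)) ^ 4 := by
      calc s ≤ s ^ 3 := Nat.le_self_pow (by norm_num) s
        _ = 1 * s ^ 3 * 1 * 1 * 1 := by ring
        _ ≤ _ := by
          gcongr
          · norm_num
          · exact Nat.one_le_pow _ _ (by omega)
          · exact Nat.one_le_pow _ _ hq0
          · exact Nat.one_le_pow _ _ (by positivity)
    have h2 := Nat.le_self_pow two_ne_zero (2 ^ 18 * s ^ 3 *
      (groupLength q (D ^ (5 * M + 2)) s + 1) ^ 7 * q ^ 2 * (D ^ (5 * M + 2)) ^ 4)
    exact h1.trans (h2.trans ((Nat.le_mul_of_pos_left _ hq0).trans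
      (Nat.le_mul_of_pos_left _ two_pos)))
  · rw [hε, div_div]
    push_cast
    refine one_div_le_one_div_of_le (by positivity) ?_
    rw [pow_add]
    have := mul_le_mul_of_nonneg_left (hpow2 2) (by positivity : (0 : ℝ) ≤ D ^ (5 * M))
    linarith
  · refine hpb.trans (le_trans ?_ (div_le_div_of_nonneg_right hδ two_pos.le))
    rw [div_div]
    refine one_div_le_one_div_of_le (by positivity) ?_
    calc (D : ℝ) * 2 ≤ D * D := by gcongr
      _ = D ^ 2 := (sq _).symm
      _ ≤ _ := pow_le_pow_right₀ hD1 (by omega)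
  · have h1 : 1 / (D : ℝ) ^ (5 * M) ≤ (δ ^ 3 / 4) ^ M := by
      have h2 : 1 / (D : ℝ) ^ 5 ≤ δ ^ 3 / 4 := by
        have h3 := pow_le_pow_left₀ (by positivity) hδ 3
        have h4 : 1 / (D : ℝ) ^ 5 ≤ (1 / D) ^ 3 / 4 := by
          rw [one_div_pow, div_div]
          refine one_div_le_one_div_of_le (by positivity) ?_
          have := mul_le_mul_of_nonneg_left (hpow2 2) (by positivity : (0 : ℝ) ≤ D ^ 3)
          have h5 : (D : ℝ) ^ 5 = D ^ 3 * D ^ 2 := by ring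
          linarith
        linarith
      have h3 := pow_le_pow_left₀ (by positivity) h2 M
      rwa [one_div_pow, ← pow_mul] at h3
    -- As ρ ^ t < 1 / 2, the t-fold count in `labelCount` yields enough halvings to beat 2 ^ P, the
    -- factor 8 and D ^ (5M).
    have h2 : ρ ^ N ≤ (1 / 2) ^ (P + 3 + 5 * M * D) := by
      rw [hN, labelCount, pow_mul]
      exact pow_le_pow_left₀ (by positivity) ht.le _
    have h3 : (2 : ℝ) ^ P * ρ ^ N ≤ 1 / (8 * D ^ (5 * M)) := by
      have h4 : (D : ℝ) ^ (5 * M) ≤ 2 ^ (5 * M * D) := by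
        have h5 : (D : ℝ) ≤ 2 ^ D := by exact_mod_cast Nat.lt_two_pow_self.le
        have h6 := pow_le_pow_left₀ hD0.le h5 (5 * M)
        rwa [← pow_mul, mul_comm D] at h6
      calc (2 : ℝ) ^ P * ρ ^ N ≤ 2 ^ P * (1 / 2) ^ (P + 3 + 5 * M * D) := by gcongr
        _ = 1 / (8 * 2 ^ (5 * M * D)) := by
          rw [pow_add, pow_add, one_div_pow, one_div_pow, one_div_pow]
          field_simp
          norm_num
        _ ≤ _ := by gcongr
    have h4 : 1 / (8 * (D : ℝ) ^ (5 * M)) = (1 / D ^ (5 * M)) / 8 := by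
      rw [div_div, mul_comm]
    have h5 : ε = (1 / D ^ (5 * M)) / 2 := by rw [hε, div_div, mul_comm]
    have h6 : (0 : ℝ) < 1 / D ^ (5 * M) := by positivity
    linarith

end Increment

/-! ### Iteration and the triple logarithm. -/

section Iteration
variable {α : Type*} {S : Set (α × α × α)}

/-- The dimension needed for `t` density increments. -/
def iterSize (D E : ℕ) : ℕ → ℕ
  | 0 => 1
  | t + 1 => (iterSize D E t * D) ^ E

/-- Carrying the extra factor D turns the recursion into the inequality E (E + 1) ^ t + 1 ≤ (E + 1)
^ (t + 1) between exponents. -/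
lemma iterSize_mul_le (D E : ℕ) (hD : 1 ≤ D) :
    ∀ t, iterSize D E t * D ≤ D ^ (E + 1) ^ t
  | 0 => by simp [iterSize]
  | t + 1 => by
    have h1 : E * (E + 1) ^ t + 1 ≤ (E + 1) ^ (t + 1) := by
      have := Nat.one_le_pow t (E + 1) (by omega)
      rw [pow_succ]
      nlinarith
    calc (iterSize D E t * D) ^ E * D ≤ (D ^ (E + 1) ^ t) ^ E * D :=
          Nat.mul_le_mul_right _ (Nat.pow_le_pow_left (iterSize_mul_le D E hD t) E)
      _ = D ^ (E * (E + 1) ^ t + 1) := by rw [← pow_mul, pow_succ, mul_comm E]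
      _ ≤ _ := Nat.pow_le_pow_right hD h1

lemma one_le_iterSize (D E : ℕ) (hD : 1 ≤ D) : ∀ t, 1 ≤ iterSize D E t
  | 0 => le_rfl
  | t + 1 => Nat.one_le_pow _ _ (Nat.mul_pos (one_le_iterSize D E hD t) hD)

lemma subpoint_injective {ι κ : Type*} {r : ι → α ⊕ κ} (hr : ∀ k, ∃ i, r i = Sum.inr k) :
    Injective (subpoint r : (κ → α) → ι → α) := by
  intro x y h
  funext k
  obtain ⟨i, hi⟩ := hr k
  simpa [subpoint, hi] using congrFun h i

/-- A dense set in sufficiently large dimension contains a nontrivial triple. -/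
theorem exists_dense_triple [Fintype α] [DecidableEq α] [Nontrivial α]
    (hd : ∀ a, (a, a, a) ∈ S) (hS : PairwiseConnected S) : ∃ K : ℕ,
      ∀ (ι : Type) [Fintype ι] [DecidableEq ι] (A : Finset (ι → α)) (D : ℕ), 2 ≤ D →
        1 / (D : ℝ) ≤ 𝔼 x, ind A x → D ^ (D ^ K + 1) ^ D ^ K ≤ Fintype.card ι →
        ∃ x ∈ A, ∃ y ∈ A, ∃ z ∈ A, ¬ (x = y ∧ y = z) ∧ ∀ i, (x i, y i, z i) ∈ S := by
  obtain ⟨K, H⟩ := exists_density_increment hd hS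
  refine ⟨K, fun ι _ _ A D hD hδ hn => ?_⟩
  by_contra hno
  have hA : ∀ x ∈ A, ∀ y ∈ A, ∀ z ∈ A, (∀ i, (x i, y i, z i) ∈ S) → x = y ∧ y = z := by
    intro x hx y hy z hz h
    by_contra hne
    exact hno ⟨x, hx, y, hy, z, hz, hne, h⟩
  have hE : (0 : ℝ) < (D : ℝ) ^ K := by
    have : (0 : ℝ) < D := by exact_mod_cast (by omega : 0 < D)
    positivity
  -- The density only grows, so `D` and the increment stay the same; t bounds the number of
  -- increments left before the density would exceed 1.
  have key : ∀ t : ℕ, ∀ (ι : Type) [Fintype ι] [DecidableEq ι] (A : Finset (ι → α)),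
      (∀ x ∈ A, ∀ y ∈ A, ∀ z ∈ A, (∀ i, (x i, y i, z i) ∈ S) → x = y ∧ y = z) →
      1 / (D : ℝ) ≤ 𝔼 x, ind A x → 1 - t / (D : ℝ) ^ K < 𝔼 x, ind A x →
      iterSize D (D ^ K) t ≤ Fintype.card ι → False := by
    intro t
    induction t with
    | zero =>
      intro ι _ _ A _ _ h _
      have h1 : 𝔼 x, ind A x ≤ 1 := expect_le_of_le zero_le_one fun x => by
        unfold ind; split_ifs <;> norm_num
      simp only [Nat.cast_zero, zero_div, sub_zero] at h
      linarith
    | succ t ih =>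
      intro ι _ _ A hA hδ h hn
      obtain ⟨m, hm, r, hr, hinc⟩ := H ι A hA D (iterSize D (D ^ K) t) hD
        (one_le_iterSize D _ (by omega) t) hδ hn
      let A' : Finset (Fin m → α) := univ.filter fun y => subpoint r y ∈ A
      have hmem : ∀ {y}, y ∈ A' ↔ subpoint r y ∈ A := by simp [A']
      have hind : ∀ y, ind A (subpoint r y) = ind A' y := fun y => by simp [ind, hmem]
      simp only [hind] at hinc
      have hpos : (0 : ℝ) < 1 / (D : ℝ) ^ K := by positivity
      refine ih (Fin m) A' ?_ (by linarith) ?_ (by simpa using hm)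
      · intro x hx y hy z hz hxyz
        have h1 := hA _ (hmem.1 hx) _ (hmem.1 hy) _ (hmem.1 hz) fun i => by
          simp only [subpoint]
          rcases r i with a | k
          · exact hd a
          · exact hxyz k
        exact ⟨subpoint_injective hr h1.1, subpoint_injective hr h1.2⟩
      · push_cast at h
        rw [add_div] at h
        linarith
  refine key (D ^ K) ι A hA hδ ?_ ?_
  · push_cast
    rw [div_self hE.ne', sub_self]
    refine lt_of_lt_of_le ?_ hδ
    have : (0 : ℝ) < D := by exact_mod_cast (by omega : 0 < D)
    positivity
  · refine le_trans ?_ hn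
    exact (Nat.le_mul_of_pos_right _ (by omega)).trans (iterSize_mul_le D _ (by omega) _)

/-- This is why n ≥ 16 makes the triple logarithm positive. -/
lemma exp_exp_one_lt : Real.exp (Real.exp 1) < 16 := by
  have h1 : Real.exp 1 < 4 * Real.log 2 := by
    have := Real.exp_one_lt_d9
    have := Real.log_two_gt_d9
    linarith
  calc Real.exp (Real.exp 1) < Real.exp (4 * Real.log 2) := Real.exp_lt_exp.2 h1
    _ = 16 := by
      rw [show (4 : ℝ) * Real.log 2 = Real.log (2 ^ 4) by rw [Real.log_pow]; norm_num,
        Real.exp_log (by norm_num)]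
      norm_num

lemma logloglog_spec {n : ℕ} (hn : 16 ≤ n) :
    0 < Real.log (Real.log (Real.log (n : ℝ))) ∧
      Real.exp (Real.exp (Real.exp (Real.log (Real.log (Real.log (n : ℝ)))))) = n := by
  have hn' : (16 : ℝ) ≤ n := by exact_mod_cast hn
  have h0 : (0 : ℝ) < n := by linarith
  have h1 : Real.exp 1 < Real.log n :=
    (Real.lt_log_iff_exp_lt h0).2 (exp_exp_one_lt.trans_le hn')
  have h2 : 0 < Real.log (n : ℝ) := (Real.exp_pos 1).trans h1
  have h3 : 1 < Real.log (Real.log (n : ℝ)) := (Real.lt_log_iff_exp_lt h2).2 h1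
  have h4 : 0 < Real.log (Real.log (n : ℝ)) := by linarith
  exact ⟨Real.log_pos h3, by rw [Real.exp_log h4, Real.exp_log h2, Real.exp_log h0]⟩

/-- With W = D ^ (K + 1) the required dimension is at most W ^ (W ^ W), which is compared with three
exponentials of 2W. The comparison is generous: the logarithm of W ^ W is only W log W. -/
lemma tower_le_of_le_logloglog {n D K : ℕ} (hn : 16 ≤ n) (hD : 2 ≤ D)
    (h : (D : ℝ) ^ (K + 2) ≤ Real.log (Real.log (Real.log (n : ℝ)))) :
    D ^ (D ^ K + 1) ^ D ^ K ≤ n := by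
  set W := D ^ (K + 1) with hW
  have hEW : D ^ K + 1 ≤ W := by
    have h1 : 1 ≤ D ^ K := Nat.one_le_pow _ _ (by omega)
    rw [hW, pow_succ]
    nlinarith
  have hDW : D ≤ W := Nat.le_self_pow (by omega) D
  have hW1 : 1 ≤ W := by omega
  have h1 : D ^ (D ^ K + 1) ^ D ^ K ≤ W ^ W ^ W :=
    calc D ^ (D ^ K + 1) ^ D ^ K ≤ W ^ (D ^ K + 1) ^ D ^ K := Nat.pow_le_pow_left hDW _
      _ ≤ W ^ W ^ W := Nat.pow_le_pow_right hW1 ((Nat.pow_le_pow_left hEW _).trans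
          (Nat.pow_le_pow_right hW1 (by omega)))
  refine h1.trans ?_
  have hWexp : (W : ℝ) ≤ Real.exp W := by linarith [Real.add_one_le_exp (W : ℝ)]
  have hW0 : (0 : ℝ) ≤ W := by positivity
  have h2 : ((W ^ W ^ W : ℕ) : ℝ) ≤ Real.exp (Real.exp (Real.exp (2 * W))) := by
    push_cast
    have h3 : (W : ℝ) ^ W ≤ Real.exp (W * W) := by
      rw [Real.exp_nat_mul]
      exact pow_le_pow_left₀ hW0 hWexp W
    have h4 : (W : ℝ) * W + W ≤ Real.exp (2 * W) := by
      have h5 := Real.add_one_le_exp (W : ℝ)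
      rw [two_mul, Real.exp_add]
      nlinarith
    have h6 : (W : ℝ) ^ W ^ W ≤ Real.exp ((W ^ W : ℕ) * W) := by
      rw [Real.exp_nat_mul]
      exact pow_le_pow_left₀ hW0 hWexp _
    refine h6.trans (Real.exp_le_exp.2 ?_)
    push_cast
    calc (W : ℝ) ^ W * W ≤ Real.exp (W * W) * Real.exp W := by gcongr
      _ = Real.exp (W * W + W) := (Real.exp_add _ _).symm
      _ ≤ _ := Real.exp_le_exp.2 h4
  have h3 : 2 * (W : ℝ) ≤ Real.log (Real.log (Real.log (n : ℝ))) := by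
    refine le_trans ?_ h
    rw [hW, pow_succ (D : ℝ) (K + 1)]
    push_cast
    have : (2 : ℝ) ≤ D := by exact_mod_cast hD
    have h4 : (0 : ℝ) ≤ (D : ℝ) ^ (K + 1) := by positivity
    nlinarith
  have h4 : ((W ^ W ^ W : ℕ) : ℝ) ≤ n := by
    rw [← (logloglog_spec hn).2]
    exact h2.trans (Real.exp_le_exp.2 (Real.exp_le_exp.2 (Real.exp_le_exp.2 h3)))
  exact_mod_cast h4

lemma expect_ind {n : ℕ} [Fintype α] [DecidableEq α] (A : Finset (Fin n → α)) :
    𝔼 x, ind A x = (A.card : ℝ) / (Fintype.card α : ℝ) ^ n := by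
  rw [Fintype.expect_eq_sum_div_card]
  simp [ind]

/-- Sets of density at least a negative power of the triple logarithm of the dimension contain a
nontrivial triple. -/
theorem exists_triple_of_density (α : Type*) [Fintype α] [Nontrivial α] :
    ∃ c C : ℝ, 0 < c ∧ 0 < C ∧
      ∀ S : Set (α × α × α), (∀ a : α, (a, a, a) ∈ S) → PairwiseConnected S →
      ∀ n : ℕ, 16 ≤ n → ∀ A : Finset (Fin n → α),
        C / (Real.log (Real.log (Real.log (n : ℝ)))) ^ c ≤
          (A.card : ℝ) / (Fintype.card α : ℝ) ^ n →
        ∃ x ∈ A, ∃ y ∈ A, ∃ z ∈ A, ¬ (x = y ∧ y = z) ∧ ∀ i, (x i, y i, z i) ∈ S := by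
  classical
  have h1 : ∀ S : Set (α × α × α), ∃ K : ℕ, (∀ a : α, (a, a, a) ∈ S) → PairwiseConnected S →
      ∀ (ι : Type) [Fintype ι] [DecidableEq ι] (A : Finset (ι → α)) (D : ℕ), 2 ≤ D →
        1 / (D : ℝ) ≤ 𝔼 x, ind A x → D ^ (D ^ K + 1) ^ D ^ K ≤ Fintype.card ι →
        ∃ x ∈ A, ∃ y ∈ A, ∃ z ∈ A, ¬ (x = y ∧ y = z) ∧ ∀ i, (x i, y i, z i) ∈ S := by
    intro S
    by_cases h : (∀ a : α, (a, a, a) ∈ S) ∧ PairwiseConnected S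
    · obtain ⟨K, hK⟩ := exists_dense_triple h.1 h.2
      exact ⟨K, fun _ _ => hK⟩
    · exact ⟨0, fun h2 h3 => absurd ⟨h2, h3⟩ h⟩
  choose K hK using h1
  -- There are finitely many sets `S`, so one exponent serves them all and the constants depend on
  -- `α` only.
  set k := univ.sup K with hk
  refine ⟨1 / (k + 2 : ℕ), 2, by positivity, two_pos, fun S hd hS n hn A hA => ?_⟩
  have hl := (logloglog_spec hn).1
  set l := Real.log (Real.log (Real.log (n : ℝ))) with hldef
  rw [← expect_ind] at hA
  -- The numerator 2 acts twice: density at most 1 forces X ≥ 2, and 2 / X ≥ 1 / ⌊X⌋ since X < ⌊X⌋ +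
  -- 1 ≤ 2⌊X⌋.
  set X := l ^ (1 / (k + 2 : ℕ) : ℝ) with hX
  have hX0 : 0 < X := Real.rpow_pos_of_pos hl _
  have hδ1 : 𝔼 x, ind A x ≤ 1 := expect_le_of_le zero_le_one fun x => by
    unfold ind; split_ifs <;> norm_num
  have hX2 : 2 ≤ X := by
    have := hA.trans hδ1
    rwa [div_le_one hX0] at this
  have hXl : X ^ (k + 2) = l := by
    rw [hX, one_div]
    exact Real.rpow_inv_natCast_pow hl.le (by omega)
  have hD2 : 2 ≤ ⌊X⌋₊ := Nat.le_floor (by exact_mod_cast hX2)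
  have hDX : (⌊X⌋₊ : ℝ) ≤ X := Nat.floor_le hX0.le
  have hXD : X < ⌊X⌋₊ + 1 := Nat.lt_floor_add_one X
  have hD2' : (2 : ℝ) ≤ ⌊X⌋₊ := by exact_mod_cast hD2
  refine hK S hd hS (Fin n) A ⌊X⌋₊ hD2 (le_trans ?_ hA) ?_
  · rw [div_le_div_iff₀ (by linarith) hX0]
    linarith
  · rw [Fintype.card_fin]
    refine tower_le_of_le_logloglog hn hD2 ?_
    rw [← hldef, ← hXl]
    calc (⌊X⌋₊ : ℝ) ^ (K S + 2) ≤ (⌊X⌋₊ : ℝ) ^ (k + 2) :=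
          pow_le_pow_right₀ (by linarith)
            (by have := Finset.le_sup (f := K) (mem_univ S); omega)
      _ ≤ X ^ (k + 2) := pow_le_pow_left₀ (by positivity) hDX _

end Iteration

/-! ### Restricted three-term progressions. -/

section Progressions

/-- The right vertex u + c joins the left vertices u and u + c, and multiples of c exhaust the
field. -/
lemma bipartiteGraph_connected {p : ℕ} [Fact p.Prime] {R : Set (ZMod p × ZMod p)} {c : ZMod p}
    (hc : c ≠ 0) (h0 : ∀ u, (u, u) ∈ R) (h1 : ∀ u, (u, u + c) ∈ R) :
    (bipartiteGraph R).Connected := by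
  have hlr : ∀ {a b}, (a, b) ∈ R → (bipartiteGraph R).Reachable (Sum.inl a) (Sum.inr b) :=
    fun {a b} h => SimpleGraph.Adj.reachable (Or.inl ⟨a, b, h, rfl, rfl⟩)
  have hk : ∀ k : ℕ, (bipartiteGraph R).Reachable (Sum.inl 0) (Sum.inl (k * c)) := by
    intro k
    induction k with
    | zero => simp
    | succ k ih =>
      refine ih.trans ((hlr (h1 _)).trans ?_)
      rw [Nat.cast_succ, add_mul, one_mul]
      exact (hlr (h0 _)).symm
  have hl : ∀ u, (bipartiteGraph R).Reachable (Sum.inl 0) (Sum.inl u) := by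
    intro u
    have := hk (u * c⁻¹).val
    rwa [ZMod.natCast_zmod_val, mul_assoc, inv_mul_cancel₀ hc, mul_one] at this
  have hall : ∀ v, (bipartiteGraph R).Reachable (Sum.inl 0) v := by
    rintro (u | u)
    · exact hl u
    · exact (hl u).trans (hlr (h0 u))
  exact ⟨fun v w => (hall v).symm.trans (hall w)⟩

/-- The triples in arithmetic progression with difference `0` or `1`. -/
def progressionTriples (p : ℕ) : Set (ZMod p × ZMod p × ZMod p) :=
  {t | ∃ u d, (d = 0 ∨ d = 1) ∧ t = (u, u + d, u + 2 * d)}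

/-- The first and third terms differ by 0 or 2; for them p ≥ 3 is needed, to have 2 ≠ 0. -/
lemma progressionTriples_connected {p : ℕ} [Fact p.Prime] (hp : 3 ≤ p) :
    PairwiseConnected (progressionTriples p) := by
  have h2 : (2 : ZMod p) ≠ 0 := by
    intro h
    have h' : ((2 : ℕ) : ZMod p) = 0 := by exact_mod_cast h
    rw [ZMod.natCast_eq_zero_iff] at h'
    have := Nat.le_of_dvd two_pos h'
    omega
  have hd : ∀ u, (u, u, u) ∈ progressionTriples p := fun u => ⟨u, 0, Or.inl rfl, by simp⟩
  have h1 : ∀ u, (u, u + 1, u + 2) ∈ progressionTriples p := fun u =>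
    ⟨u, 1, Or.inr rfl, by simp⟩
  refine ⟨bipartiteGraph_connected one_ne_zero (fun u => ⟨_, hd u⟩) fun u => ⟨_, h1 u⟩,
    bipartiteGraph_connected h2 (fun u => ⟨_, hd u⟩) fun u => ⟨_, h1 u⟩,
    bipartiteGraph_connected one_ne_zero (fun u => ⟨_, hd u⟩) fun u => ⟨u - 1, ?_⟩⟩
  have := h1 (u - 1)
  rwa [sub_add_cancel, show u - 1 + 2 = u + 1 by ring] at this

theorem exists_progression_of_density (p : ℕ) (hprime : p.Prime) (hp : 3 ≤ p) :
    ∃ c C : ℝ, 0 < c ∧ 0 < C ∧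
      ∀ n : ℕ, 16 ≤ n → ∀ A : Finset (Fin n → ZMod p),
        C / (Real.log (Real.log (Real.log (n : ℝ)))) ^ c ≤ (A.card : ℝ) / (p : ℝ) ^ n →
        ∃ x a : Fin n → ZMod p, (∀ i, a i = 0 ∨ a i = 1) ∧ a ≠ 0 ∧
          x ∈ A ∧ x + a ∈ A ∧ x + 2 • a ∈ A := by
  have : Fact p.Prime := ⟨hprime⟩
  obtain ⟨c, C, hc, hC, H⟩ := exists_triple_of_density (ZMod p)
  refine ⟨c, C, hc, hC, fun n hn A hA => ?_⟩
  obtain ⟨x, hx, y, hy, z, hz, hne, h⟩ := H (progressionTriples p)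
    (fun u => ⟨u, 0, Or.inl rfl, by simp⟩) (progressionTriples_connected hp) n hn A
    (by rwa [ZMod.card])
  choose u d hd h using h
  simp only [Prod.mk.injEq] at h
  obtain rfl : x = u := funext fun i => (h i).1
  obtain rfl : y = x + d := funext fun i => (h i).2.1
  obtain rfl : z = x + 2 • d := funext fun i => by simpa using (h i).2.2
  refine ⟨x, d, hd, ?_, hx, hy, hz⟩
  rintro rfl
  exact hne (by simp)

end Progressions

end TripleDensity

theorem mainTheorem3 :
    (∀ (α : Type*) [Fintype α] [Nontrivial α],
      ∃ c C : ℝ, 0 < c ∧ 0 < C ∧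
        ∀ S : Set (α × α × α), (∀ a : α, (a, a, a) ∈ S) → PairwiseConnected S →
        ∀ n : ℕ, 16 ≤ n → ∀ A : Finset (Fin n → α),
          C / (Real.log (Real.log (Real.log (n : ℝ)))) ^ c ≤
            (A.card : ℝ) / (Fintype.card α : ℝ) ^ n →
          ∃ x ∈ A, ∃ y ∈ A, ∃ z ∈ A, ¬ (x = y ∧ y = z) ∧ ∀ i, (x i, y i, z i) ∈ S) ∧
    (∀ p : ℕ, p.Prime → 3 ≤ p →
      ∃ c C : ℝ, 0 < c ∧ 0 < C ∧
        ∀ n : ℕ, 16 ≤ n → ∀ A : Finset (Fin n → ZMod p),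
          C / (Real.log (Real.log (Real.log (n : ℝ)))) ^ c ≤ (A.card : ℝ) / (p : ℝ) ^ n →
          ∃ x a : Fin n → ZMod p, (∀ i, a i = 0 ∨ a i = 1) ∧ a ≠ 0 ∧
            x ∈ A ∧ x + a ∈ A ∧ x + 2 • a ∈ A) :=
  ⟨fun α _ _ => TripleDensity.exists_triple_of_density α,
    TripleDensity.exists_progression_of_density⟩
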